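/- Work in ZFC. Let $\kappa$ be an ordinal that is a limit of measurable cardinals, i.e. $\kappa>0$ and for every $\alpha<\kappa$ there is a measurable cardinal $\mu$ with $\alpha<\mu<\kappa$ (so $\kappa$ is itself a cardinal). Let $\mathcal{H}_\kappa$ be the set of all sets whose transitive closure has cardinality $<\kappa$, and let $\mathrm{OR}$ be the class of ordinals. A class $Y$ is called $\Sigma_1(\mathcal{H}_\kappa\cup\mathrm{OR})$ if there are a $\Sigma_1$ formula $\varphi$ of the language of set theory (in the Lévy hierarchy) and parameters $p_0,\ldots,p_{n-1}\in\mathcal{H}_\kappa\cup\mathrm{OR}$ such that for all sets $y$ we have $y\in Y\iff\varphi(p_0,\ldots,p_{n-1},y)$; relations are regarded as classes of ordered pairs. Equip the set ${}^{\mathrm{cof}(\kappa)}\kappa$ of functions from $\mathrm{cof}(\kappa)$ to $\kappa$ with the topology whose basic open sets are the sets $\{x: s\subseteq x\}$ for functions $s:\xi\to\kappa$ with $\xi<\mathrm{cof}(\kappa)$, and equip $\mathcal{P}(\kappa)$ with the topology whose basic open sets are the sets $\{X\subseteq\kappa: X\cap\eta=a\}$ for $\eta<\kappa$ and $a\subseteq\eta$.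 A perfect embedding $\iota:{}^{\mathrm{cof}(\kappa)}\kappa\to\mathcal{P}(\kappa)$ is an injection that is a homeomorphism onto its range with the subspace topology. Then: 1. For every $\Sigma_1(\mathcal{H}_\kappa\cup\mathrm{OR})$ set $D\subseteq\mathcal{P}(\kappa)$ of cardinality $>\kappa$ there is a perfect embedding $\iota:{}^{\mathrm{cof}(\kappa)}\kappa\to\mathcal{P}(\kappa)$ with $\mathrm{rg}(\iota)\subseteq D$. 2. There are no set $D\subseteq\mathcal{P}(\kappa)$ of cardinality $>\kappa$ and (strict) wellorder $<^*$ of $D$ such that $<^*$ is $\Sigma_1(\mathcal{H}_\kappa\cup\mathrm{OR})$. 3. There are no $f$ and $C$ such that $f\subseteq\kappa^+\times\mathcal{P}(\kappa)$ is $\Sigma_1(\mathcal{H}_\kappa\cup\mathrm{OR})$, $C$ is a closed unbounded subset of $\kappa^+$, and $f\restriction C=f\cap(C\times\mathcal{P}(\kappa))$ is an injective function from $C$ to $\mathcal{P}(\kappa)$. -/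

import Mathlib

open Cardinal

universe u

namespace SigmaOne

/-! ### The Lévy class `Σ₁` over the universe of sets

The background universe `V` is Mathlib's `ZFSet.{u}`. -/

/-- The relation symbols of the language of set theory: one binary symbol for membership. -/
inductive SetRel : ℕ → Type
  | mem : SetRel 2

/-- The language of set theory. -/
def setLanguage : FirstOrder.Language.{0, 0} := ⟨fun _ => Empty, SetRel⟩

/-- The membership symbol. -/
abbrev memSymb : setLanguage.Relations 2 := SetRel.mem

/-- The universe of sets with its true membership relation. -/
instance : setLanguage.Structure ZFSet.{u} where
  funMap f := nomatch f
  RelMap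
    | SetRel.mem, v => v 0 ∈ v 1

/-- The atomic formula `s ∈ t`. -/
def memFormula {α : Type} {n : ℕ} (s t : setLanguage.Term (α ⊕ Fin n)) :
    setLanguage.BoundedFormula α n :=
  memSymb.boundedFormula₂ s t

/-- The bounded quantification `∀ x ∈ v, φ`, where `x` is the new last variable and `v` is one of
the variables available outside the quantifier. -/
def boundedAll {α : Type} {n : ℕ} (v : α ⊕ Fin n) (φ : setLanguage.BoundedFormula α (n + 1)) :
    setLanguage.BoundedFormula α n :=
  ((memFormula (.var (.inr (Fin.last n))) (.var (v.map id Fin.castSucc))).imp φ).all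

/-- `Δ₀` formulas: built from atomic formulas by propositional connectives (all of them are
expressed through `⊥` and `→`) and bounded quantification (`∃ x ∈ v, φ` is `¬ ∀ x ∈ v, ¬ φ`). -/
inductive IsDelta0 {α : Type} : ∀ {n : ℕ}, setLanguage.BoundedFormula α n → Prop
  | falsum {n : ℕ} : IsDelta0 (.falsum (n := n))
  | equal {n : ℕ} (s t : setLanguage.Term (α ⊕ Fin n)) : IsDelta0 (.equal s t)
  | mem {n : ℕ} (s t : setLanguage.Term (α ⊕ Fin n)) : IsDelta0 (memFormula s t)
  | imp {n : ℕ} {φ ψ : setLanguage.BoundedFormula α n} :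
      IsDelta0 φ → IsDelta0 ψ → IsDelta0 (φ.imp ψ)
  | boundedAll {n : ℕ} (v : α ⊕ Fin n) {φ : setLanguage.BoundedFormula α (n + 1)} :
      IsDelta0 φ → IsDelta0 (boundedAll v φ)

/-- `Σ₁` formulas: a block of unbounded existential quantifiers in front of a `Δ₀` formula. -/
inductive IsSigma1 {α : Type} : ∀ {n : ℕ}, setLanguage.BoundedFormula α n → Prop
  | of_delta0 {n : ℕ} {φ : setLanguage.BoundedFormula α n} : IsDelta0 φ → IsSigma1 φ
  | ex {n : ℕ} {φ : setLanguage.BoundedFormula α (n + 1)} : IsSigma1 φ → IsSigma1 φ.ex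

/-- The class `Y` is `Σ₁(P)`: there are a `Σ₁` formula `φ` and `p₀, …, pₙ₋₁ ∈ P` such that
`y ∈ Y ↔ φ(p₀, …, pₙ₋₁, y)` for all sets `y`. -/
def IsSigma1Definable (P Y : Set ZFSet.{u}) : Prop :=
  ∃ (n : ℕ) (φ : setLanguage.Formula (Fin n ⊕ Unit)) (p : Fin n → ZFSet.{u}),
    IsSigma1 φ ∧ (∀ i, p i ∈ P) ∧ ∀ y, y ∈ Y ↔ φ.Realize (Sum.elim p fun _ => y)

/-! ### Parameters and large cardinals -/

/-- `H_κ`: the sets whose transitive closure has cardinality `< κ`, that is, the subsets of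
transitive sets of cardinality `< κ`. -/
def hereditarySets (κ : Ordinal.{u}) : Set ZFSet.{u} :=
  {x | ∃ t : ZFSet.{u}, t.IsTransitive ∧ x ⊆ t ∧ t.card < κ.card}

/-- The class of (von Neumann) ordinals. -/
def ordinals : Set ZFSet.{u} := {x | x.IsOrdinal}

/-- `μ` is measurable: it is uncountable and carries a non-principal `μ`-complete ultrafilter. -/
def IsMeasurableCardinal (μ : Cardinal.{u}) : Prop :=
  ℵ₀ < μ ∧ ∃ U : Ultrafilter μ.out,
    (∀ x : μ.out, {x} ∉ U) ∧ CardinalInterFilter (U : Filter μ.out) μ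

/-- `κ` is a limit of measurable cardinals (and hence itself a cardinal). -/
def IsLimitOfMeasurables (κ : Ordinal.{u}) : Prop :=
  κ ≠ 0 ∧ ∀ α < κ, ∃ μ : Cardinal.{u}, IsMeasurableCardinal μ ∧ α < μ.ord ∧ μ.ord < κ

/-! ### Perfect embeddings -/

/-- The space `^θ κ` of all functions from `θ` to `κ`. -/
def FunSpace (θ κ : Ordinal.{u}) : Type (u + 1) := Set.Iio θ → Set.Iio κ

/-- The bounded topology on `^θ κ`: the basic open sets consist of all functions extending a given
function `s ↾ ξ : ξ → κ` with `ξ < θ`. -/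
instance (θ κ : Ordinal.{u}) : TopologicalSpace (FunSpace θ κ) :=
  .generateFrom {B | ∃ (s : FunSpace θ κ) (ξ : Set.Iio θ), B = {x | ∀ β < ξ, x β = s β}}

/-- The space `𝒫(κ)` of all subsets of the von Neumann ordinal `κ`. -/
def PowerSpace (κ : Ordinal.{u}) : Type (u + 1) := {X : ZFSet.{u} // X ⊆ κ.toZFSet}

/-- The bounded topology on `𝒫(κ)`: the basic open sets consist of all subsets of `κ` whose
intersection with a given `η < κ` is a given subset of `η`. -/
instance (κ : Ordinal.{u}) : TopologicalSpace (PowerSpace κ) :=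
  .generateFrom {B | ∃ (A : PowerSpace κ) (η : Set.Iio κ),
    B = {X | X.1 ∩ η.1.toZFSet = A.1 ∩ η.1.toZFSet}}

/-- A perfect embedding is an injection that is a homeomorphism onto its range. -/
def IsPerfectEmbedding {θ κ : Ordinal.{u}} (ι : FunSpace θ κ → PowerSpace κ) : Prop :=
  Topology.IsEmbedding ι

/-! ### Relations, functions and clubs -/

/-- The set relation `W` is a (strict) wellorder of the set `D`. -/
def IsWellorderOf (W D : ZFSet.{u}) : Prop :=
  W ⊆ ZFSet.prod D D ∧
    IsWellOrder {X : ZFSet.{u} // X ∈ D} fun X Y => ZFSet.pair X.1 Y.1 ∈ W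

/-- The restriction `f ↾ C` of a set relation `f` to `C`. -/
def restrict (f C : ZFSet.{u}) : ZFSet.{u} :=
  ZFSet.sep (fun z => ∃ a ∈ C, ∃ b, z = ZFSet.pair a b) f

/-- The set relation `g` is an injective function from `x` to `y`. -/
def IsInjectiveFunction (x y g : ZFSet.{u}) : Prop :=
  ZFSet.IsFunc x y g ∧ ∀ a b c, ZFSet.pair a c ∈ g → ZFSet.pair b c ∈ g → a = b

/-- The set `C` is a closed unbounded subset of the ordinal `γ`. -/
def IsClubIn (C : ZFSet.{u}) (γ : Ordinal.{u}) : Prop :=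
  C ⊆ γ.toZFSet ∧ IsClub {α : Set.Iio γ | α.1.toZFSet ∈ C}

/-- The cardinal successor `κ⁺`, as an ordinal. -/
noncomputable def succCard (κ : Ordinal.{u}) : Ordinal.{u} := (Order.succ κ.card).ord

end SigmaOne

/-! The tool is the iterated ultrapower of the universe by normal measures on measurable cardinals
below `κ`. A coordinate is a pair of a block `d` and a position `ν` in the iteration of the measure
on `d`. Elements of the iterate by a set `A` of coordinates are germs of functions of finitely many
coordinates in `A`, taken along one filter `iterFilter`. A Rowbottom-type partition theorem
(`exists_large_decide`) makes this filter decide every predicate of finite support, and countably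
many large sets always have a common point (`exists_forall_of_eventually`). So the iterate is
well-founded and collapses to a transitive class, and Łoś's theorem holds for `Δ₀` formulas. Since
`Σ₁` formulas go up from a transitive class to the universe, an embedding `emb A` that fixes the
parameters maps a `Σ₁` class into itself (`IsSigma1Definable.exists_emb_mem`).

Parameters in `H_κ` are fixed once all blocks are large enough. For ordinals, each one is moved by
only finitely many blocks of a sparse set of coordinates (`moving_finite`), and omitting these
blocks fixes it (`emO_res`). This also serves to fix `κ` itself, so that subsets of `κ` go to
subsets of `κ`.

The combinatorial core is a count. If iterations of two lengths `l`, `m` of the measure on `z` send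
`x` to sets that agree below the second image of `z`, then a long part of `x` is determined by `x ∩
z` and the iterations (`Agree.mem_iff`). Hence at most `κ` subsets of `κ` fail to be split at `z`
into `z + 1` different images (`mk_not_splitBelow_le`), and a set `D` of more than `κ` subsets has
an element `X` split at every measurable block.

Perfect set: along a cofinal tower of blocks, `s` selects the length of the iteration at each block,
and `s` is sent to the image of `X`. Blocks beyond `η` do not affect the image below `η`, and
splitting lets `s` be recovered.

Wellorder: with one nontrivial iteration at each of infinitely many blocks, every single block moves
`X` upwards in the order, since iterating a downward move would give a descending chain. Composing,
the images of `X` under the tails of the sequence of blocks strictly decrease.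

Club: some measure on `z < κ` has all its iterations of length less than `κ` fixing the parameters
and `κ`. Their common fixed points in the club are unbounded in `κ⁺`, the values of the injection
there are fixed too, and a fixed subset of `κ` is determined by its part below `z`. This leaves at
most `2 ^ |z| < κ` values. -/

namespace SigmaOne
open Filter Set

/-! ### Normal measures on ordinals -/

/-- `U` is a normal measure on `d`, regarded as an ultrafilter on the class of ordinals. -/
structure IsNormalMeasure (d : Ordinal.{u}) (U : Ultrafilter Ordinal.{u}) : Prop where
  omega0_lt : Ordinal.omega0 < d
  iio_mem : Iio d ∈ U
  ioi_mem : ∀ a < d, Ioi a ∈ U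
  regressive : ∀ f : Ordinal → Ordinal, (∀ᶠ a in (U : Filter Ordinal), f a < a) →
    ∃ c, ∀ᶠ a in (U : Filter Ordinal), f a = c

/-- `T` injects into a proper initial segment of `d`. -/
def Below (T : Type*) (d : Ordinal.{u}) : Prop :=
  ∃ (g : T → Ordinal.{u}) (e : Ordinal.{u}), e < d ∧ Function.Injective g ∧ ∀ t, g t < e

theorem Below.of_injective {S T : Type*} {d : Ordinal.{u}} (h : Below T d) (f : S → T)
    (hf : Function.Injective f) : Below S d := by
  obtain ⟨g, e, he, hg, hge⟩ := h
  exact ⟨g ∘ f, e, he, hg.comp hf, fun t => hge _⟩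

theorem below_iio {c d : Ordinal.{u}} (h : c < d) : Below (Iio c) d :=
  ⟨Subtype.val, c, h, Subtype.val_injective, fun t => t.2⟩

theorem below_nat {d : Ordinal.{u}} (h : Ordinal.omega0 < d) : Below ℕ d :=
  ⟨fun n => n, _, h, Nat.cast_injective, fun n => Ordinal.natCast_lt_omega0 n⟩

theorem below_of_mk_lt {T : Type u} {d : Ordinal.{u}} (h : #T < d.card) : Below T d := by
  have hd : (#T).ord < d := by
    by_contra hd
    have := Ordinal.card_le_card (not_lt.1 hd)
    rw [Cardinal.card_ord] at this
    exact absurd h (not_lt.2 this)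
  have : #T = #((#T).ord.ToType) := by simp
  obtain ⟨f⟩ := Cardinal.eq.1 this
  exact ⟨fun t => (Ordinal.ToType.mk.symm (f t)).1, _, hd,
    Subtype.val_injective.comp (Ordinal.ToType.mk.symm.injective.comp f.injective),
    fun t => (Ordinal.ToType.mk.symm (f t)).2⟩

namespace IsNormalMeasure

variable {d : Ordinal.{u}} {U : Ultrafilter Ordinal.{u}}

/-- Otherwise choosing some `a < c` with `c ∉ K a` is regressive on a large set, hence constant
there, and a single `K a` is not large. -/
theorem diag_mem (h : IsNormalMeasure d U) (K : Ordinal → Set Ordinal)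
    (hK : ∀ a < d, K a ∈ U) : {c | ∀ a < c, c ∈ K a} ∈ U := by
  classical
  by_contra hc
  have hc' := Ultrafilter.compl_mem_iff_notMem.2 hc
  let f : Ordinal → Ordinal := fun c => if h : ∃ a < c, c ∉ K a then h.choose else 0
  have hf : ∀ c, c ∈ {c | ∀ a < c, c ∈ K a}ᶜ → f c < c ∧ c ∉ K (f c) := by
    intro c hc
    have h : ∃ a < c, c ∉ K a := by simpa using hc
    simp only [f, dif_pos h]
    exact h.choose_spec
  obtain ⟨a, ha⟩ := h.regressive f (mem_of_superset hc' fun c hc => (hf c hc).1)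
  have key : ∀ᶠ c in (U : Filter Ordinal), a < d ∧ c ∉ K a := by
    filter_upwards [ha, hc', h.iio_mem] with c h1 h2 h3
    have := hf c h2
    rw [h1] at this
    exact ⟨this.1.trans h3, this.2⟩
  obtain ⟨c, hc⟩ := key.exists
  obtain ⟨c, hc1, hc2⟩ := (key.and (hK a hc.1)).exists
  exact hc1.2 hc2

/-- Completeness follows from normality: with the indices placed below some `e < d`, the diagonal
intersection beyond `e` lies in the full intersection. -/
theorem iInter_mem {T : Type*} (h : IsNormalMeasure d U) (hT : Below T d) (K : T → Set Ordinal)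
    (hK : ∀ t, K t ∈ U) : (⋂ t, K t) ∈ U := by
  obtain ⟨g, e, he, hg, hge⟩ := hT
  have := h.diag_mem (fun a => {x | ∀ t, g t = a → x ∈ K t}) (fun a _ => by
    by_cases hex : ∃ t, g t = a
    · obtain ⟨t, rfl⟩ := hex
      exact mem_of_superset (hK t) fun x hx s hs => hg hs ▸ hx
    · push Not at hex
      exact mem_of_superset univ_mem fun x _ t ht => absurd ht (hex t))
  filter_upwards [this, h.ioi_mem e he] with c h1 h2
  exact mem_iInter.2 fun t => h1 (g t) ((hge t).trans h2) t rfl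

/-- Recursion along `E`: only countably many earlier values have to be exceeded, and the measure is
countably complete because `ω < d`. -/
theorem exists_increasing (h : IsNormalMeasure d U) {E : Set Ordinal.{u}} (hE : E.Countable)
    {K : Set Ordinal.{u}} (hK : K ∈ U) :
    ∃ f : Ordinal.{u} → Ordinal.{u}, ∀ ν ∈ E, (f ν ∈ K ∧ f ν < d) ∧ ∀ μ ∈ E, μ < ν → f μ < f ν := by
  classical
  let f : Ordinal.{u} → Ordinal.{u} := WellFounded.fix (r := (· < ·)) wellFounded_lt
    fun ν ih => Classical.epsilon fun x => (x ∈ K ∧ x < d) ∧ ∀ μ (h : μ < ν), μ ∈ E → ih μ h < x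
  have hf : ∀ ν, f ν = Classical.epsilon
      fun x => (x ∈ K ∧ x < d) ∧ ∀ μ, μ < ν → μ ∈ E → f μ < x := fun ν => by
    simp only [f]; rw [WellFounded.fix_eq]
  have main : ∀ ν ∈ E, (f ν ∈ K ∧ f ν < d) ∧ ∀ μ, μ < ν → μ ∈ E → f μ < f ν := by
    intro ν
    induction ν using WellFoundedLT.induction with
    | ind ν ih =>
      intro _
      rw [hf ν]
      apply Classical.epsilon_spec (p := fun x => (x ∈ K ∧ x < d) ∧ ∀ μ, μ < ν → μ ∈ E → f μ < x)
      have : Countable {μ // μ ∈ E ∧ μ < ν} :=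
        (hE.mono fun x hx => hx.1 : ({μ | μ ∈ E ∧ μ < ν} : Set Ordinal).Countable).to_subtype
      obtain ⟨g, hg⟩ := exists_injective_nat {μ // μ ∈ E ∧ μ < ν}
      have h1 := h.iInter_mem ((below_nat h.omega0_lt).of_injective g hg)
        (fun μ => Ioi (f μ.1)) fun μ => h.ioi_mem _ (ih μ.1 μ.2.2 μ.2.1).1.2
      obtain ⟨x, ⟨h2, h3⟩, h4⟩ :=
        U.neBot.nonempty_of_mem (inter_mem (inter_mem hK h.iio_mem) h1)
      exact ⟨x, ⟨h2, h3⟩, fun μ hμ hμE => mem_iInter.1 h4 ⟨μ, hμE, hμ⟩⟩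
  exact ⟨f, fun ν hν => ⟨(main ν hν).1, fun μ hμ hlt => (main ν hν).2 μ hlt hμ⟩⟩

end IsNormalMeasure

/-- `d` carries a normal measure. -/
def Meas (d : Ordinal.{u}) : Prop := ∃ U, IsNormalMeasure d U

open Classical in
/-- A fixed normal measure on `d`, if there is one. -/
noncomputable def normalMeasure (d : Ordinal.{u}) : Ultrafilter Ordinal.{u} :=
  if h : Meas d then h.choose else pure 0

theorem Meas.isNormal {d : Ordinal.{u}} (h : Meas d) : IsNormalMeasure d (normalMeasure d) := by
  rw [normalMeasure, dif_pos h]; exact h.choose_spec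

theorem Meas.pos {d : Ordinal.{u}} (h : Meas d) : 0 < d :=
  (Ordinal.omega0_pos).trans h.isNormal.omega0_lt

/-! ### The finite support filter of the iteration -/

/-- A coordinate of the iteration: a block (an ordinal carrying a normal measure) and a position. -/
abbrev Coord : Type (u + 1) := Ordinal.{u} × Ordinal.{u}

/-- The points at which the functions representing elements of iterated ultrapowers live. -/
abbrev Pt : Type (u + 1) := Coord.{u} → Ordinal.{u}

/-- The basic large sets. -/
def Box (E : Finset Coord.{u}) (H : Ordinal.{u} → Set Ordinal.{u}) : Set Pt.{u} :=
  {w | (∀ i ∈ E, w i ∈ H i.1 ∧ w i < i.1) ∧ ∀ i ∈ E, ∀ j ∈ E, i.1 = j.1 → i.2 < j.2 → w i < w j}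

/-- A choice of large sets for all normal measures. -/
def Large (H : Ordinal.{u} → Set Ordinal.{u}) : Prop := ∀ d, Meas d → H d ∈ normalMeasure d

theorem Large.inter {H K : Ordinal.{u} → Set Ordinal.{u}} (hH : Large H) (hK : Large K) :
    Large fun d => H d ∩ K d := fun d hd => inter_mem (hH d hd) (hK d hd)

theorem large_univ : Large fun _ : Ordinal.{u} => univ := fun _ _ => univ_mem

theorem Box.mono {E E' : Finset Coord.{u}} {H H' : Ordinal.{u} → Set Ordinal.{u}} (hE : E' ⊆ E)
    (hH : ∀ i ∈ E', H i.1 ⊆ H' i.1) : Box E H ⊆ Box E' H' := fun _ hw =>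
  ⟨fun i hi => ⟨hH i hi (hw.1 i (hE hi)).1, (hw.1 i (hE hi)).2⟩,
    fun i hi j hj => hw.2 i (hE hi) j (hE hj)⟩

/-- The finite support filter. -/
def iterFilter : Filter Pt.{u} where
  sets := {S | ∃ (E : Finset Coord.{u}) (H : Ordinal.{u} → Set Ordinal.{u}), (∀ i ∈ E, Meas i.1) ∧ Large H ∧ Box E H ⊆ S}
  univ_sets := ⟨∅, fun _ => univ, by simp, large_univ, subset_univ _⟩
  sets_of_superset := fun ⟨E, H, h1, h2, h3⟩ h => ⟨E, H, h1, h2, h3.trans h⟩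
  inter_sets := by
    classical
    rintro S T ⟨E, H, h1, h2, h3⟩ ⟨E', H', h1', h2', h3'⟩
    refine ⟨E ∪ E', fun d => H d ∩ H' d, fun i hi => ?_, h2.inter h2', fun w hw => ⟨h3 ?_, h3' ?_⟩⟩
    · rcases Finset.mem_union.1 hi with h | h
      exacts [h1 i h, h1' i h]
    · exact Box.mono Finset.subset_union_left (fun i _ => inter_subset_left) hw
    · exact Box.mono Finset.subset_union_right (fun i _ => inter_subset_right) hw

theorem eventually_iter {P : Pt.{u} → Prop} : (∀ᶠ w in iterFilter, P w) ↔
    ∃ (E : Finset Coord.{u}) (H : Ordinal.{u} → Set Ordinal.{u}),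
      (∀ i ∈ E, Meas i.1) ∧ Large H ∧ ∀ w ∈ Box E H, P w := Iff.rfl

/-- In each block only countably many positions and large sets occur, so one increasing choice of
values serves all the boxes at once. This is the source of well-foundedness and of the properness of
the filter. -/
theorem exists_forall_of_eventually {P : ℕ → Pt.{u} → Prop}
    (h : ∀ n, ∀ᶠ w in iterFilter, P n w) : ∃ w, ∀ n, P n w := by
  classical
  simp only [eventually_iter] at h
  choose E H hE hH hP using h
  have key : ∀ d, Meas d → ∃ f : Ordinal.{u} → Ordinal.{u}, ∀ ν ∈ {ν | ∃ n, (d, ν) ∈ E n},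
      (f ν ∈ ⋂ n, H n d ∧ f ν < d) ∧ ∀ μ ∈ {ν | ∃ n, (d, ν) ∈ E n}, μ < ν → f μ < f ν := by
    intro d hd
    refine hd.isNormal.exists_increasing ?_
      (hd.isNormal.iInter_mem (below_nat hd.isNormal.omega0_lt) _ fun n => hH n d hd)
    have : {ν | ∃ n, (d, ν) ∈ E n} = ⋃ n, Prod.snd '' {i ∈ (E n : Set Coord) | i.1 = d} := by
      ext ν; simp
    rw [this]
    exact countable_iUnion fun n => (((E n).finite_toSet.subset (sep_subset _ _)).image _).countable
  choose f hf using key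
  refine ⟨fun i => if h : Meas i.1 then f i.1 h i.2 else 0, fun n => hP n _ ⟨fun i hi => ?_, ?_⟩⟩
  · have h := hE n i hi
    simp only [dif_pos h]
    have := (hf i.1 h i.2 ⟨n, hi⟩).1
    exact ⟨mem_iInter.1 this.1 n, this.2⟩
  · rintro ⟨d, ν⟩ hi ⟨d', ν'⟩ hj hd hlt
    dsimp at hd hlt
    subst hd
    have h := hE n _ hi
    dsimp at h
    simp only [dif_pos h]
    exact (hf d h ν' ⟨n, hj⟩).2 ν ⟨n, hi⟩ hlt

instance : (iterFilter.{u}).NeBot := by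
  refine ⟨fun h => ?_⟩
  obtain ⟨w, hw⟩ := exists_forall_of_eventually (P := fun _ _ => False) fun _ => by
    rw [h]; exact Filter.eventually_bot
  exact hw 0

/-- Rowbottom's argument. With the value `a` at the lexicographically least coordinate `i` fixed,
induction decides the rest by large sets `K a`; the measure on the block of `i` then decides which
outcome is typical. The `K a` are amalgamated by a diagonal intersection in the block of `i`, where
later values exceed `a`, and by plain intersections over `a < i.1` in higher blocks. -/
theorem exists_large_decide (E : Finset Coord.{u}) (hE : ∀ i ∈ E, Meas i.1) (P : Pt.{u} → Prop)
    (hP : DependsOn P E) :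
    ∃ H, Large H ∧ ((∀ w ∈ Box E H, P w) ∨ ∀ w ∈ Box E H, ¬ P w) := by
  classical
  induction hn : E.card generalizing E P with
  | zero =>
    obtain rfl := Finset.card_eq_zero.1 hn
    refine ⟨_, large_univ, ?_⟩
    have : ∀ w v, P w = P v := fun w v => hP (by simp)
    by_cases h : P 0
    · exact .inl fun w _ => by rw [this w 0]; exact h
    · exact .inr fun w _ => by rw [this w 0]; exact h
  | succ n ih =>
    obtain ⟨i, hi, hmin⟩ := E.exists_min_image (fun j => toLex j)
      (Finset.card_pos.1 (by omega))
    have hmin' : ∀ j ∈ E.erase i, i.1 < j.1 ∨ i.1 = j.1 ∧ i.2 < j.2 := by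
      intro j hj
      have h1 := hmin j (Finset.mem_of_mem_erase hj)
      have h2 : toLex i ≠ toLex j := fun h => Finset.ne_of_mem_erase hj (toLex.injective h).symm
      simpa [Prod.Lex.lt_iff] using lt_of_le_of_ne h1 h2
    have step : ∀ a : Ordinal.{u}, ∃ H, Large H ∧
        ((∀ w ∈ Box (E.erase i) H, P (Function.update w i a)) ∨
          ∀ w ∈ Box (E.erase i) H, ¬ P (Function.update w i a)) := fun a =>
      ih (E.erase i) (fun j hj => hE j (Finset.mem_of_mem_erase hj))
        (fun w => P (Function.update w i a)) (fun w v hwv => hP fun j hj => by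
          by_cases hji : j = i
          · subst hji; simp
          · simp only [Function.update_of_ne hji]
            exact hwv j (Finset.mem_coe.2 (Finset.mem_erase.2 ⟨hji, hj⟩)))
        (by rw [Finset.card_erase_of_mem hi, hn]; rfl)
    choose K hK hdec using step
    have hm := hE i hi
    let T : Set Ordinal.{u} := {a | ∀ w ∈ Box (E.erase i) (K a), P (Function.update w i a)}
    have hT : ∃ S ∈ normalMeasure i.1, (S ⊆ T ∨ S ⊆ Tᶜ) := by
      rcases (normalMeasure i.1).mem_or_compl_mem T with h | h
      exacts [⟨T, h, .inl subset_rfl⟩, ⟨_, h, .inr subset_rfl⟩]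
    obtain ⟨S, hS, hST⟩ := hT
    let H : Ordinal.{u} → Set Ordinal.{u} := fun d =>
      if d = i.1 then S ∩ {c | ∀ a < c, c ∈ K a d} else if i.1 < d then ⋂ a : Iio i.1, K a.1 d
      else univ
    have hH : Large H := by
      intro d hd
      simp only [H]
      split_ifs with h1 h2
      · subst h1
        exact inter_mem hS (hd.isNormal.diag_mem _ fun a _ => hK a _ hd)
      · exact hd.isNormal.iInter_mem (below_iio h2) _ fun a => hK _ _ hd
      · exact univ_mem
    have hbox : ∀ w ∈ Box E H, w i ∈ S ∧ w ∈ Box (E.erase i) (K (w i)) := by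
      intro w hw
      refine ⟨?_, fun j hj => ⟨?_, (hw.1 j (Finset.mem_of_mem_erase hj)).2⟩, fun j hj k hk =>
        hw.2 j (Finset.mem_of_mem_erase hj) k (Finset.mem_of_mem_erase hk)⟩
      · have := (hw.1 i hi).1
        simp only [H, if_true] at this
        exact this.1
      · have hj' := hw.1 j (Finset.mem_of_mem_erase hj)
        rcases hmin' j hj with h | h
        · have := hj'.1
          simp only [H, if_neg h.ne', if_pos h] at this
          exact mem_iInter.1 this ⟨w i, (hw.1 i hi).2⟩
        · have h3 := hj'.1
          simp only [H, if_pos h.1.symm] at h3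
          exact h3.2 (w i) (hw.2 i hi j (Finset.mem_of_mem_erase hj) h.1 h.2)
    refine ⟨H, hH, ?_⟩
    rcases hST with h | h
    · left
      intro w hw
      have := h (hbox w hw).1 w (hbox w hw).2
      rwa [Function.update_eq_self] at this
    · right
      intro w hw
      have := (hdec (w i)).resolve_left (h (hbox w hw).1) w (hbox w hw).2
      rwa [Function.update_eq_self] at this

/-! ### Functions of finite support -/

/-- `f` depends on finitely many coordinates, all of them in the (small) set `A`. -/
def Fn (A : Set Coord.{u}) {β : Type*} (f : Pt.{u} → β) : Prop :=
  Small.{u} A ∧ ∃ E : Finset Coord.{u}, (∀ i ∈ E, i ∈ A ∧ Meas i.1) ∧ DependsOn f (E : Set Coord.{u})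

theorem Fn.mono {A B : Set Coord.{u}} {β : Type*} {f : Pt.{u} → β} (h : Fn A f) (hAB : A ⊆ B)
    (hB : Small.{u} B) : Fn B f := by
  obtain ⟨_, E, hE, hf⟩ := h
  exact ⟨hB, E, fun i hi => ⟨hAB (hE i hi).1, (hE i hi).2⟩, hf⟩

theorem fn_const {A : Set Coord.{u}} (hA : Small.{u} A) {β : Type*} (b : β) :
    Fn A fun _ : Pt.{u} => b := ⟨hA, ∅, by simp, fun _ _ _ => rfl⟩

theorem Fn.comp {A : Set Coord.{u}} {β γ : Type*} {f : Pt.{u} → β} (h : Fn A f) (g : β → γ) :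
    Fn A fun w => g (f w) := by
  obtain ⟨hA, E, hE, hf⟩ := h
  exact ⟨hA, E, hE, fun w v hwv => congrArg g (hf hwv)⟩

theorem Fn.comp₂ {A : Set Coord.{u}} {β γ δ : Type*} {f : Pt.{u} → β} {f' : Pt.{u} → γ}
    (h : Fn A f) (h' : Fn A f') (g : β → γ → δ) : Fn A fun w => g (f w) (f' w) := by
  classical
  obtain ⟨hA, E, hE, hf⟩ := h
  obtain ⟨-, E', hE', hf'⟩ := h'
  refine ⟨hA, E ∪ E', fun i hi => ?_, fun w v hwv => ?_⟩
  · rcases Finset.mem_union.1 hi with h | h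
    exacts [hE i h, hE' i h]
  · have h1 := hf (x := w) (y := v) fun i hi => hwv i (by
      push_cast; exact .inl hi)
    have h2 := hf' (x := w) (y := v) fun i hi => hwv i (by push_cast; exact .inr hi)
    simp only [h1, h2]

theorem fn_pi {A : Set Coord.{u}} (hA : Small.{u} A) {ι : Type*} [Finite ι] {β : Type*}
    {f : ι → Pt.{u} → β} (h : ∀ i, Fn A (f i)) : Fn A fun w i => f i w := by
  classical
  cases nonempty_fintype ι
  choose _ E hE hf using h
  refine ⟨hA, Finset.univ.biUnion E, fun i hi => ?_, fun w v hwv => ?_⟩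
  · obtain ⟨j, -, hj⟩ := Finset.mem_biUnion.1 hi
    exact hE j i hj
  · funext j
    exact hf j fun i hi => hwv i (by
      simp only [Finset.coe_biUnion, mem_iUnion]; exact ⟨j, by simp, hi⟩)

theorem fn_coord {A : Set Coord.{u}} (hA : Small.{u} A) {i : Coord.{u}} (hi : i ∈ A)
    (hm : Meas i.1) : Fn A fun w : Pt.{u} => w i :=
  ⟨hA, {i}, by simp [hi, hm], fun w v hwv => hwv i (by simp)⟩

/-- For predicates of finite support the filter acts as an ultrafilter; this is what drives Łoś's
theorem. -/
theorem Fn.em {A : Set Coord.{u}} {P : Pt.{u} → Prop} (h : Fn A P) :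
    (∀ᶠ w in iterFilter, P w) ∨ ∀ᶠ w in iterFilter, ¬ P w := by
  obtain ⟨hA, E, hE, hf⟩ := h
  obtain ⟨H, hH, h | h⟩ := exists_large_decide E (fun i hi => (hE i hi).2) P hf
  · exact .inl (eventually_iter.2 ⟨E, H, fun i hi => (hE i hi).2, hH, h⟩)
  · exact .inr (eventually_iter.2 ⟨E, H, fun i hi => (hE i hi).2, hH, h⟩)

theorem Fn.eventually_not {A : Set Coord.{u}} {P : Pt.{u} → Prop} (h : Fn A P) :
    (∀ᶠ w in iterFilter, ¬ P w) ↔ ¬ ∀ᶠ w in iterFilter, P w := by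
  refine ⟨fun h1 h2 => ?_, fun h1 => h.em.resolve_left h1⟩
  obtain ⟨w, hw1, hw2⟩ := (h1.and h2).exists
  exact hw1 hw2

theorem eventually_box {E : Finset Coord.{u}} (hE : ∀ i ∈ E, Meas i.1) {P : Pt.{u} → Prop}
    (hP : DependsOn P E) (h : ∀ᶠ w in iterFilter, P w) : ∃ H, Large H ∧ ∀ w ∈ Box E H, P w := by
  obtain ⟨H, hH, h' | h'⟩ := exists_large_decide E hE P hP
  · exact ⟨H, hH, h'⟩
  · obtain ⟨w, hw1, hw2⟩ := (h.and (eventually_iter.2 ⟨E, H, hE, hH, h'⟩)).exists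
    exact absurd hw1 hw2

/-- The critical point argument: if every value were avoided on a box, the boxes for all values
could be intersected, because `T` is smaller than each block. -/
theorem Fn.eventually_const {A : Set Coord.{u}} {T : Type*} {f : Pt.{u} → T} (h : Fn A f)
    (hT : ∀ i ∈ A, Meas i.1 → Below T i.1) : ∃ t, ∀ᶠ w in iterFilter, f w = t := by
  obtain ⟨hA, E, hE, hf⟩ := h
  by_contra hno
  rw [not_exists] at hno
  have : ∀ t, ∃ H, Large H ∧ ∀ w ∈ Box E H, f w ≠ t := fun t => by
    have hd : DependsOn (fun w => f w ≠ t) (E : Set Coord) := fun w v hwv => by simp [hf hwv]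
    refine eventually_box (fun i hi => (hE i hi).2) hd ?_
    have : Fn A fun w => f w = t := ⟨hA, E, hE, fun w v hwv => by simp [hf hwv]⟩
    exact this.eventually_not.2 (hno t)
  choose H hH hne using this
  classical
  -- Only the blocks occurring in `E` are known to exceed `T`, so nothing is intersected elsewhere.
  let K : Ordinal.{u} → Set Ordinal.{u} := fun d => if d ∈ E.image Prod.fst then ⋂ t, H t d else univ
  have hK : Large K := by
    intro d hd
    simp only [K]
    split_ifs with h
    · obtain ⟨i, hi, rfl⟩ := Finset.mem_image.1 h
      exact hd.isNormal.iInter_mem (hT i (hE i hi).1 hd) _ fun t => hH t _ hd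
    · exact univ_mem
  obtain ⟨w, hw⟩ := (eventually_iter.2 ⟨E, K, fun i hi => (hE i hi).2, hK, fun w hw => hw⟩ :
    ∀ᶠ w in iterFilter, w ∈ Box E K).exists
  refine hne (f w) w (Box.mono subset_rfl (fun i hi => ?_) hw) rfl
  simp only [K, if_pos (Finset.mem_image_of_mem Prod.fst hi)]
  exact iInter_subset _ _

/-! ### Fubini and indiscernibility -/

open Classical in
/-- The point that agrees with `b` on `B` and with `a` elsewhere. -/
noncomputable def glue (B : Set Coord.{u}) (b a : Pt.{u}) : Pt.{u} := fun i => if i ∈ B then b i else a i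

theorem glue_of_mem {B : Set Coord.{u}} {b a : Pt.{u}} {i : Coord.{u}} (h : i ∈ B) :
    glue B b a i = b i := if_pos h

theorem glue_of_notMem {B : Set Coord.{u}} {b a : Pt.{u}} {i : Coord.{u}} (h : i ∉ B) :
    glue B b a i = a i := if_neg h

/-- In every block, the positions in `B` precede those that are not in `B`. -/
def IsCut (B : Set Coord.{u}) : Prop := ∀ i ∈ B, ∀ j ∉ B, i.1 = j.1 → i.2 < j.2

theorem IsCut.of_blocks (S : Set Ordinal.{u}) : IsCut {i : Coord.{u} | i.1 ∈ S} :=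
  fun _ hi j hj h => absurd (show j.1 ∈ S from h ▸ hi) hj

/-- A Fubini theorem. Once `b` is fixed, the large sets are cut down to points above the finitely
many values of `b` in their block; as `B` is a cut, the glued point is then increasing in each
block. -/
theorem eventually_glue {B : Set Coord.{u}} (hB : IsCut B) {P : Pt.{u} → Prop}
    (h : ∀ᶠ w in iterFilter, P w) :
    ∀ᶠ b in iterFilter, ∀ᶠ a in iterFilter, P (glue B b a) := by
  classical
  obtain ⟨E, H, hE, hH, hP⟩ := eventually_iter.1 h
  refine eventually_iter.2 ⟨E, H, hE, hH, fun b hb => ?_⟩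
  let K : Ordinal.{u} → Set Ordinal.{u} := fun d => H d ∩ {c | ∀ i ∈ E, i.1 = d → b i < c}
  have hK : Large K := by
    intro d hd
    refine inter_mem (hH d hd) ?_
    have : {c | ∀ i ∈ E, i.1 = d → b i < c} = ⋂ i ∈ E, {c | i.1 = d → b i < c} := by
      ext c; simp
    rw [this]
    refine (Finset.iInter_mem_sets E).2 fun i hi => ?_
    by_cases h : i.1 = d
    · exact mem_of_superset (hd.isNormal.ioi_mem (b i) (h ▸ (hb.1 i hi).2)) fun c hc _ => hc
    · exact mem_of_superset univ_mem fun c _ h' => absurd h' h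
  refine eventually_iter.2 ⟨E, K, hE, hK, fun a ha => hP _ ⟨fun i hi => ?_, fun i hi j hj hij hlt => ?_⟩⟩
  · by_cases hiB : i ∈ B
    · rw [glue_of_mem hiB]; exact hb.1 i hi
    · rw [glue_of_notMem hiB]; exact ⟨(ha.1 i hi).1.1, (ha.1 i hi).2⟩
  · by_cases hiB : i ∈ B <;> by_cases hjB : j ∈ B
    · rw [glue_of_mem hiB, glue_of_mem hjB]; exact hb.2 i hi j hj hij hlt
    · rw [glue_of_mem hiB, glue_of_notMem hjB]
      exact (ha.1 j hj).1.2 i hi hij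
    · exact absurd (hB j hjB i hiB hij.symm) (not_lt.2 hlt.le)
    · rw [glue_of_notMem hiB, glue_of_notMem hjB]; exact ha.2 i hi j hj hij hlt

theorem Fn.eventually_glue_iff {A B : Set Coord.{u}} (hB : IsCut B) {P : Pt.{u} → Prop}
    (hP : Fn A P) : (∀ᶠ b in iterFilter, ∀ᶠ a in iterFilter, P (glue B b a)) ↔
      ∀ᶠ w in iterFilter, P w := by
  refine ⟨fun h => ?_, eventually_glue hB⟩
  refine hP.em.resolve_right fun h' => ?_
  obtain ⟨b, h1, h2⟩ := (h.and (eventually_glue hB h')).exists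
  obtain ⟨a, h3, h4⟩ := (h1.and h2).exists
  exact h4 h3

end SigmaOne

namespace SigmaOne
open Filter Set

/-! ### Codes for functions of finite support -/

/-- Codes for the functions with values in `T` that depend on finitely many coordinates in `A`. -/
def Code (A : Set Coord.{u}) (T : Type*) : Type _ :=
  Σ E : Finset A, ((e : E) → Iio e.1.1.1) → T

instance {A : Set Coord.{u}} [Small.{u} A] {T : Type*} [Small.{u} T] : Small.{u} (Code A T) := by
  have : Small.{u} (Finset A) :=
    small_of_injective (f := fun E : Finset A => (E : Set A)) Finset.coe_injective
  unfold Code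
  infer_instance

open Classical in
/-- The function described by a code. -/
noncomputable def Code.eval {A : Set Coord.{u}} {T : Type*} (p : Code A T) (t₀ : T) (w : Pt.{u}) : T :=
  if h : ∀ e : p.1, w e.1.1 ∈ Iio e.1.1.1 then p.2 fun e => ⟨w e.1.1, h e⟩ else t₀

/-- Almost everywhere `w i < i.1`, so only the values of `f` on a set-sized product matter. Codes
make the iterate set-like and later bound the images of ordinals. -/
theorem Fn.exists_code {A : Set Coord.{u}} {β : Type*} {f : Pt.{u} → β} (hf : Fn A f) {T : Set β}
    (h : ∀ᶠ w in iterFilter, f w ∈ T) (t₀ : T) :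
    ∃ p : Code A T, ∀ᶠ w in iterFilter, f w = p.eval t₀ w := by
  classical
  obtain ⟨hA, E, hE, hdep⟩ := hf
  let ext : ((e : E.subtype (· ∈ A)) → Iio e.1.1.1) → Pt.{u} := fun v i =>
    if h : i ∈ A ∧ i ∈ E then
      (v ⟨⟨i, h.1⟩, Finset.mem_subtype.2 h.2⟩).1 else 0
  let q : ((e : E.subtype (· ∈ A)) → Iio e.1.1.1) → T := fun v =>
    if h : f (ext v) ∈ T then ⟨f (ext v), h⟩ else t₀
  have hq : ∀ v, f (ext v) ∈ T → (q v).1 = f (ext v) := fun v hv => by simp only [q, dif_pos hv]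
  refine ⟨⟨E.subtype (· ∈ A), q⟩, ?_⟩
  have hbox : ∀ᶠ w in iterFilter, w ∈ Box E fun _ => univ :=
    eventually_iter.2 ⟨E, _, fun i hi => (hE i hi).2, large_univ, fun w hw => hw⟩
  filter_upwards [h, hbox] with w hw hwb
  have h1 : ∀ e : E.subtype (· ∈ A), w e.1.1 ∈ Iio e.1.1.1 := fun e =>
    mem_Iio.2 (hwb.1 _ (Finset.mem_subtype.1 e.2)).2
  have h2 : f (ext fun e => ⟨w e.1.1, h1 e⟩) = f w := hdep fun i hi => by
    have : i ∈ A ∧ i ∈ E := ⟨(hE i hi).1, hi⟩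
    simp only [ext, dif_pos this]
  have h3 : f (ext fun e => ⟨w e.1.1, h1 e⟩) ∈ T := by rw [h2]; exact hw
  refine Eq.trans ?_ (congrArg Subtype.val (dif_pos h1)).symm
  exact h2.symm.trans (hq (fun e => ⟨w e.1.1, h1 e⟩) h3).symm

/-! ### The transitive collapse -/

/-- The iterated ultrapower with coordinates in `A`. -/
abbrev Iter (A : Set Coord.{u}) : Type (u + 1) :=
  {q : Germ iterFilter.{u} ZFSet.{u} // ∃ f : Pt.{u} → ZFSet.{u}, Fn A f ∧ (f : Germ iterFilter ZFSet) = q}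

/-- The membership relation of the iterated ultrapower. -/
def Iter.mem {A : Set Coord.{u}} (q r : Iter A) : Prop := q.1.LiftRel (· ∈ ·) r.1

/-- A descending chain of germs, evaluated at a common point of its countably many large sets, would
descend in the universe. -/
theorem Iter.wf (A : Set Coord.{u}) : WellFounded (Iter.mem (A := A)) := by
  rw [wellFounded_iff_isEmpty_descending_chain]
  refine ⟨fun ⟨q, hq⟩ => ?_⟩
  choose f hf hfq using fun n => (q n).2
  have : ∀ n, ∀ᶠ w in iterFilter, f (n + 1) w ∈ f n w := fun n => by
    have := hq n
    rw [Iter.mem, ← hfq, ← hfq, Germ.liftRel_coe] at this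
    exact this
  obtain ⟨w, hw⟩ := exists_forall_of_eventually this
  exact (wellFounded_iff_isEmpty_descending_chain.1 ZFSet.mem_wf).false ⟨fun n => f n w, hw⟩

/-- Set-likeness, as the collapse requires: the members of the germ of `f` are represented by
functions into the set `T` of elements of the values of `f` on boxes, and those have only a set of
codes. -/
instance {A : Set Coord.{u}} (q : Iter A) : Small.{u} {r : Iter A // r.mem q} := by
  obtain ⟨q, f, hf, rfl⟩ := q
  have hA : Small.{u} A := hf.1
  obtain ⟨-, E, hE, hdep⟩ := hf
  let T : Set ZFSet.{u} := ⋃ v : (e : E) → Iio e.1.1, {x | x ∈ f fun i =>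
    open Classical in if h : i ∈ E then (v ⟨i, h⟩).1 else 0}
  have hT : Small.{u} T := by
    have : ∀ x : ZFSet.{u}, Small.{u} {y | y ∈ x} := fun x => inferInstanceAs (Small.{u} x)
    exact small_iUnion _
  let g : Code A ↥(insert ∅ T) → Germ iterFilter.{u} ZFSet.{u} := fun p =>
    ((fun w => (p.eval ⟨∅, mem_insert _ _⟩ w).1 : Pt → ZFSet) : Germ iterFilter ZFSet)
  have hsm : Small.{u} (range g) := by
    have : Small.{u} ↥(insert ∅ T) := small_insert _ _
    infer_instance
  have key : ∀ r : {r : Iter A // r.mem ⟨(f : Germ iterFilter ZFSet), f, ⟨hA, E, hE, hdep⟩, rfl⟩},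
      r.1.1 ∈ range g := by
    rintro ⟨⟨-, h, hh, rfl⟩, hr⟩
    have hr' : ∀ᶠ w in iterFilter, h w ∈ f w := hr
    have hbox : ∀ᶠ w in iterFilter, w ∈ Box E fun _ => univ :=
      eventually_iter.2 ⟨E, _, fun i hi => (hE i hi).2, large_univ, fun w hw => hw⟩
    obtain ⟨p, hp⟩ := hh.exists_code (T := insert ∅ T) (by
      filter_upwards [hr', hbox] with w hw hwb
      refine .inr (mem_iUnion.2 ⟨fun e => ⟨w e.1, mem_Iio.2 (hwb.1 e.1 e.2).2⟩, ?_⟩)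
      exact (congrArg (h w ∈ ·) (hdep fun i hi => dif_pos (Finset.mem_coe.1 hi))).mpr hw) ⟨∅, mem_insert _ _⟩
    exact ⟨p, Germ.coe_eq.2 (hp.mono fun w hw => hw.symm)⟩
  exact small_of_injective (f := fun r => (⟨r.1.1, key r⟩ : range g)) fun r s h => by
    apply Subtype.ext
    apply Subtype.ext
    have h' := congrArg (fun x : range g => x.1) h
    exact h'

/-- The Mostowski collapse of the iterated ultrapower. -/
noncomputable def Iter.collapse {A : Set Coord.{u}} : Iter A → ZFSet.{u} :=
  WellFounded.fix (Iter.wf A) fun q ih => ZFSet.range fun r : {r : Iter A // r.mem q} => ih r.1 r.2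

theorem Iter.mem_collapse {A : Set Coord.{u}} {q : Iter A} {z : ZFSet.{u}} :
    z ∈ q.collapse ↔ ∃ r : Iter A, r.mem q ∧ r.collapse = z := by
  rw [Iter.collapse, WellFounded.fix_eq, ZFSet.mem_range]
  exact ⟨fun ⟨r, hr⟩ => ⟨r.1, r.2, hr⟩, fun ⟨r, h, hr⟩ => ⟨⟨r, h⟩, hr⟩⟩

open Classical in
/-- The element of the collapsed iterated ultrapower represented by `f`. -/
noncomputable def col (A : Set Coord.{u}) (f : Pt.{u} → ZFSet.{u}) : ZFSet.{u} :=
  if h : Fn A f then Iter.collapse (A := A) ⟨(f : Germ iterFilter ZFSet), f, h, rfl⟩ else ∅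

variable {A : Set Coord.{u}} {f g : Pt.{u} → ZFSet.{u}}

theorem col_congr (hf : Fn A f) (hg : Fn A g) (h : ∀ᶠ w in iterFilter, f w = g w) :
    col A f = col A g := by
  rw [col, col, dif_pos hf, dif_pos hg]
  congr 2
  exact Germ.coe_eq.2 h

theorem mem_col (hf : Fn A f) {z : ZFSet.{u}} :
    z ∈ col A f ↔ ∃ g, Fn A g ∧ (∀ᶠ w in iterFilter, g w ∈ f w) ∧ col A g = z := by
  rw [col, dif_pos hf, Iter.mem_collapse]
  constructor
  · rintro ⟨⟨-, g, hg, rfl⟩, h1, h2⟩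
    refine ⟨g, hg, h1, ?_⟩
    rw [col, dif_pos hg]
    exact h2
  · rintro ⟨g, hg, h1, h2⟩
    rw [col, dif_pos hg] at h2
    exact ⟨⟨_, g, hg, rfl⟩, h1, h2⟩

theorem fn_wf : WellFounded fun f g : Pt.{u} → ZFSet.{u} => ∀ᶠ w in iterFilter, f w ∈ g w := by
  rw [wellFounded_iff_isEmpty_descending_chain]
  refine ⟨fun ⟨f, hf⟩ => ?_⟩
  obtain ⟨w, hw⟩ := exists_forall_of_eventually hf
  exact (wellFounded_iff_isEmpty_descending_chain.1 ZFSet.mem_wf).false ⟨fun n => f n w, hw⟩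

/-- Extensionality of the iterate. If `f` and `g` differ almost everywhere, a distinguishing element
chosen from the two values has finite support; on either side it yields a contradiction by
induction. -/
theorem eventually_eq_of_col_eq (hf : Fn A f) (hg : Fn A g) (h : col A f = col A g) :
    ∀ᶠ w in iterFilter, f w = g w := by
  classical
  induction f using fn_wf.induction generalizing g with
  | _ f ih =>
  refine (hf.comp₂ hg (· = ·)).em.resolve_right fun hne => ?_
  let x : Pt.{u} → ZFSet.{u} := fun w =>
    if h : ∃ x, ¬ (x ∈ f w ↔ x ∈ g w) then h.choose else ∅
  have hx : Fn A x := hf.comp₂ hg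
    fun a b => if h : ∃ x, ¬ (x ∈ a ↔ x ∈ b) then h.choose else ∅
  have hxs : ∀ w, f w ≠ g w → ¬ (x w ∈ f w ↔ x w ∈ g w) := fun w hw => by
    have h : ∃ x, ¬ (x ∈ f w ↔ x ∈ g w) := by
      by_contra hno
      push Not at hno
      exact hw (ZFSet.ext hno)
    simp only [x, dif_pos h]
    exact h.choose_spec
  rcases (hx.comp₂ hf (· ∈ ·)).em with h1 | h1
  · have : col A x ∈ col A g := h ▸ (mem_col hf).2 ⟨x, hx, h1, rfl⟩
    obtain ⟨y, hy, hyg, hyx⟩ := (mem_col hg).1 this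
    have h2 := ih x h1 hx hy hyx.symm
    obtain ⟨w, ⟨⟨h3, h4⟩, h5⟩, h6⟩ := (((h2.and hyg).and hne).and h1).exists
    exact hxs w h5 ⟨fun _ => h3 ▸ h4, fun _ => h6⟩
  · have h2 : ∀ᶠ w in iterFilter, x w ∈ g w := by
      filter_upwards [h1, hne] with w h1 h2
      by_contra h3
      exact hxs w h2 ⟨fun h => absurd h h1, fun h => absurd h h3⟩
    have : col A x ∈ col A f := h ▸ (mem_col hg).2 ⟨x, hx, h2, rfl⟩
    obtain ⟨y, hy, hyf, hyx⟩ := (mem_col hf).1 this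
    obtain ⟨w, ⟨h3, h4⟩, h5⟩ := (((ih y hyf hy hx hyx).and hyf).and h1).exists
    exact h5 (h3 ▸ h4)

theorem col_eq_iff (hf : Fn A f) (hg : Fn A g) :
    col A f = col A g ↔ ∀ᶠ w in iterFilter, f w = g w :=
  ⟨eventually_eq_of_col_eq hf hg, col_congr hf hg⟩

theorem col_mem_iff (hf : Fn A f) (hg : Fn A g) :
    col A f ∈ col A g ↔ ∀ᶠ w in iterFilter, f w ∈ g w := by
  refine ⟨fun h => ?_, fun h => (mem_col hg).2 ⟨f, hf, h, rfl⟩⟩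
  obtain ⟨y, hy, hyg, hyf⟩ := (mem_col hg).1 h
  filter_upwards [hyg, (col_eq_iff hy hf).1 hyf] with w h1 h2
  exact h2 ▸ h1

/-! ### Łoś's theorem for `Δ₀` formulas and upward absoluteness of `Σ₁` formulas -/

theorem col_term {α : Type} {n : ℕ} (t : setLanguage.Term (α ⊕ Fin n)) :
    ∃ i : α ⊕ Fin n, t = .var i := by
  cases t with
  | var i => exact ⟨i, rfl⟩
  | func f _ => exact nomatch f

theorem realize_memFormula {α : Type} {n : ℕ} (s t : setLanguage.Term (α ⊕ Fin n))
    (v : α → ZFSet.{u}) (xs : Fin n → ZFSet.{u}) : (memFormula s t).Realize v xs ↔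
      s.realize (Sum.elim v xs) ∈ t.realize (Sum.elim v xs) := by
  rw [memFormula, FirstOrder.Language.BoundedFormula.realize_rel₂]
  rfl

theorem realize_boundedAll {α : Type} {n : ℕ} (i : α ⊕ Fin n)
    (φ : setLanguage.BoundedFormula α (n + 1)) (v : α → ZFSet.{u}) (xs : Fin n → ZFSet.{u}) :
    (boundedAll i φ).Realize v xs ↔
      ∀ x ∈ Sum.elim v xs i, φ.Realize v (Fin.snoc xs x : Fin (n + 1) → ZFSet.{u}) := by
  rw [boundedAll, FirstOrder.Language.BoundedFormula.realize_all]
  refine forall_congr' fun x => ?_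
  rw [FirstOrder.Language.BoundedFormula.realize_imp, realize_memFormula]
  cases i <;> simp

theorem fn_sum_elim {α : Type} {n : ℕ} {v : α → Pt.{u} → ZFSet.{u}}
    {xs : Fin n → Pt.{u} → ZFSet.{u}} (hv : ∀ i, Fn A (v i)) (hxs : ∀ i, Fn A (xs i))
    (i : α ⊕ Fin n) : Fn A (Sum.elim v xs i) := by
  cases i
  exacts [hv _, hxs _]

theorem fn_snoc {n : ℕ} {xs : Fin n → Pt.{u} → ZFSet.{u}} (hxs : ∀ i, Fn A (xs i)) (hf : Fn A f)
    (i : Fin (n + 1)) : Fn A ((Fin.snoc xs f : Fin (n + 1) → Pt.{u} → ZFSet.{u}) i) := by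
  induction i using Fin.lastCases with
  | last => simpa using hf
  | cast i => simpa using hxs i

theorem snoc_col {n : ℕ} (xs : Fin n → Pt.{u} → ZFSet.{u}) (f : Pt.{u} → ZFSet.{u}) :
    (Fin.snoc (fun i => col A (xs i)) (col A f) : Fin (n + 1) → ZFSet.{u}) =
      fun i => col A ((Fin.snoc xs f : Fin (n + 1) → Pt.{u} → ZFSet.{u}) i) := by
  funext i
  induction i using Fin.lastCases <;> simp

theorem snoc_apply {n : ℕ} (xs : Fin n → Pt.{u} → ZFSet.{u}) (f : Pt.{u} → ZFSet.{u}) (w : Pt.{u}) :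
    (fun i => (Fin.snoc xs f : Fin (n + 1) → Pt.{u} → ZFSet.{u}) i w) =
      (Fin.snoc (fun i => xs i w) (f w) : Fin (n + 1) → ZFSet.{u}) := by
  funext i
  induction i using Fin.lastCases <;> simp

theorem sum_elim_col {α : Type} {n : ℕ} (v : α → Pt.{u} → ZFSet.{u})
    (xs : Fin n → Pt.{u} → ZFSet.{u}) (i : α ⊕ Fin n) :
    Sum.elim (fun i => col A (v i)) (fun i => col A (xs i)) i = col A (Sum.elim v xs i) := by
  cases i <;> rfl

theorem sum_elim_apply {α : Type} {n : ℕ} (v : α → Pt.{u} → ZFSet.{u})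
    (xs : Fin n → Pt.{u} → ZFSet.{u}) (w : Pt.{u}) (i : α ⊕ Fin n) :
    Sum.elim (fun i => v i w) (fun i => xs i w) i = Sum.elim v xs i w := by
  cases i <;> rfl

/-- The transitivity of the collapse is built in: the left side is truth in the universe, and by
`mem_col` a bounded quantifier over a collapsed element ranges exactly over collapsed functions. -/
theorem IsDelta0.realize_col_iff {α : Type} [Finite α] {n : ℕ} {φ : setLanguage.BoundedFormula α n}
    (hφ : IsDelta0 φ) (hA : Small.{u} A) {v : α → Pt.{u} → ZFSet.{u}}
    {xs : Fin n → Pt.{u} → ZFSet.{u}} (hv : ∀ i, Fn A (v i)) (hxs : ∀ i, Fn A (xs i)) :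
    φ.Realize (fun i => col A (v i)) (fun i => col A (xs i)) ↔
      ∀ᶠ w in iterFilter, φ.Realize (fun i => v i w) fun i => xs i w := by
  classical
  have hfn : ∀ {n : ℕ} (φ : setLanguage.BoundedFormula α n) {xs : Fin n → Pt.{u} → ZFSet.{u}},
      (∀ i, Fn A (xs i)) → Fn A fun w => φ.Realize (fun i => v i w) fun i => xs i w :=
    fun φ xs hxs => (fn_pi hA hv).comp₂ (fn_pi hA hxs) fun a b => φ.Realize a b
  induction hφ with
  | falsum =>
    simp only [FirstOrder.Language.BoundedFormula.Realize, eventually_false_iff_eq_bot, false_iff]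
    exact NeBot.ne inferInstance
  | equal s t =>
    obtain ⟨i, rfl⟩ := col_term s
    obtain ⟨j, rfl⟩ := col_term t
    simp only [FirstOrder.Language.BoundedFormula.Realize, FirstOrder.Language.Term.realize_var,
      sum_elim_col, sum_elim_apply]
    exact col_eq_iff (fn_sum_elim hv hxs i) (fn_sum_elim hv hxs j)
  | mem s t =>
    obtain ⟨i, rfl⟩ := col_term s
    obtain ⟨j, rfl⟩ := col_term t
    simp only [realize_memFormula, FirstOrder.Language.Term.realize_var,
      sum_elim_col, sum_elim_apply]
    exact col_mem_iff (fn_sum_elim hv hxs i) (fn_sum_elim hv hxs j)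
  | imp _ _ ih1 ih2 =>
    rename_i φ ψ _ _
    simp only [FirstOrder.Language.BoundedFormula.realize_imp]
    have e1 : _ ↔ _ := ih1 hxs
    have e2 : _ ↔ _ := ih2 hxs
    rw [e1, e2]
    constructor
    · intro h
      rcases (hfn φ hxs).em with h1 | h1
      · exact (h h1).mono fun w hw _ => hw
      · exact h1.mono fun w hw hw' => absurd hw' hw
    · intro h h1
      filter_upwards [h, h1] with w h h1 using h h1
  | boundedAll i _ ih =>
    rename_i φ hφ
    simp only [realize_boundedAll, sum_elim_col, sum_elim_apply]
    have hi := fn_sum_elim hv hxs i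
    constructor
    · intro h
      have hfn' : Fn A fun w => ∀ x ∈ Sum.elim v xs i w, φ.Realize (fun i => v i w)
          (Fin.snoc (fun i => xs i w) x : Fin _ → ZFSet.{u}) :=
        (hi.comp₂ (fn_pi hA hv) Prod.mk).comp₂ (fn_pi hA hxs) fun p b => ∀ x ∈ p.1, φ.Realize p.2
          (Fin.snoc b x : Fin _ → ZFSet.{u})
      refine hfn'.em.resolve_right fun hno => ?_
      -- The counterexample is chosen from the values of the parameters and not from `w`, which
      -- keeps its support finite.
      let G : ZFSet.{u} × (α → ZFSet.{u}) → (Fin _ → ZFSet.{u}) → ZFSet.{u} := fun p b =>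
        if h : ∃ x ∈ p.1, ¬ φ.Realize p.2 (Fin.snoc b x : Fin _ → ZFSet.{u}) then h.choose else ∅
      let g : Pt.{u} → ZFSet.{u} := fun w => G (Sum.elim v xs i w, fun i => v i w) fun i => xs i w
      have hg : Fn A g := (hi.comp₂ (fn_pi hA hv) Prod.mk).comp₂ (fn_pi hA hxs) G
      have hgs : ∀ᶠ w in iterFilter, g w ∈ Sum.elim v xs i w ∧ ¬ φ.Realize (fun i => v i w)
          (Fin.snoc (fun i => xs i w) (g w) : Fin _ → ZFSet.{u}) := by
        filter_upwards [hno] with w hw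
        push Not at hw
        simp only [g, G, dif_pos hw]
        exact hw.choose_spec
      have h1 := h (col A g) ((col_mem_iff hg hi).2 (hgs.mono fun w hw => hw.1))
      rw [snoc_col] at h1
      replace h1 := (ih (fn_snoc hxs hg)).1 h1
      simp only [snoc_apply] at h1
      obtain ⟨w, h2, h3⟩ := (h1.and hgs).exists
      exact h3.2 h2
    · intro h z hz
      obtain ⟨g, hg, hgi, rfl⟩ := (mem_col hi).1 hz
      rw [snoc_col]
      refine (ih (fn_snoc hxs hg)).2 ?_
      simp only [snoc_apply]
      filter_upwards [h, hgi] with w h1 h2 using h1 _ h2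

/-- The image of the set `x` under the embedding into the iterated ultrapower. -/
noncomputable def emb (A : Set Coord.{u}) (x : ZFSet.{u}) : ZFSet.{u} := col A fun _ => x

theorem IsSigma1.realize_emb {α : Type} [Finite α] {n : ℕ} {φ : setLanguage.BoundedFormula α n}
    (hφ : IsSigma1 φ) (hA : Small.{u} A) {v : α → ZFSet.{u}} {xs : Fin n → ZFSet.{u}}
    (h : φ.Realize v xs) : φ.Realize (fun i => emb A (v i)) fun i => emb A (xs i) := by
  induction hφ with
  | of_delta0 hφ =>
    exact (hφ.realize_col_iff hA (fun _ => fn_const hA _) fun _ => fn_const hA _).2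
      (Eventually.of_forall fun _ => h)
  | ex _ ih =>
    rw [FirstOrder.Language.BoundedFormula.realize_ex] at h ⊢
    obtain ⟨x, hx⟩ := h
    refine ⟨emb A x, ?_⟩
    have := ih hx
    convert this using 1
    funext i
    induction i using Fin.lastCases <;> simp

end SigmaOne

namespace SigmaOne
open Filter Set

/-! ### Ordinals of the iterated ultrapower -/

/-- The ordinal represented by `g` in the iterated ultrapower. -/
noncomputable def rk (A : Set Coord.{u}) (g : Pt.{u} → Ordinal.{u}) : Ordinal.{u} :=
  (col A fun w => (g w).toZFSet).rank

variable {A A₁ A₂ B : Set Coord.{u}} {g h : Pt.{u} → Ordinal.{u}}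

theorem isOrdinal_col {f : Pt.{u} → ZFSet.{u}} (hf : Fn A f)
    (h : ∀ᶠ w in iterFilter, (f w).IsOrdinal) : (col A f).IsOrdinal := by
  induction f using fn_wf.induction with
  | _ f ih =>
  rw [ZFSet.isOrdinal_iff_forall_mem_isOrdinal]
  constructor
  · intro y hy z hz
    obtain ⟨g, hg, hgf, rfl⟩ := (mem_col hf).1 hy
    obtain ⟨k, hk, hkg, rfl⟩ := (mem_col hg).1 hz
    refine (col_mem_iff hk hf).2 ?_
    filter_upwards [h, hgf, hkg] with w h1 h2 h3 using h1.mem_trans h3 h2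
  · intro y hy
    obtain ⟨g, hg, hgf, rfl⟩ := (mem_col hf).1 hy
    exact ih g hgf hg (by filter_upwards [h, hgf] with w h1 h2 using h1.mem h2)

theorem Fn.toZFSet (hg : Fn A g) : Fn A fun w => (g w).toZFSet := hg.comp _

theorem col_toZFSet (hg : Fn A g) : col A (fun w => (g w).toZFSet) = (rk A g).toZFSet :=
  ((isOrdinal_col hg.toZFSet (Eventually.of_forall fun _ => ZFSet.isOrdinal_toZFSet _)).toZFSet_rank_eq).symm

theorem rk_lt_iff (hg : Fn A g) (hh : Fn A h) :
    rk A g < rk A h ↔ ∀ᶠ w in iterFilter, g w < h w := by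
  rw [← Ordinal.toZFSet_mem_toZFSet_iff, ← col_toZFSet hg, ← col_toZFSet hh,
    col_mem_iff hg.toZFSet hh.toZFSet]
  simp

theorem rk_eq_iff (hg : Fn A g) (hh : Fn A h) :
    rk A g = rk A h ↔ ∀ᶠ w in iterFilter, g w = h w := by
  rw [← Ordinal.toZFSet_injective.eq_iff, ← col_toZFSet hg, ← col_toZFSet hh,
    col_eq_iff hg.toZFSet hh.toZFSet]
  simp [Ordinal.toZFSet_injective.eq_iff]

theorem rk_congr (hg : Fn A g) (hh : Fn A h) (e : ∀ᶠ w in iterFilter, g w = h w) :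
    rk A g = rk A h := (rk_eq_iff hg hh).2 e

theorem exists_rk_eq (hg : Fn A g) {c : Ordinal.{u}} (hc : c < rk A g) :
    ∃ h, Fn A h ∧ (∀ᶠ w in iterFilter, h w < g w) ∧ rk A h = c := by
  rw [← Ordinal.toZFSet_mem_toZFSet_iff, ← col_toZFSet hg, mem_col hg.toZFSet] at hc
  obtain ⟨f, hf, hfg, hfc⟩ := hc
  have h1 : ∀ᶠ w in iterFilter, f w = (f w).rank.toZFSet := hfg.mono fun w hw =>
    (((ZFSet.isOrdinal_toZFSet _).mem hw).toZFSet_rank_eq).symm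
  refine ⟨fun w => (f w).rank, hf.comp _, ?_, ?_⟩
  · filter_upwards [hfg, h1] with w h2 h3
    rwa [h3, Ordinal.toZFSet_mem_toZFSet_iff] at h2
  · apply Ordinal.toZFSet_injective
    rw [← col_toZFSet (hf.comp _), ← hfc]
    exact (col_congr hf (hf.comp fun x => x.rank.toZFSet) h1).symm

theorem ordinal_fn_wf : WellFounded fun f g : Pt.{u} → Ordinal.{u} =>
    ∀ᶠ w in iterFilter, f w < g w := by
  refine Subrelation.wf (fun {f g} h => ?_)
    (InvImage.wf (fun (g : Pt.{u} → Ordinal.{u}) w => (g w).toZFSet) fn_wf)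
  exact h.mono fun w hw => Ordinal.toZFSet_mem_toZFSet_iff.2 hw

/-- The collapse assigns the least possible ordinals. Comparison with larger coordinate sets and
with two-step iterations rests on this. -/
theorem rk_le_of_strictMono {R : (Pt.{u} → Ordinal.{u}) → Ordinal.{u}}
    (hR : ∀ g h, Fn A g → Fn A h → (∀ᶠ w in iterFilter, g w < h w) → R g < R h) (hg : Fn A g) :
    rk A g ≤ R g := by
  induction g using ordinal_fn_wf.induction with
  | _ g ih =>
  refine le_of_forall_lt fun c hc => ?_
  obtain ⟨k, hk, hkg, rfl⟩ := exists_rk_eq hg hc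
  exact (ih k hkg hk).trans_lt (hR k g hk hg hkg)

theorem rk_eq_of_strictMono {R : (Pt.{u} → Ordinal.{u}) → Ordinal.{u}}
    (hR : ∀ g h, Fn A g → Fn A h → (∀ᶠ w in iterFilter, g w < h w) → R g < R h)
    (hR' : ∀ g, Fn A g → ∀ c < R g, ∃ h, Fn A h ∧ (∀ᶠ w in iterFilter, h w < g w) ∧ R h = c)
    (hg : Fn A g) : rk A g = R g := by
  refine (rk_le_of_strictMono hR hg).antisymm ?_
  induction g using ordinal_fn_wf.induction with
  | _ g ih =>
  refine le_of_forall_lt fun c hc => ?_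
  obtain ⟨k, hk, hkg, rfl⟩ := hR' g hg c hc
  exact (ih k hkg hk).trans_lt ((rk_lt_iff hk hg).2 hkg)

theorem rk_mono_set (hAB : A ⊆ B) (hB : Small.{u} B) (hg : Fn A g) : rk A g ≤ rk B g :=
  rk_le_of_strictMono (fun _ _ h1 h2 h => (rk_lt_iff (h1.mono hAB hB) (h2.mono hAB hB)).2 h) hg

/-! ### The embeddings on ordinals, on sets of ordinals and on sets -/

/-- The embedding of the ordinals into the ordinals of the iterated ultrapower. -/
noncomputable def emO (A : Set Coord.{u}) (c : Ordinal.{u}) : Ordinal.{u} := rk A fun _ => c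

theorem emO_strictMono (hA : Small.{u} A) : StrictMono (emO A) := fun _ _ h =>
  (rk_lt_iff (fn_const hA _) (fn_const hA _)).2 (Eventually.of_forall fun _ => h)

theorem le_emO (hA : Small.{u} A) (c : Ordinal.{u}) : c ≤ emO A c := (emO_strictMono hA).le_apply

theorem rk_lt_emO_iff (hg : Fn A g) {c : Ordinal.{u}} :
    rk A g < emO A c ↔ ∀ᶠ w in iterFilter, g w < c := rk_lt_iff hg (fn_const hg.1 c)

theorem emO_mono_set (hAB : A ⊆ B) (hB : Small.{u} B) (c : Ordinal.{u}) : emO A c ≤ emO B c :=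
  rk_mono_set hAB hB (fn_const (small_subset hAB) c)

/-- The image of a set of ordinals under the embedding into the iterated ultrapower. -/
def emS (A : Set Coord.{u}) (x : Set Ordinal.{u}) : Set Ordinal.{u} :=
  {c | ∃ g, Fn A g ∧ (∀ᶠ w in iterFilter, g w ∈ x) ∧ rk A g = c}

theorem rk_mem_emS (hg : Fn A g) {x : Set Ordinal.{u}} :
    rk A g ∈ emS A x ↔ ∀ᶠ w in iterFilter, g w ∈ x := by
  refine ⟨fun ⟨h, hh, h1, h2⟩ => ?_, fun h => ⟨g, hg, h, rfl⟩⟩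
  filter_upwards [h1, (rk_eq_iff hh hg).1 h2] with w h3 h4
  exact h4 ▸ h3

theorem emO_mem_emS (hA : Small.{u} A) {c : Ordinal.{u}} {x : Set Ordinal.{u}} :
    emO A c ∈ emS A x ↔ c ∈ x := by
  rw [emO, rk_mem_emS (fn_const hA c), eventually_const]

theorem emS_inter (x y : Set Ordinal.{u}) : emS A (x ∩ y) = emS A x ∩ emS A y := by
  ext c
  constructor
  · rintro ⟨g, hg, h, rfl⟩
    exact ⟨⟨g, hg, h.mono fun w hw => hw.1, rfl⟩, ⟨g, hg, h.mono fun w hw => hw.2, rfl⟩⟩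
  · rintro ⟨⟨g, hg, h, rfl⟩, h'⟩
    exact ⟨g, hg, h.and ((rk_mem_emS hg).1 h'), rfl⟩

theorem emS_iio (hA : Small.{u} A) (c : Ordinal.{u}) : emS A (Iio c) = Iio (emO A c) := by
  ext e
  constructor
  · rintro ⟨g, hg, h, rfl⟩
    exact (rk_lt_emO_iff hg).2 h
  · intro h
    obtain ⟨g, hg, h', rfl⟩ := exists_rk_eq (fn_const hA c) (mem_Iio.1 h)
    exact ⟨g, hg, h', rfl⟩

/-- The set of ordinals that belong to a set, as a set of Mathlib ordinals. -/
def ordSet (x : ZFSet.{u}) : Set Ordinal.{u} := {c | c.toZFSet ∈ x}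

theorem ordSet_emb (hA : Small.{u} A) {x : ZFSet.{u}} (hx : ∀ y ∈ x, y.IsOrdinal) :
    ordSet (emb A x) = emS A (ordSet x) := by
  ext c
  constructor
  · intro h
    obtain ⟨f, hf, hfx, hfc⟩ := (mem_col (fn_const hA x)).1 (show c.toZFSet ∈ emb A x from h)
    have h1 : ∀ᶠ w in iterFilter, f w = (f w).rank.toZFSet := hfx.mono fun w hw =>
      ((hx _ hw).toZFSet_rank_eq).symm
    refine ⟨fun w => (f w).rank, hf.comp _, ?_, ?_⟩
    · filter_upwards [hfx, h1] with w h2 h3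
      exact (show (f w).rank.toZFSet ∈ x from h3 ▸ h2)
    · apply Ordinal.toZFSet_injective
      rw [← col_toZFSet (hf.comp _), ← hfc]
      exact (col_congr hf (hf.comp fun x => x.rank.toZFSet) h1).symm
  · rintro ⟨g, hg, h, rfl⟩
    show (rk A g).toZFSet ∈ emb A x
    rw [← col_toZFSet hg]
    exact (col_mem_iff hg.toZFSet (fn_const hA x)).2 h

theorem emb_toZFSet (hA : Small.{u} A) (c : Ordinal.{u}) :
    emb A c.toZFSet = (emO A c).toZFSet := col_toZFSet (fn_const hA c)

theorem emb_mem_emb (hA : Small.{u} A) {x y : ZFSet.{u}} : emb A x ∈ emb A y ↔ x ∈ y := by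
  rw [emb, emb, col_mem_iff (fn_const hA x) (fn_const hA y), eventually_const]

theorem emb_subset (hA : Small.{u} A) {x y : ZFSet.{u}} (h : x ⊆ y) : emb A x ⊆ emb A y := by
  intro z hz
  obtain ⟨f, hf, hfx, rfl⟩ := (mem_col (fn_const hA x)).1 hz
  exact (col_mem_iff hf (fn_const hA y)).2 (hfx.mono fun w hw => h hw)

theorem emb_insert_pair (hA : Small.{u} A) (x y : ZFSet.{u}) :
    emb A {x, y} = {emb A x, emb A y} := by
  ext z
  rw [ZFSet.mem_pair]
  constructor
  · intro hz
    obtain ⟨f, hf, hfx, rfl⟩ := (mem_col (fn_const hA _)).1 hz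
    rcases (hf.comp (· = x)).em with h | h
    · exact .inl (col_congr hf (fn_const hA x) h)
    · refine .inr (col_congr hf (fn_const hA y) ?_)
      filter_upwards [h, hfx] with w h1 h2 using (ZFSet.mem_pair.1 h2).resolve_left h1
  · rintro (rfl | rfl)
    · exact (emb_mem_emb hA).2 (by simp)
    · exact (emb_mem_emb hA).2 (by simp)

theorem emb_pair (hA : Small.{u} A) (x y : ZFSet.{u}) :
    emb A (ZFSet.pair x y) = ZFSet.pair (emb A x) (emb A y) := by
  rw [ZFSet.pair, ZFSet.pair, emb_insert_pair hA, emb_insert_pair hA, ← ZFSet.pair_eq_singleton x,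
    emb_insert_pair hA, ZFSet.pair_eq_singleton]

theorem Fn.eventually_const_mem {β : Type*} {f : Pt.{u} → β} (hf : Fn A f) {S : Set β}
    (hS : ∀ᶠ w in iterFilter, f w ∈ S) (hb : ∀ i ∈ A, Meas i.1 → Below S i.1) :
    ∃ b ∈ S, ∀ᶠ w in iterFilter, f w = b := by
  classical
  obtain ⟨w₀, hw₀⟩ := hS.exists
  obtain ⟨t, ht⟩ := (hf.comp fun b => if h : b ∈ S then (⟨b, h⟩ : S) else ⟨f w₀, hw₀⟩).eventually_const hb
  refine ⟨t.1, t.2, ?_⟩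
  filter_upwards [hS, ht] with w h1 h2
  rw [dif_pos h1] at h2
  rw [← h2]

/-- Sets that are hereditarily smaller than all blocks are fixed. -/
theorem emb_eq_self (hA : Small.{u} A) {t : ZFSet.{u}} (ht : t.IsTransitive)
    (hb : ∀ i ∈ A, Meas i.1 → Below {x | x ∈ t} i.1) {x : ZFSet.{u}} (hx : x ⊆ t) :
    emb A x = x := by
  induction x using ZFSet.inductionOn with
  | _ x ih =>
  ext z
  constructor
  · intro hz
    obtain ⟨f, hf, hfx, rfl⟩ := (mem_col (fn_const hA x)).1 hz
    obtain ⟨y, hy, hfy⟩ := hf.eventually_const_mem (S := {y | y ∈ x}) hfx fun i hi hm =>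
      (hb i hi hm).of_injective (fun y => ⟨y.1, hx y.2⟩) fun y y' h => Subtype.ext (congrArg (·.1) h)
    rw [col_congr hf (fn_const hA y) hfy]
    have := ih y hy (ht y (hx hy))
    rw [emb] at this
    rwa [this]
  · intro hz
    rw [← ih z hz (ht z (hx hz))]
    exact (emb_mem_emb hA).2 hz

/-- A function with values below `c` is almost everywhere constant when all blocks exceed `c`, so no
new ordinals appear below `c`. -/
theorem emO_eq_self (hA : Small.{u} A) {c : Ordinal.{u}} (hc : ∀ i ∈ A, Meas i.1 → c < i.1) :
    emO A c = c := by
  refine le_antisymm ?_ (le_emO hA c)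
  induction c using WellFoundedLT.induction with
  | ind c ih =>
  refine le_of_forall_lt fun e he => ?_
  obtain ⟨g, hg, hgc, rfl⟩ := exists_rk_eq (fn_const hA c) he
  obtain ⟨b, hb, hgb⟩ := hg.eventually_const_mem (S := Iio c) hgc fun i hi hm => below_iio (hc i hi hm)
  rw [rk_congr hg (fn_const hA b) hgb]
  exact (ih b hb fun i hi hm => (mem_Iio.1 hb).trans (hc i hi hm)).trans_lt hb

/-! ### Composition of iterations -/

theorem Fn.glue_right (hB : ∀ i ∈ A₂, i ∈ B) {β : Type*} {f : Pt.{u} → β} (hf : Fn (A₁ ∪ A₂) f)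
    (b : Pt.{u}) : Fn A₁ fun a => f (glue B b a) := by
  classical
  obtain ⟨hA, E, hE, hdep⟩ := hf
  refine ⟨small_subset (subset_union_left (t := A₂)), E.filter (· ∈ A₁), fun i hi => ?_, fun a a' h => hdep fun i hi => ?_⟩
  · obtain ⟨h1, h2⟩ := Finset.mem_filter.1 hi
    exact ⟨h2, (hE i h1).2⟩
  · by_cases hiB : i ∈ B
    · rw [glue_of_mem hiB, glue_of_mem hiB]
    · rw [glue_of_notMem hiB, glue_of_notMem hiB]
      exact h i (by
        have := (hE i hi).1.resolve_right fun h => hiB (hB i h)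
        simpa using ⟨hi, this⟩)

theorem Fn.glue_left (hB : ∀ i ∈ A₁, i ∉ B) {β : Type*} {f : Pt.{u} → β} (hf : Fn (A₁ ∪ A₂) f) :
    Fn A₂ fun b a => f (glue B b a) := by
  classical
  obtain ⟨hA, E, hE, hdep⟩ := hf
  refine ⟨small_subset (subset_union_right (s := A₁)), E.filter (· ∈ A₂), fun i hi => ?_, fun b b' h => ?_⟩
  · obtain ⟨h1, h2⟩ := Finset.mem_filter.1 hi
    exact ⟨h2, (hE i h1).2⟩
  · funext a
    refine hdep fun i hi => ?_
    by_cases hiB : i ∈ B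
    · rw [glue_of_mem hiB, glue_of_mem hiB]
      exact h i (by
        have := (hE i hi).1.resolve_left fun h => hB i h hiB
        simpa using ⟨hi, this⟩)
    · rw [glue_of_notMem hiB, glue_of_notMem hiB]

theorem Fn.apply_glue_right (hB : ∀ i ∈ A₁, i ∉ B) {β : Type*} {f : Pt.{u} → β} (hf : Fn A₁ f)
    (b a : Pt.{u}) : f (glue B b a) = f a := by
  obtain ⟨hA, E, hE, hdep⟩ := hf
  exact hdep fun i hi => glue_of_notMem (hB i (hE i hi).1)

theorem Fn.apply_glue_left (hB : ∀ i ∈ A₂, i ∈ B) {β : Type*} {f : Pt.{u} → β} (hf : Fn A₂ f)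
    (b a : Pt.{u}) : f (glue B b a) = f b := by
  obtain ⟨hA, E, hE, hdep⟩ := hf
  exact hdep fun i hi => glue_of_mem (hB i (hE i hi).1)

/-- The cut `B` separates the coordinates in `A₂`, which belong to `B`, from those in `A₁`. -/
structure Separates (B A₁ A₂ : Set Coord.{u}) : Prop where
  isCut : IsCut B
  notMem : ∀ i ∈ A₁, i ∉ B
  mem : ∀ i ∈ A₂, i ∈ B

/-- The ordinal represented by a function of two groups of coordinates, evaluated in two steps. -/
noncomputable def rk₂ (B A₁ A₂ : Set Coord.{u}) (g : Pt.{u} → Ordinal.{u}) : Ordinal.{u} :=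
  rk A₂ fun b => rk A₁ fun a => g (glue B b a)

theorem Separates.fn_rk (hB : Separates B A₁ A₂) (hg : Fn (A₁ ∪ A₂) g) :
    Fn A₂ fun b => rk A₁ fun a => g (glue B b a) := (hg.glue_left hB.notMem).comp (rk A₁)

theorem Separates.rk₂_strictMono (hB : Separates B A₁ A₂) (hg : Fn (A₁ ∪ A₂) g)
    (hh : Fn (A₁ ∪ A₂) h) (hgh : ∀ᶠ w in iterFilter, g w < h w) :
    rk₂ B A₁ A₂ g < rk₂ B A₁ A₂ h := by
  refine (rk_lt_iff (hB.fn_rk hg) (hB.fn_rk hh)).2 ?_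
  filter_upwards [eventually_glue hB.isCut hgh] with b hb
  exact (rk_lt_iff (hg.glue_right hB.mem b) (hh.glue_right hB.mem b)).2 hb

/-- This half of the factorization needs no bound on the number of coordinates in `A₁`; equality
requires one. -/
theorem Separates.rk_le_rk₂ (hB : Separates B A₁ A₂) (hg : Fn (A₁ ∪ A₂) g) :
    rk (A₁ ∪ A₂) g ≤ rk₂ B A₁ A₂ g :=
  rk_le_of_strictMono (fun _ _ h1 h2 h => hB.rk₂_strictMono h1 h2 h) hg

theorem Separates.rk_le_emO_rk (hB : Separates B A₁ A₂) (hA : Small.{u} A₂) (hg : Fn A₁ g) :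
    rk (A₁ ∪ A₂) g ≤ emO A₂ (rk A₁ g) := by
  have hA₁ := hg.1
  refine (hB.rk_le_rk₂ (hg.mono subset_union_left (small_union _ _))).trans_eq ?_
  simp only [rk₂, hg.apply_glue_right hB.notMem]
  rfl

theorem Separates.emO_le (hB : Separates B A₁ A₂) (hA₁ : Small.{u} A₁) (hA₂ : Small.{u} A₂)
    (c : Ordinal.{u}) : emO (A₁ ∪ A₂) c ≤ emO A₂ (emO A₁ c) :=
  hB.rk_le_emO_rk hA₂ (fn_const hA₁ c)

/-- For almost every `b` the inner iteration uses only blocks `≥ d`, hence fixes `g b < d`. -/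
theorem Separates.rk_eq_rk_left (hB : Separates B A₁ A₂) (hA : Small.{u} A₁) (hg : Fn A₂ g)
    {d : Ordinal.{u}} (hd : ∀ i ∈ A₁, Meas i.1 → d ≤ i.1) (hgd : ∀ᶠ w in iterFilter, g w < d) :
    rk (A₁ ∪ A₂) g = rk A₂ g := by
  have hA₂ := hg.1
  refine le_antisymm ?_ (rk_mono_set subset_union_right (small_union _ _) hg)
  refine (hB.rk_le_rk₂ (hg.mono subset_union_right (small_union _ _))).trans_eq ?_
  simp only [rk₂, hg.apply_glue_left hB.mem]
  refine rk_congr (hg.comp fun c => rk A₁ fun _ => c) hg ?_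
  filter_upwards [hgd] with w hw
  exact emO_eq_self hA fun i hi hm => hw.trans_le (hd i hi hm)

/-- Amalgamates functions `g` on `A₁`, given for almost every `b`, into one function of finite
support on `A₁ ∪ A₂`. The supports of the chosen functions are finite subsets of `A₁`; by `hb` there
are few of these compared with the blocks of `A₂`, so one support `F` works almost everywhere. -/
theorem Separates.exists_lift (hB : Separates B A₁ A₂)
    (hb : ∀ i ∈ A₂, Meas i.1 → Below (Finset A₁) i.1) (hA : Small.{u} A₁)
    {k : Pt.{u} → Ordinal.{u}} (hk : Fn A₂ k)
    {Q : Pt.{u} → Ordinal.{u} → Prop} (hQ : Fn (A₁ ∪ A₂) Q)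
    (h : ∀ᶠ b in iterFilter, ∃ g, Fn A₁ g ∧ (∀ᶠ a in iterFilter, Q (glue B b a) (g a)) ∧
      rk A₁ g = k b) :
    ∃ g, Fn (A₁ ∪ A₂) g ∧ (∀ᶠ w in iterFilter, Q w (g w)) ∧
      ∀ᶠ b in iterFilter, (rk A₁ fun a => g (glue B b a)) = k b := by
  classical
  -- The choice is made from the rank and the predicate alone, so that as a function of `b` it
  -- inherits finite support from `k` and `Q`.
  have spec : ∀ (c : Ordinal.{u}) (q : Pt.{u} → Ordinal.{u} → Prop),
      ∃ p : (Pt.{u} → Ordinal.{u}) × Finset A₁, DependsOn p.1 (Subtype.val '' (p.2 : Set A₁)) ∧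
        ((∃ g, Fn A₁ g ∧ (∀ᶠ a in iterFilter, q a (g a)) ∧ rk A₁ g = c) →
          (∀ i ∈ p.2, Meas i.1.1) ∧ (∀ᶠ a in iterFilter, q a (p.1 a)) ∧ rk A₁ p.1 = c) := by
    intro c q
    by_cases hex : ∃ g, Fn A₁ g ∧ (∀ᶠ a in iterFilter, q a (g a)) ∧ rk A₁ g = c
    · obtain ⟨g, ⟨-, E, hE, hdep⟩, hg⟩ := hex
      refine ⟨⟨g, E.subtype (· ∈ A₁)⟩, fun a a' haa => hdep fun i hi => haa i ?_, fun _ =>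
        ⟨fun i hi => (hE i.1 (Finset.mem_subtype.1 hi)).2, hg⟩⟩
      exact ⟨⟨i, (hE i hi).1⟩, by simpa using hi, rfl⟩
    · exact ⟨⟨fun _ => 0, ∅⟩, fun _ _ _ => rfl, fun h => absurd h hex⟩
  choose D hD0 hD1 using spec
  let p : Pt.{u} → (Pt.{u} → Ordinal.{u}) × Finset A₁ := fun b => D (k b) fun a => Q (glue B b a)
  have hp : Fn A₂ p := hk.comp₂ (hQ.glue_left hB.notMem) D
  obtain ⟨F, hF⟩ := (hp.comp Prod.snd).eventually_const hb
  have hgood : ∀ᶠ b in iterFilter, (∀ i ∈ F, Meas i.1.1) ∧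
      (∀ᶠ a in iterFilter, Q (glue B b a) ((p b).1 a)) ∧ rk A₁ (p b).1 = k b := by
    filter_upwards [hF, h] with b h1 h2
    have := hD1 _ _ h2
    exact ⟨h1 ▸ this.1, this.2⟩
  have hFm : ∀ i ∈ F, Meas i.1.1 := hgood.exists.choose_spec.1
  have hdepF : ∀ b, (p b).2 = F → Fn A₁ (p b).1 := fun b hbF =>
    ⟨hA, F.image Subtype.val, fun i hi => by
      obtain ⟨j, hj, rfl⟩ := Finset.mem_image.1 hi
      exact ⟨j.2, hFm j hj⟩, by
        have := hD0 (k b) fun a => Q (glue B b a)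
        rw [show (D (k b) fun a => Q (glue B b a)).2 = F from hbF] at this
        simpa using this⟩
  let g : Pt.{u} → Ordinal.{u} := fun w => if (p w).2 = F then (p w).1 w else 0
  have hg : Fn (A₁ ∪ A₂) g := by
    obtain ⟨hA₂, E, hE, hdep⟩ := hp
    refine ⟨small_union _ _, F.image Subtype.val ∪ E, fun i hi => ?_, fun w v hwv => ?_⟩
    · rcases Finset.mem_union.1 hi with h | h
      · obtain ⟨j, hj, rfl⟩ := Finset.mem_image.1 h
        exact ⟨.inl j.2, hFm j hj⟩
      · exact ⟨.inr (hE i h).1, (hE i h).2⟩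
    · have h1 : p w = p v := hdep fun i hi => hwv i (by push_cast; exact .inr hi)
      simp only [g, h1]
      split_ifs with h2
      · refine hD0 (k v) (fun a => Q (glue B v a)) fun i hi => hwv i ?_
        rw [show (D (k v) fun a => Q (glue B v a)).2 = F from h2] at hi
        push_cast
        exact .inl hi
      · rfl
  have hgg : ∀ b, (p b).2 = F → ∀ a, g (glue B b a) = (p b).1 a := fun b hbF a => by
    have h1 : p (glue B b a) = p b := hp.apply_glue_left hB.mem b a
    simp only [g, h1, if_pos hbF]
    exact (hdepF b hbF).apply_glue_right hB.notMem b a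
  refine ⟨g, hg, ?_, ?_⟩
  · refine (Fn.eventually_glue_iff hB.isCut (hQ.comp₂ hg fun q c => q c)).1 ?_
    filter_upwards [hF, hgood] with b h1 h2
    simpa only [hgg b h1] using h2.2.1
  · filter_upwards [hF, hgood] with b h1 h2
    simpa only [hgg b h1] using h2.2.2

/-- The two-step rank is strictly monotone, and by `exists_lift` its values form an initial segment,
so it is the collapse. -/
theorem Separates.rk_eq_rk₂ (hB : Separates B A₁ A₂)
    (hb : ∀ i ∈ A₂, Meas i.1 → Below (Finset A₁) i.1) (hg : Fn (A₁ ∪ A₂) g) :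
    rk (A₁ ∪ A₂) g = rk₂ B A₁ A₂ g := by
  have hA₁ : Small.{u} A₁ := have := hg.1; small_subset (subset_union_left (t := A₂))
  refine rk_eq_of_strictMono (fun _ _ h1 h2 h => hB.rk₂_strictMono h1 h2 h) (fun g hg c hc => ?_) hg
  obtain ⟨k, hk, hkr, rfl⟩ := exists_rk_eq (hB.fn_rk hg) hc
  obtain ⟨h, hh, h1, h2⟩ := hB.exists_lift hb hA₁ hk (Q := fun w c => c < g w)
    (hg.comp fun b c => c < b) (by
      filter_upwards [hkr] with b hb
      exact exists_rk_eq (hg.glue_right hB.mem b) hb)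
  exact ⟨h, hh, h1, rk_congr (hB.fn_rk hh) hk h2⟩

theorem Separates.emO_emO (hB : Separates B A₁ A₂) (hA₁ : Small.{u} A₁) (hA₂ : Small.{u} A₂)
    (hb : ∀ i ∈ A₂, Meas i.1 → Below (Finset A₁) i.1) (c : Ordinal.{u}) :
    emO A₂ (emO A₁ c) = emO (A₁ ∪ A₂) c :=
  (hB.rk_eq_rk₂ hb (fn_const (small_union _ _) c)).symm

theorem Separates.emS_emS (hB : Separates B A₁ A₂) (hA₁ : Small.{u} A₁) (hA₂ : Small.{u} A₂)
    (hb : ∀ i ∈ A₂, Meas i.1 → Below (Finset A₁) i.1) (x : Set Ordinal.{u}) :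
    emS A₂ (emS A₁ x) = emS (A₁ ∪ A₂) x := by
  ext c
  constructor
  · rintro ⟨k, hk, hkx, rfl⟩
    obtain ⟨h, hh, h1, h2⟩ := hB.exists_lift hb hA₁ hk (Q := fun w c => c ∈ x)
      (fn_const (small_union _ _) _) hkx
    exact ⟨h, hh, h1, (hB.rk_eq_rk₂ hb hh).trans (rk_congr (hB.fn_rk hh) hk h2)⟩
  · rintro ⟨h, hh, hhx, rfl⟩
    rw [hB.rk_eq_rk₂ hb hh]
    refine ⟨_, hB.fn_rk hh, ?_, rfl⟩
    filter_upwards [eventually_glue hB.isCut hhx] with b hb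
    exact (rk_mem_emS (hh.glue_right hB.mem b)).2 hb

end SigmaOne

namespace SigmaOne
open Filter Set

/-! ### Fixing ordinals -/

/-- The coordinates in `A` whose block belongs to `S`. -/
def res (A : Set Coord.{u}) (S : Set Ordinal.{u}) : Set Coord.{u} := {i | i ∈ A ∧ i.1 ∈ S}

variable {A : Set Coord.{u}} {S T : Set Ordinal.{u}}

theorem res_subset : res A S ⊆ A := fun _ h => h.1

theorem small_res (hA : Small.{u} A) : Small.{u} (res A S) := small_subset res_subset

theorem res_union : res A (S ∪ T) = res A S ∪ res A T := by
  ext i; simp only [res, mem_union, mem_ofPred_eq]; tauto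

theorem separates_res (h : Disjoint S T) : Separates {i | i.1 ∈ T} (res A S) (res A T) :=
  ⟨IsCut.of_blocks T, fun _ hi hi' => Set.disjoint_left.1 h hi.2 hi', fun _ hi => hi.2⟩

/-- Below each block, there are few coordinates. -/
def Sparse (A : Set Coord.{u}) : Prop :=
  ∀ i ∈ A, Meas i.1 → Below (Finset {j | j ∈ A ∧ j.1 < i.1}) i.1

theorem Sparse.mono {A' : Set Coord.{u}} (hs : Sparse A) (h : A' ⊆ A) : Sparse A' := by
  intro i hi hm
  let e : {j | j ∈ A' ∧ j.1 < i.1} ↪ {j | j ∈ A ∧ j.1 < i.1} :=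
    ⟨fun j => ⟨j.1, h j.2.1, j.2.2⟩, fun j k hjk =>
      Subtype.ext (congrArg (fun x : {j | j ∈ A ∧ j.1 < i.1} => x.1) hjk)⟩
  exact (hs i (h hi) hm).of_injective (Finset.map e) (Finset.map_injective e)

theorem Sparse.below_res (hs : Sparse A) (h : ∀ s ∈ S, ∀ t ∈ T, s < t) :
    ∀ i ∈ res A T, Meas i.1 → Below (Finset (res A S)) i.1 := by
  intro i hi hm
  let e : res A S ↪ {j | j ∈ A ∧ j.1 < i.1} :=
    ⟨fun j => ⟨j.1, j.2.1, h _ j.2.2 _ hi.2⟩, fun j k hjk =>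
      Subtype.ext (congrArg (fun x : {j | j ∈ A ∧ j.1 < i.1} => x.1) hjk)⟩
  exact (hs i hi.1 hm).of_injective (Finset.map e) (Finset.map_injective e)

/-- The blocks of `A` that move the ordinal `c`. -/
def moving (A : Set Coord.{u}) (c : Ordinal.{u}) : Set Ordinal.{u} := {d | c < emO (res A {d}) c}

theorem exists_strictMono_of_infinite (hS : S.Infinite) :
    ∃ d : ℕ → Ordinal.{u}, StrictMono d ∧ ∀ n, d n ∈ S := by
  let e := hS.natEmbedding
  obtain ⟨g, hg | hg⟩ := exists_increasing_or_nonincreasing_subseq (· < ·) fun n => (e n).1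
  · exact ⟨fun n => (e (g n)).1, fun m n h => hg m n h, fun n => (e (g n)).2⟩
  · exfalso
    refine (wellFounded_iff_isEmpty_descending_chain.1 (wellFounded_lt (α := Ordinal.{u}))).false
      ⟨fun n => (e (g n)).1, fun n => lt_of_le_of_ne (not_lt.1 (hg n (n + 1) n.lt_succ_self)) ?_⟩
    intro h
    exact absurd (g.injective (e.injective (Subtype.ext h))) (by omega)

theorem setOf_exists_ge_eq {α : Type*} (d : ℕ → α) (n : ℕ) :
    {x | ∃ m ≥ n, x = d m} = {d n} ∪ {x | ∃ m ≥ n + 1, x = d m} := by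
  ext x
  constructor
  · rintro ⟨m, hm, rfl⟩
    rcases Nat.eq_or_lt_of_le hm with h | h
    · exact .inl (h ▸ rfl)
    · exact .inr ⟨m, h, rfl⟩
  · rintro (rfl | ⟨m, hm, rfl⟩)
    exacts [⟨n, le_rfl, rfl⟩, ⟨m, by omega, rfl⟩]

/-- If increasing blocks `d n` all moved `c`, the images of `c` under the tails would descend: the
tail from `n` is the block `d n` followed by the tail from `n + 1`, and the first step already
enlarges `c`. -/
theorem moving_finite (hA : Small.{u} A) (hs : Sparse A) (c : Ordinal.{u}) : (moving A c).Finite := by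
  by_contra hinf
  obtain ⟨d, hd, hdm⟩ := exists_strictMono_of_infinite hinf
  refine (wellFounded_iff_isEmpty_descending_chain.1 (wellFounded_lt (α := Ordinal.{u}))).false
    ⟨fun n => emO (res A {x | ∃ m ≥ n, x = d m}) c, fun n => ?_⟩
  have hlt : ∀ s ∈ ({d n} : Set Ordinal), ∀ t ∈ {x | ∃ m ≥ n + 1, x = d m}, s < t := by
    rintro _ rfl _ ⟨m, hm, rfl⟩
    exact hd (by omega)
  have hsep : Separates _ (res A {d n}) (res A {x | ∃ m ≥ n + 1, x = d m}) := separates_res (by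
    rw [Set.disjoint_left]
    exact fun s h1 h2 => (hlt s h1 s h2).false)
  change emO (res A {x | ∃ m ≥ n + 1, x = d m}) c < emO (res A {x | ∃ m ≥ n, x = d m}) c
  rw [setOf_exists_ge_eq d n, res_union, ← hsep.emO_emO (small_res hA) (small_res hA) (hs.below_res hlt)]
  exact emO_strictMono (small_res hA) (hdm n)

theorem emO_res_of_finite (hA : Small.{u} A) {c : Ordinal.{u}} (hS : S.Finite)
    (h : Disjoint S (moving A c)) : emO (res A S) c = c := by
  induction S, hS using Set.Finite.induction_on with
  | empty => exact emO_eq_self (small_res hA) fun i hi => absurd hi.2 (Set.notMem_empty _)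
  | @insert d S hd _ ih =>
    rw [Set.disjoint_insert_left] at h
    refine le_antisymm ?_ (le_emO (small_res hA) c)
    rw [Set.insert_eq, res_union]
    refine ((separates_res (Set.disjoint_singleton_left.2 hd)).emO_le (small_res hA) (small_res hA) c).trans ?_
    have : emO (res A {d}) c = c := le_antisymm (not_lt.1 h.1) (le_emO (small_res hA) c)
    rw [this, ih h.2]

/-- Induction on `c`. An ordinal below the image of `c` has a representative supported in finitely
many blocks `K`, which fix `c`, so its rank `b` over `K` is below `c`. The other blocks act on `b`:
those that do not move `b` are harmless by induction, and those that do form a finite set, which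
fixes `c` and therefore keeps the image of `b` below `c`. -/
theorem emO_res (hA : Small.{u} A) (hs : Sparse A) {c : Ordinal.{u}}
    (h : Disjoint S (moving A c)) : emO (res A S) c = c := by
  classical
  refine le_antisymm ?_ (le_emO (small_res hA) c)
  induction c using WellFoundedLT.induction generalizing S with
  | ind c ih =>
  refine le_of_forall_lt fun e he => ?_
  obtain ⟨g, hg, hgc, rfl⟩ := exists_rk_eq (fn_const (small_res hA) c) he
  obtain ⟨-, E, hE, hdep⟩ := hg
  let K : Set Ordinal.{u} := E.image Prod.fst
  have hKS : K ⊆ S := by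
    intro x hx
    obtain ⟨i, hi, rfl⟩ := Finset.mem_image.1 (Finset.mem_coe.1 hx)
    exact (hE i hi).1.2
  have hKf : K.Finite := Finset.finite_toSet _
  have hgK : Fn (res A K) g := ⟨small_res hA, E, fun i hi =>
    ⟨⟨(hE i hi).1.1, Finset.mem_coe.2 (Finset.mem_image_of_mem _ hi)⟩, (hE i hi).2⟩, hdep⟩
  have h1 : rk (res A K) g < c := by
    rw [← emO_res_of_finite hA hKf (h.mono_left hKS)]
    exact (rk_lt_emO_iff hgK).2 hgc
  set b := rk (res A K) g
  let M : Set Ordinal.{u} := (S \ K) ∩ moving A b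
  have hMf : M.Finite := (moving_finite hA hs b).subset inter_subset_right
  have h2 : rk (res A S) g ≤ emO (res A (S \ K)) b := by
    have : S = K ∪ (S \ K) := (union_sdiff_cancel hKS).symm
    rw [this, res_union, ← this]
    exact (separates_res disjoint_sdiff_right).rk_le_emO_rk (small_res hA) hgK
  have h3 : emO (res A (S \ K)) b ≤ emO (res A M) b := by
    have : S \ K = ((S \ K) \ M) ∪ M := (sdiff_union_of_subset inter_subset_left).symm
    rw [this, res_union]
    refine ((separates_res disjoint_sdiff_left).emO_le (small_res hA) (small_res hA) b).trans ?_
    refine (emO_strictMono (small_res hA)).monotone (ih b h1 ?_)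
    rw [Set.disjoint_left]
    exact fun x hx hx' => hx.2 ⟨hx.1, hx'⟩
  refine h2.trans_lt (h3.trans_lt ?_)
  rw [← emO_res_of_finite hA hMf (h.mono_left fun x hx => hx.1.1)]
  exact emO_strictMono (small_res hA) h1

theorem emO_eq_of_disjoint_moving (hA : Small.{u} A) (hs : Sparse A) {c : Ordinal.{u}}
    {A' : Set Coord.{u}} (hA' : A' ⊆ A) (h : ∀ i ∈ A', i.1 ∉ moving A c) : emO A' c = c := by
  refine le_antisymm ?_ (le_emO (small_subset hA') c)
  have hsub : A' ⊆ res A (moving A c)ᶜ := fun i hi => ⟨hA' hi, h i hi⟩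
  exact (emO_mono_set hsub (small_res hA) c).trans_eq (emO_res hA hs disjoint_compl_left)

end SigmaOne

namespace SigmaOne
open Filter Set

/-! ### Cardinal bounds -/

theorem isStrongLimit_lift {K : Cardinal.{u}} (h : K.IsStrongLimit) :
    (Cardinal.lift.{u + 1} K).IsStrongLimit := by
  refine ⟨by simpa using h.ne_zero, fun x hx => ?_⟩
  obtain ⟨y, hy, rfl⟩ := Cardinal.lt_lift_iff.1 hx
  rw [← Cardinal.lift_two_power]
  exact Cardinal.lift_lt.2 (h.isStrongPrelimit hy)

theorem power_lt_of_isStrongLimit {X a b : Cardinal.{u}} (h : X.IsStrongLimit) (ha : a < X)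
    (hb : b < X) : a ^ b < X := by
  refine (Cardinal.power_le_power_right (Cardinal.cantor a).le).trans_lt ?_
  rw [← Cardinal.power_mul]
  exact h.isStrongPrelimit (Cardinal.mul_lt_of_lt h.aleph0_le ha hb)

theorem exists_bound {ι : Type (u + 1)} {o : Ordinal.{u}} (h : #ι < Cardinal.lift.{u + 1} o.cof)
    (f : ι → Ordinal.{u}) (hf : ∀ i, f i < o) : ∃ b < o, ∀ i, f i ≤ b := by
  have hs : Small.{u} (range f) := small_subset (range_subset_iff.2 hf : range f ⊆ Iio o)
  refine ⟨⨆ i, f i, Ordinal.lift_iSup_lt_of_lt_cof ?_ hf, fun i => ?_⟩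
  · rw [← Ordinal.lift_cof, Cardinal.lift_id'.{u, u + 1}]
    exact h
  · exact le_ciSup (Ordinal.bddAbove_of_small (s := range f)) i

theorem mk_finset_lt {X : Cardinal.{u}} (hX : ℵ₀ ≤ X) {A : Type u} (hA : #A < X) : #(Finset A) < X := by
  cases finite_or_infinite A
  · have : Finite (Finset A) := inferInstance
    exact (Cardinal.lt_aleph0_of_finite _).trans_le hX
  · rwa [Cardinal.mk_finset_of_infinite]

theorem mk_code_lt {X : Cardinal.{u + 1}} (h : X.IsStrongLimit) {A : Set Coord.{u}} (hA : #A < X)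
    {T : Type (u + 1)} [Nonempty T] (hT : #T < X) {z : Ordinal.{u}} (hz0 : 0 < z)
    (hz : #(Iio z) < X) (hAz : ∀ i ∈ A, i.1 ≤ z) : #(Code A T) < X := by
  have hne : #(Iio z) ≠ 0 := by
    have : Nonempty (Iio z) := ⟨⟨0, hz0⟩⟩
    exact Cardinal.mk_ne_zero _
  unfold Code
  rw [Cardinal.mk_sigma]
  have hle : ∀ E : Finset A, #(((e : E) → Iio e.1.1.1) → T) ≤ #T ^ (#(Iio z) ^ #A) := by
    intro E
    rw [← Cardinal.power_def]
    refine Cardinal.power_le_power_left (Cardinal.mk_ne_zero _) ?_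
    refine le_trans (b := #(Iio z) ^ #E) ?_ ?_
    · rw [Cardinal.power_def]
      refine Cardinal.mk_le_of_injective (f := fun v e => ⟨(v e).1, (mem_Iio.1 (v e).2).trans_le (hAz _ e.1.2)⟩) ?_
      intro v v' hv
      funext e
      have := congrFun hv e
      exact Subtype.ext (congrArg (fun x : Iio z => x.1) this)
    · exact Cardinal.power_le_power_left hne (Cardinal.mk_subtype_le _)
  refine (Cardinal.sum_le_sum _ _ hle).trans_lt ?_
  rw [Cardinal.sum_const']
  refine Cardinal.mul_lt_of_lt h.aleph0_le (mk_finset_lt h.aleph0_le hA) ?_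
  exact power_lt_of_isStrongLimit h hT (power_lt_of_isStrongLimit h hz hA)

theorem mk_iio_lt_lift {K : Cardinal.{u}} {c : Ordinal.{u}} :
    #(Iio c) < Cardinal.lift.{u + 1} K ↔ c < K.ord := by
  rw [Cardinal.mk_Iio_ordinal, Cardinal.lift_lt, Cardinal.lt_ord]

/-- Small iterations do not leave a strong limit cardinal. -/
theorem emO_lt_ord {K : Cardinal.{u}} (hK : K.IsStrongLimit) {A : Set Coord.{u}}
    (hs : Small.{u} A) (hA : #A < Cardinal.lift.{u + 1} K) {z : Ordinal.{u}} (hz0 : 0 < z)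
    (hz : z < K.ord) (hAz : ∀ i ∈ A, i.1 ≤ z) {c : Ordinal.{u}} (hc : c < K.ord) :
    emO A c < K.ord := by
  rcases eq_or_ne c 0 with rfl | h0
  · by_contra hle
    obtain ⟨g, hg, hg0, -⟩ := exists_rk_eq (fn_const hs 0) (hc.trans_le (not_lt.1 hle))
    obtain ⟨w, hw⟩ := hg0.exists
    exact absurd hw (not_lt.2 zero_le)
  · have t₀ : Iio c := ⟨0, mem_Iio.2 (pos_iff_ne_zero.2 h0)⟩
    have : Nonempty (Iio c) := ⟨t₀⟩
    rw [← mk_iio_lt_lift]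
    refine lt_of_le_of_lt ?_ (mk_code_lt (isStrongLimit_lift hK) hA (T := Iio c)
      (mk_iio_lt_lift.2 hc) hz0 (mk_iio_lt_lift.2 hz) hAz)
    have key : ∀ e : Iio (emO A c), ∃ g, Fn A g ∧ rk A g = e.1 ∧
        ∃ p : Code A (Iio c), ∀ᶠ w in iterFilter, g w = p.eval t₀ w := by
      rintro ⟨e, he⟩
      obtain ⟨g, hg, hgc, rfl⟩ := exists_rk_eq (fn_const hs c) (mem_Iio.1 he)
      exact ⟨g, hg, rfl, hg.exists_code (T := Iio c) hgc t₀⟩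
    choose g hg hge p hp using key
    refine Cardinal.mk_le_of_injective (f := p) fun e e' h => ?_
    apply Subtype.ext
    rw [← hge e, ← hge e']
    refine rk_congr (hg e) (hg e') ?_
    filter_upwards [hp e, hp e'] with w h1 h2
    rw [h1, h2, h]

/-! ### Blocks -/

/-- The coordinates of an iteration of length `l` of the measure on `z`. -/
def blk (z l : Ordinal.{u}) : Set Coord.{u} := {i | i.1 = z ∧ i.2 < l}

instance (z l : Ordinal.{u}) : Small.{u} (blk z l) := by
  have : blk z l = Prod.mk z '' Iio l := by
    ext ⟨a, b⟩
    simp only [blk, mem_ofPred_eq, mem_image, mem_Iio, Prod.mk.injEq]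
    constructor
    · rintro ⟨rfl, h⟩; exact ⟨b, h, rfl, rfl⟩
    · rintro ⟨x, h, rfl, rfl⟩; exact ⟨rfl, h⟩
  rw [this]
  exact small_image _ _

theorem mk_blk_le (z l : Ordinal.{u}) : #(blk z l) ≤ #(Iio l) := by
  refine Cardinal.mk_le_of_injective (f := fun i : blk z l => (⟨i.1.2, i.2.2⟩ : Iio l)) ?_
  rintro ⟨i, hi⟩ ⟨j, hj⟩ h
  replace h := congrArg (fun x : Iio l => x.1) h
  exact Subtype.ext (Prod.ext (hi.1.trans hj.1.symm) h)

variable {A A₁ A₂ B : Set Coord.{u}}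

/-- The coordinate functions at the positions `ν < l` represent increasing ordinals below the image
of `z`. -/
theorem le_emO_of_blk_subset (hA : Small.{u} A) {z l : Ordinal.{u}} (hz : Meas z) (h : blk z l ⊆ A) :
    l ≤ emO A z := by
  have hf : ∀ ν < l, Fn A fun w : Pt.{u} => w (z, ν) := fun ν hν => fn_coord hA (h ⟨rfl, hν⟩) hz
  have hbox : ∀ E : Finset Coord.{u}, (∀ i ∈ E, i.1 = z) →
      ∀ᶠ w in iterFilter, w ∈ Box E fun _ => univ := fun E hE =>
    eventually_iter.2 ⟨E, _, fun i hi => (hE i hi).symm ▸ hz, large_univ, fun w hw => hw⟩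
  have hmono : ∀ ν < l, ν ≤ rk A fun w => w (z, ν) := by
    intro ν
    induction ν using WellFoundedLT.induction with
    | ind ν ih =>
    intro hν
    refine le_of_forall_lt fun e he => (ih e he (he.trans hν)).trans_lt ?_
    refine (rk_lt_iff (hf e (he.trans hν)) (hf ν hν)).2 ?_
    filter_upwards [hbox {(z, e), (z, ν)} (by simp)] with w hw
    exact hw.2 (z, e) (by simp) (z, ν) (by simp) rfl he
  refine le_of_forall_lt fun ν hν => (hmono ν hν).trans_lt ((rk_lt_emO_iff (hf ν hν)).2 ?_)
  filter_upwards [hbox {(z, ν)} (by simp)] with w hw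
  exact (hw.1 (z, ν) (by simp)).2

/-- Later coordinates do not change the images of sets below the image of `d`. -/
theorem Separates.mem_emS_iff (hB : Separates B A₁ A₂) (h₁ : Small.{u} A₁) (h₂ : Small.{u} A₂)
    {d : Ordinal.{u}} (hd : ∀ i ∈ A₁, Meas i.1 → d ≤ i.1) (x : Set Ordinal.{u}) {c : Ordinal.{u}}
    (hc : c < emO A₂ d) : c ∈ emS (A₁ ∪ A₂) x ↔ c ∈ emS A₂ x := by
  obtain ⟨g, hg, hgd, rfl⟩ := exists_rk_eq (fn_const h₂ d) hc
  rw [rk_mem_emS hg, ← hB.rk_eq_rk_left h₁ hg hd hgd,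
    rk_mem_emS (hg.mono subset_union_right (small_union _ _))]

end SigmaOne

namespace SigmaOne
open Filter Set

/-! ### Measurable cardinals -/

/-- `V` is a nonprincipal `μ`-complete ultrafilter on `μ.ord`, regarded as an ultrafilter on the
class of ordinals. -/
structure IsMeasureOn (μ : Cardinal.{u}) (V : Ultrafilter Ordinal.{u}) : Prop where
  aleph0_lt : ℵ₀ < μ
  complete : ∀ (ι : Type (u + 1)) (K : ι → Set Ordinal.{u}), #ι < Cardinal.lift.{u + 1} μ →
    (∀ i, K i ∈ V) → (⋂ i, K i) ∈ V
  iio_mem : Iio μ.ord ∈ V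
  compl_singleton_mem : ∀ a, {a}ᶜ ∈ V

theorem IsMeasurableCardinal.exists_measureOn {μ : Cardinal.{u}} (h : IsMeasurableCardinal μ) :
    ∃ V, IsMeasureOn μ V := by
  obtain ⟨h0, U, hne, hU⟩ := h
  obtain ⟨e⟩ : Nonempty (μ.out ≃ μ.ord.ToType) := Cardinal.eq.1 (by simp)
  let i : μ.out → Ordinal.{u} := fun x => (Ordinal.ToType.mk.symm (e x)).1
  have hi : Function.Injective i :=
    Subtype.val_injective.comp (Ordinal.ToType.mk.symm.injective.comp e.injective)
  refine ⟨U.map i, h0, fun ι K hι hK => ?_, ?_, fun a => ?_⟩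
  · rw [Ultrafilter.mem_map, preimage_iInter, ← sInter_range]
    refine hU.cardinal_sInter_mem _ ?_ ?_
    · have := (Cardinal.mk_range_le_lift (f := fun j => i ⁻¹' K j))
      rw [Cardinal.lift_id'.{u, u + 1}] at this
      exact Cardinal.lift_lt.1 (this.trans_lt hι)
    · rintro _ ⟨j, rfl⟩
      exact hK j
  · rw [Ultrafilter.mem_map]
    exact mem_of_superset univ_mem fun x _ => (Ordinal.ToType.mk.symm (e x)).2
  · rw [Ultrafilter.mem_map]
    by_cases ha : ∃ x, i x = a
    · obtain ⟨x, rfl⟩ := ha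
      have := Ultrafilter.compl_mem_iff_notMem.2 (hne x)
      exact mem_of_superset this fun y hy hyx => hy (hi hyx)
    · exact mem_of_superset univ_mem fun x _ hx => ha ⟨x, hx⟩

namespace IsMeasureOn

variable {μ : Cardinal.{u}} {V : Ultrafilter Ordinal.{u}}

theorem eventually_forall (h : IsMeasureOn μ V) {ι : Type (u + 1)} (hι : #ι < Cardinal.lift.{u + 1} μ)
    {p : ι → Ordinal.{u} → Prop} (hp : ∀ i, ∀ᶠ a in (V : Filter Ordinal), p i a) :
    ∀ᶠ a in (V : Filter Ordinal), ∀ i, p i a := by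
  have := h.complete ι (fun i => {a | p i a}) hι hp
  exact mem_of_superset this fun a ha i => mem_iInter.1 ha i

theorem exists_eventually_eq (h : IsMeasureOn μ V) {T : Set Ordinal.{u}}
    (hT : #T < Cardinal.lift.{u + 1} μ) {f : Ordinal.{u} → Ordinal.{u}}
    (hf : ∀ᶠ a in (V : Filter Ordinal), f a ∈ T) :
    ∃ c ∈ T, ∀ᶠ a in (V : Filter Ordinal), f a = c := by
  by_contra! hne
  obtain ⟨a, h1, h2⟩ := (hf.and (h.eventually_forall hT (p := fun t a => f a ≠ t.1) fun t =>
    hne t.1 t.2)).exists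
  exact h2 ⟨f a, h1⟩ rfl

theorem ioi_mem (h : IsMeasureOn μ V) {a : Ordinal.{u}} (ha : a < μ.ord) :
    ∀ᶠ x in (V : Filter Ordinal), a < x := by
  by_contra hc
  have hc' : ∀ᶠ x in (V : Filter Ordinal), x ∈ Iio (a + 1) := by
    filter_upwards [Ultrafilter.eventually_not.2 hc] with x hx
    exact Order.lt_add_one_iff.2 (not_lt.1 hx)
  have hμ : a + 1 < μ.ord := (Cardinal.isSuccLimit_ord h.aleph0_lt.le).add_one_lt ha
  obtain ⟨c, -, hc⟩ := h.exists_eventually_eq (f := fun x => x) (mk_iio_lt_lift.2 hμ) hc'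
  obtain ⟨x, h1, h2⟩ := (hc.and (h.compl_singleton_mem c : ∀ᶠ x in (V : Filter Ordinal), x ∈ ({c} : Set Ordinal)ᶜ)).exists
  exact h2 h1

/-- If `μ` had a short cofinal set, almost every point would lie above all its members. If `μ`
injected into the power set of a smaller cardinal, deciding each element of that cardinal would make
the injection constant almost everywhere. -/
theorem isInaccessible (h : IsMeasureOn μ V) : μ.IsInaccessible := by
  refine ⟨h.aleph0_lt, ?_, fun x hx => ?_⟩
  · by_contra! hlt
    obtain ⟨S, hS, hSc⟩ := Order.exists_cof_eq (Iio μ.ord)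
    rw [Ordinal.cof_Iio, ← Ordinal.lift_cof] at hSc
    have h3 : ∀ᶠ x in (V : Filter Ordinal), x ∈ Iio μ.ord := h.iio_mem
    obtain ⟨x, h1, h2⟩ := (h3.and (h.eventually_forall (ι := S) (p := fun s x => s.1.1 < x)
      (by rw [hSc]; exact Cardinal.lift_lt.2 hlt) fun s => h.ioi_mem s.1.2)).exists
    obtain ⟨s, hs, hxs⟩ := hS ⟨x, h1⟩
    exact (h2 ⟨s, hs⟩).not_ge hxs
  · by_contra! hle
    have hcard : #(Iio μ.ord) ≤ #(Set (Iio x.ord)) := by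
      rw [Cardinal.mk_set, Cardinal.mk_Iio_ordinal, Cardinal.mk_Iio_ordinal, Cardinal.card_ord,
        Cardinal.card_ord, ← Cardinal.lift_two_power]
      exact Cardinal.lift_le.2 hle
    obtain ⟨f⟩ := hcard
    let F : Ordinal.{u} → Set (Iio x.ord) := fun a => if ha : a < μ.ord then f ⟨a, ha⟩ else ∅
    have hx' : #(Iio x.ord) < Cardinal.lift.{u + 1} μ := mk_iio_lt_lift.2 (Cardinal.ord_lt_ord.2 hx)
    obtain ⟨e, he⟩ : ∃ e : Set (Iio x.ord), ∀ᶠ a in (V : Filter Ordinal), F a = e := by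
      refine ⟨{t | ∀ᶠ a in (V : Filter Ordinal), t ∈ F a}, ?_⟩
      have := h.eventually_forall hx' (p := fun t a => (t ∈ F a ↔ ∀ᶠ a in (V : Filter Ordinal), t ∈ F a))
        fun t => by
          by_cases ht : ∀ᶠ a in (V : Filter Ordinal), t ∈ F a
          · simp [ht]
          · simpa [ht] using Ultrafilter.eventually_not.2 ht
      filter_upwards [this] with a ha
      ext t
      exact ha t
    have hk : ∀ᶠ a in (V : Filter Ordinal), a < μ.ord ∧ F a = e := by
      filter_upwards [h.iio_mem, he] with a h1 h2 using ⟨h1, h2⟩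
    obtain ⟨a, ha, hae⟩ := hk.exists
    obtain ⟨b, ⟨hb, hbe⟩, hba⟩ := (hk.and (h.ioi_mem ha)).exists
    have hab : F a = F b := hae.trans hbe.symm
    simp only [F, dif_pos ha, dif_pos hb] at hab
    have := congrArg Subtype.val (f.injective hab)
    exact hba.ne this

theorem wellFounded (h : IsMeasureOn μ V) : WellFounded fun f g : Ordinal.{u} → Ordinal.{u} =>
    ∀ᶠ a in (V : Filter Ordinal), f a < g a := by
  rw [wellFounded_iff_isEmpty_descending_chain]
  refine ⟨fun ⟨f, hf⟩ => ?_⟩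
  obtain ⟨a, ha⟩ := (h.eventually_forall (ι := ULift ℕ) (p := fun n a => f (n.down + 1) a < f n.down a)
    (by simpa using h.aleph0_lt) fun n => hf n.down).exists
  exact (wellFounded_iff_isEmpty_descending_chain.1 (wellFounded_lt (α := Ordinal.{u}))).false
    ⟨fun n => f n a, fun n => ha ⟨n⟩⟩

/-- Scott's argument: push `V` forward along a minimal function `f` exceeding each `c < μ` almost
everywhere. If `g ∘ f` lies below `f`, then minimality bounds `g ∘ f` on a large set, so
completeness makes it constant. -/
theorem meas (h : IsMeasureOn μ V) : Meas μ.ord := by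
  let S : Set (Ordinal.{u} → Ordinal.{u}) := {f | ∀ c < μ.ord, ∀ᶠ a in (V : Filter Ordinal), c < f a}
  have hid : (fun a => a) ∈ S := fun c hc => h.ioi_mem hc
  let f := h.wellFounded.min S ⟨_, hid⟩
  have hfS : f ∈ S := h.wellFounded.min_mem _ _
  have hmin : ∀ g ∈ S, ∀ᶠ a in (V : Filter Ordinal), f a ≤ g a := fun g hg => by
    have := h.wellFounded.not_lt_min S hg
    filter_upwards [Ultrafilter.eventually_not.2 this] with a ha using not_lt.1 ha
  have hfμ : ∀ᶠ a in (V : Filter Ordinal), f a < μ.ord := by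
    filter_upwards [hmin _ hid, h.iio_mem] with a h1 h2 using h1.trans_lt h2
  refine ⟨V.map f, ?_, hfμ, fun c hc => hfS c hc, fun g hg => ?_⟩
  · rw [← Cardinal.ord_aleph0]
    exact Cardinal.ord_lt_ord.2 h.aleph0_lt
  · have hg' : ∀ᶠ a in (V : Filter Ordinal), g (f a) < f a := hg
    have hgS : (fun a => g (f a)) ∉ S := fun hS => by
      obtain ⟨a, h1, h2⟩ := (hg'.and (hmin _ hS)).exists
      exact h1.not_ge h2
    simp only [S, mem_ofPred_eq, not_forall] at hgS
    obtain ⟨c, hc, hgc⟩ := hgS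
    have hμ : c + 1 < μ.ord := (Cardinal.isSuccLimit_ord h.aleph0_lt.le).add_one_lt hc
    obtain ⟨b, -, hb⟩ := h.exists_eventually_eq (f := fun x => g (f x)) (mk_iio_lt_lift.2 hμ) (by
      filter_upwards [Ultrafilter.eventually_not.2 hgc] with x hx
      exact Order.lt_add_one_iff.2 (not_lt.1 hx))
    exact ⟨b, hb⟩

end IsMeasureOn

theorem IsMeasurableCardinal.meas {μ : Cardinal.{u}} (h : IsMeasurableCardinal μ) : Meas μ.ord :=
  h.exists_measureOn.choose_spec.meas

theorem IsMeasurableCardinal.isInaccessible {μ : Cardinal.{u}} (h : IsMeasurableCardinal μ) :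
    μ.IsInaccessible := h.exists_measureOn.choose_spec.isInaccessible

namespace IsLimitOfMeasurables

variable {κ : Ordinal.{u}}

theorem ord_card (h : IsLimitOfMeasurables κ) : κ.card.ord = κ := by
  refine (Cardinal.ord_card_le κ).antisymm ?_
  by_contra! hlt
  obtain ⟨μ, -, h1, h2⟩ := h.2 _ hlt
  have := Ordinal.card_le_card h2.le
  rw [Cardinal.card_ord] at this
  exact (Cardinal.ord_le_ord.2 this).not_gt h1

theorem pos (h : IsLimitOfMeasurables κ) : 0 < κ := pos_iff_ne_zero.2 h.1

theorem isStrongLimit (h : IsLimitOfMeasurables κ) : κ.card.IsStrongLimit := by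
  refine ⟨by simpa using h.1, fun x hx => ?_⟩
  obtain ⟨μ, hμ, h1, h2⟩ := h.2 x.ord (by rw [← h.ord_card]; exact Cardinal.ord_lt_ord.2 hx)
  refine (hμ.isInaccessible.isStrongPrelimit (Cardinal.ord_lt_ord.1 h1)).trans_le ?_
  rw [← Cardinal.ord_le_ord, h.ord_card]
  exact h2.le

theorem isSuccLimit (h : IsLimitOfMeasurables κ) : Order.IsSuccLimit κ := by
  rw [← h.ord_card]
  exact Cardinal.isSuccLimit_ord h.isStrongLimit.aleph0_le

theorem add_one_lt (h : IsLimitOfMeasurables κ) {c : Ordinal.{u}} (hc : c < κ) : c + 1 < κ :=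
  h.isSuccLimit.add_one_lt hc

end IsLimitOfMeasurables

end SigmaOne

namespace SigmaOne
open Filter Set

/-! ### Parameters -/

variable {κ : Ordinal.{u}}

/-- Blocks beyond the cardinality of its transitive closure fix a hereditarily small set; an ordinal
parameter is its own condition `c`. -/
theorem exists_bound_emb_eq_self (hκ : IsLimitOfMeasurables κ) {p : ZFSet.{u}}
    (hp : p ∈ hereditarySets κ ∪ ordinals) :
    ∃ ρ < κ, ∃ c : Ordinal.{u}, ∀ A : Set Coord.{u}, Small.{u} A → (∀ i ∈ A, ρ < i.1) →
      emO A c = c → emb A p = p := by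
  rcases hp with ⟨t, ht, hpt, htκ⟩ | hp
  -- The successor ensures that `t` is strictly smaller in cardinality than every block above the
  -- bound.
  · refine ⟨(Order.succ t.card).ord, ?_, 0, fun A hA hAρ _ => emb_eq_self hA ht (fun i hi _ => ?_) hpt⟩
    · rw [← hκ.ord_card]
      exact Cardinal.ord_lt_ord.2 (hκ.isStrongLimit.isSuccLimit.succ_lt htκ)
    · have h1 : #(Shrink.{u} t) < i.1.card := by
        have : (Order.succ t.card) ≤ i.1.card := by
          rw [← Cardinal.card_ord (Order.succ t.card)]
          exact Ordinal.card_le_card (hAρ i hi).le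
        exact (Order.lt_succ _).trans_le this
      exact (below_of_mk_lt h1).of_injective (fun x => equivShrink t ⟨x.1, x.2⟩) fun x y hxy =>
        Subtype.ext (congrArg (fun z : t => z.1) ((equivShrink t).injective hxy))
  · refine ⟨0, hκ.pos, p.rank, fun A hA _ h => ?_⟩
    have hp' : p.rank.toZFSet = p := ZFSet.IsOrdinal.toZFSet_rank_eq hp
    rw [← hp', emb_toZFSet hA, h]

/-- Iterations that fix the parameters map a `Σ₁` definable class into itself. -/
theorem IsSigma1Definable.exists_emb_mem (hκ : IsLimitOfMeasurables κ) {Y : Set ZFSet.{u}}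
    (hY : IsSigma1Definable (hereditarySets κ ∪ ordinals) Y) :
    ∃ ρ < κ, ∃ F : Finset Ordinal.{u}, ∀ A : Set Coord.{u}, Small.{u} A → (∀ i ∈ A, ρ < i.1) →
      (∀ c ∈ F, emO A c = c) → ∀ y ∈ Y, emb A y ∈ Y := by
  obtain ⟨n, φ, p, hφ, hp, hY⟩ := hY
  choose ρ hρ c hc using fun i => exists_bound_emb_eq_self hκ (hp i)
  refine ⟨Finset.univ.sup ρ, (Finset.sup_lt_iff hκ.pos).2 fun i _ => hρ i, Finset.univ.image c,
    fun A hA hAρ hF y hy => ?_⟩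
  rw [hY] at hy ⊢
  have := hφ.realize_emb hA hy
  have h2 : (fun i => emb A (Sum.elim p (fun _ => y) i)) = Sum.elim p fun _ : Unit => emb A y := by
    funext i
    rcases i with i | i
    · exact hc i A hA (fun j hj => (Finset.le_sup (Finset.mem_univ i)).trans_lt (hAρ j hj))
        (hF _ (Finset.mem_image_of_mem c (Finset.mem_univ i)))
    · rfl
  rw [h2] at this
  rw [FirstOrder.Language.Formula.Realize]
  convert this using 1

end SigmaOne

namespace SigmaOne
open Filter Set

/-! ### Agreement of iterations of different lengths -/

/-- The sets of coordinates bounded by `z`. -/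
abbrev lower (z : Ordinal.{u}) : Set (Set Coord.{u}) := 𝒫 (Iio z ×ˢ Iio z)

/-- The images of `x` under the iterations of lengths `l` and `m` of the measure on `z` agree below
the second image of `z`. -/
def Agree (A : Set Coord.{u}) (z l m : Ordinal.{u}) (x : Set Ordinal.{u}) : Prop :=
  ∀ c < emO (A ∪ blk z m) z, c ∈ emS (A ∪ blk z l) x ↔ c ∈ emS (A ∪ blk z m) x

variable {A : Set Coord.{u}} {z l m : Ordinal.{u}} {x y : Set Ordinal.{u}}

theorem small_lower (hA : A ∈ lower z) : Small.{u} A := by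
  have : Small.{u} (Iio z ×ˢ Iio z : Set Coord.{u}) := by
    refine small_of_injective (β := Iio z × Iio z) (f := fun p => (⟨p.1.1, p.2.1⟩, ⟨p.1.2, p.2.2⟩)) ?_
    rintro ⟨p, hp⟩ ⟨q, hq⟩ h
    simp only [Prod.mk.injEq, Subtype.mk.injEq] at h
    exact Subtype.ext (Prod.ext h.1 h.2)
  exact small_subset hA

theorem small_lower_union (hA : A ∈ lower z) : Small.{u} ↑(A ∪ blk z l) := by
  have := small_lower hA
  exact small_union _ _

/-- The positions from `m` on come after all those of `A ∪ blk z m` and are taken on blocks `≥ z`;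
they leave everything below the shorter iteration's image of `z` unchanged. -/
theorem mem_emS_blk_iff_of_le (hA : A ∈ lower z) (hml : m ≤ l) {c : Ordinal.{u}}
    (hc : c < emO (A ∪ blk z m) z) :
    c ∈ emS (A ∪ blk z l) x ↔ c ∈ emS (A ∪ blk z m) x := by
  have hsep : Separates {i | i.1 < z ∨ i.1 = z ∧ i.2 < m} (blk z l \ blk z m) (A ∪ blk z m) := by
    refine ⟨fun i hi j hj hij => ?_, fun i hi h => ?_, fun i hi => ?_⟩
    · simp only [mem_ofPred_eq, not_or, not_and, not_lt] at hi hj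
      rcases hi with h | h
      · exact absurd h (not_lt.2 (hij ▸ hj.1))
      · exact h.2.trans_le (hj.2 (hij ▸ h.1))
    · rcases h with h | h
      · exact absurd hi.1.1 h.ne
      · exact hi.2 h
    · rcases hi with h | h
      · exact .inl (hA h).1
      · exact .inr h
  have heq : A ∪ blk z l = (blk z l \ blk z m) ∪ (A ∪ blk z m) := by
    have : blk z m ⊆ blk z l := fun i hi => ⟨hi.1, hi.2.trans_le hml⟩
    rw [union_left_comm, sdiff_union_of_subset this]
  rw [heq]
  exact hsep.mem_emS_iff (small_subset sdiff_subset) (small_lower_union hA)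
    (fun i hi _ => hi.1.1.ge) x hc

theorem emO_blk_mono (hA : A ∈ lower z) (hml : m ≤ l) (c : Ordinal.{u}) :
    emO (A ∪ blk z m) c ≤ emO (A ∪ blk z l) c :=
  emO_mono_set (union_subset_union_right A (show blk z m ⊆ blk z l from fun _ hi => ⟨hi.1, hi.2.trans_le hml⟩))
    (small_lower_union hA) c

theorem Agree.of_le {m' : Ordinal.{u}} (h : Agree A z l m x) (hA : A ∈ lower z) (hm : m' ≤ m) :
    Agree A z l m' x := fun c hc =>
  (h c (hc.trans_le (emO_blk_mono hA hm z))).trans (mem_emS_blk_iff_of_le hA hm hc)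

/-- Let `e` be the image of `c` under the iteration of length `l`. Membership of `c` in `x` becomes
membership of `e` in the `l`-image of `x`, then by agreement in its `m`-image. Since `e < m` lies
below the `m`-image of `z`, only `x ∩ z` matters. -/
theorem Agree.mem_iff (hx : Agree A z l m x) (hy : Agree A z l m y) (hA : A ∈ lower z)
    (hz : Meas z) (hxy : x ∩ Iio z = y ∩ Iio z) {c : Ordinal.{u}}
    (hc : emO (A ∪ blk z l) c < m) : c ∈ x ↔ c ∈ y := by
  have hs : ∀ l, Small.{u} ↑(A ∪ blk z l) := fun l => small_lower_union hA
  have hc' := hc.trans_le (le_emO_of_blk_subset (hs m) hz subset_union_right)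
  rw [← emO_mem_emS (hs l), ← emO_mem_emS (hs l) (x := y), hx _ hc', hy _ hc']
  have h1 : emO (A ∪ blk z l) c ∈ emS (A ∪ blk z m) (Iio z) := by
    rw [emS_iio (hs m)]; exact hc'
  have h2 := congrArg (fun s => emO (A ∪ blk z l) c ∈ emS (A ∪ blk z m) s) hxy
  simp only [emS_inter, mem_inter_iff, h1, and_true, eq_iff_iff] at h2
  exact h2

theorem mk_prod_iio_lt {K : Cardinal.{u}} (hK : ℵ₀ ≤ K) (hz : z < K.ord) :
    #(Iio z ×ˢ Iio z : Set Coord.{u}) < Cardinal.lift.{u + 1} K := by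
  have h : ℵ₀ ≤ Cardinal.lift.{u + 1} K := by simpa using hK
  have hz' : #(Iio z) < Cardinal.lift.{u + 1} K := mk_iio_lt_lift.2 hz
  rw [Cardinal.mk_setProd]
  exact Cardinal.mul_lt_of_lt h hz' hz'

theorem mk_lower_lt {K : Cardinal.{u}} (hK : K.IsStrongLimit) (hz : z < K.ord) :
    #(lower z) < Cardinal.lift.{u + 1} K := by
  rw [Cardinal.mk_powerset]
  exact (isStrongLimit_lift hK).isStrongPrelimit (mk_prod_iio_lt hK.aleph0_le hz)

theorem emO_lower_lt {K : Cardinal.{u}} (hK : K.IsStrongLimit) (hA : A ∈ lower z) (hz0 : 0 < z)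
    (hz : z < K.ord) (hl : l < K.ord) {c : Ordinal.{u}} (hc : c < K.ord) :
    emO (A ∪ blk z l) c < K.ord := by
  refine emO_lt_ord hK (small_lower_union hA) ?_ hz0 hz ?_ hc
  · refine (Cardinal.mk_union_le _ _).trans_lt (Cardinal.add_lt_of_lt (by simpa using hK.aleph0_le) ?_ ?_)
    · exact (Cardinal.mk_le_mk_of_subset hA).trans_lt (mk_prod_iio_lt hK.aleph0_le hz)
    · exact (mk_blk_le z l).trans_lt (mk_iio_lt_lift.2 hl)
  · rintro i (hi | hi)
    · exact (mem_Iio.1 (hA hi).1).le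
    · exact hi.1.le

theorem mk_iic_lt {K : Cardinal.{u}} (hK : ℵ₀ ≤ K) (hz : z < K.ord) :
    #(Iic z) < Cardinal.lift.{u + 1} K := by
  have : Iic z = Iio (z + 1) := by ext; simp [Order.lt_add_one_iff]
  rw [this]
  exact mk_iio_lt_lift.2 ((Cardinal.isSuccLimit_ord hK).add_one_lt hz)

theorem exists_bound_ord {K : Cardinal.{u}} (hK : K.IsInaccessible) {ι : Type (u + 1)}
    (h : #ι < Cardinal.lift.{u + 1} K) (f : ι → Ordinal.{u}) (hf : ∀ i, f i < K.ord) :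
    ∃ b < K.ord, ∀ i, f i ≤ b :=
  exists_bound (h.trans_le (Cardinal.lift_le.2 hK.le_cof_ord)) f hf

/-- Sequences in an inaccessible cardinal that grow as fast as desired. -/
theorem exists_fast_sequence {K : Cardinal.{u}} (hK : K.IsInaccessible) (hz : z < K.ord)
    (f : Ordinal.{u} → Ordinal.{u}) (hf : ∀ l < K.ord, f l < K.ord) :
    ∃ lam : Ordinal.{u} → Ordinal.{u}, (∀ i ≤ z, lam i < K.ord) ∧
      ∀ i j, i < j → j ≤ z → f (lam i) < lam j := by
  let lam : Ordinal.{u} → Ordinal.{u} := WellFounded.fix (r := (· < ·)) wellFounded_lt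
    fun j ih => ⨆ i : Iio j, f (ih i.1 i.2) + 1
  have hlam : ∀ j, lam j = ⨆ i : Iio j, f (lam i.1) + 1 := fun j => by
    simp only [lam]; rw [WellFounded.fix_eq]
  have hK1 : ∀ {c}, c < K.ord → c + 1 < K.ord := fun h =>
    (Cardinal.isSuccLimit_ord hK.aleph0_lt.le).add_one_lt h
  refine ⟨lam, fun j => ?_, fun i j hij _ => ?_⟩
  · induction j using WellFoundedLT.induction with
    | ind j ih =>
    intro hj
    obtain ⟨b, hb, hlb⟩ := exists_bound_ord hK (ι := Iio j) (mk_iio_lt_lift.2 (hj.trans_lt hz))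
      (fun i => f (lam i.1) + 1) fun i =>
        hK1 (hf _ (ih i.1 i.2 ((mem_Iio.1 i.2).le.trans hj)))
    rw [hlam]
    exact (ciSup_le' hlb).trans_lt hb
  · rw [hlam j]
    exact (Order.lt_add_one_iff.2 le_rfl).trans_le
      (le_ciSup (f := fun i : Iio j => f (lam i.1) + 1) Ordinal.bddAbove_of_small ⟨i, hij⟩)

/-- The iterations of lengths `lam i` (`i ≤ z`) of the measure on `z` move `x` to sets that are
different below `d`, after any iteration bounded by `z`. -/
def Splits (z d : Ordinal.{u}) (lam : Ordinal.{u} → Ordinal.{u}) (x : Set Ordinal.{u}) : Prop :=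
  (∀ i ≤ z, lam i < d) ∧ ∀ A ∈ lower z, ∀ i j, i < j → j ≤ z →
    emS (A ∪ blk z (lam i)) x ∩ Iio d ≠ emS (A ∪ blk z (lam j)) x ∩ Iio d

/-- Every disagreement occurs below some image of `z`; there are fewer than `K` pairs of a set `A`
and an index, so inaccessibility gives a common bound. -/
theorem exists_splits {K : Cardinal.{u}} (hK : K.IsInaccessible) (hz0 : 0 < z) (hz : z < K.ord)
    {lam : Ordinal.{u} → Ordinal.{u}} (hlam : ∀ i ≤ z, lam i < K.ord)
    (h : ∀ A ∈ lower z, ∀ i j, i < j → j ≤ z → ¬ Agree A z (lam i) (lam j) x) :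
    ∃ d < K.ord, Splits z d lam x := by
  have hKs := hK.isStrongLimit
  obtain ⟨b, hb, hbe⟩ := exists_bound_ord hK (ι := lower z × Iic z) (by
      rw [Cardinal.mk_prod, Cardinal.lift_id, Cardinal.lift_id]
      exact Cardinal.mul_lt_of_lt (by simpa using hKs.aleph0_le) (mk_lower_lt hKs hz)
        (mk_iic_lt hKs.aleph0_le hz))
    (fun p => emO (p.1.1 ∪ blk z (lam p.2.1)) z)
    fun p => emO_lower_lt hKs p.1.2 hz0 hz (hlam _ p.2.2) hz
  obtain ⟨b', hb', hbl⟩ := exists_bound_ord hK (ι := Iic z) (mk_iic_lt hKs.aleph0_le hz)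
    (fun i => lam i.1) fun i => hlam _ i.2
  refine ⟨max b b' + 1, (Cardinal.isSuccLimit_ord hKs.aleph0_le).add_one_lt (max_lt hb hb'),
    fun i hi => Order.lt_add_one_iff.2 ((hbl ⟨i, hi⟩).trans (le_max_right _ _)),
    fun A hA i j hij hj heq => h A hA i j hij hj fun c hc => ?_⟩
  have hc' : c ∈ Iio (max b b' + 1) := Order.lt_add_one_iff.2
    ((hc.le.trans (hbe (⟨A, hA⟩, ⟨j, hj⟩))).trans (le_max_left _ _))
  have := congrArg (c ∈ ·) heq
  simpa only [mem_inter_iff, hc', and_true, eq_iff_iff] using this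

end SigmaOne

namespace SigmaOne
open Filter Set

/-! ### Most sets are split at all measurable cardinals -/

variable {z : Ordinal.{u}} {κ : Ordinal.{u}}

/-- Some family of `z + 1` iterations of the measure on `z` of lengths bounded below `κ` splits `x`. -/
def SplitBelow (κ z : Ordinal.{u}) (x : Set Ordinal.{u}) : Prop := ∃ d < κ, ∃ lam, Splits z d lam x

theorem mk_powerset_iio_lt {K : Cardinal.{u}} (hK : K.IsStrongLimit) (hz : z < K.ord) :
    #(𝒫 (Iio z)) < Cardinal.lift.{u + 1} K := by
  rw [Cardinal.mk_powerset]
  exact (isStrongLimit_lift hK).isStrongPrelimit (mk_iio_lt_lift.2 hz)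

/-- An unsplit `x` has some `A` and `l` whose iteration agrees with those of all lengths `m < K`;
otherwise a fast sequence of lengths would split it. Then `A`, `l` and `x ∩ z` determine `x`, and
there are at most `K` such triples. -/
theorem mk_not_splitBelow_le_of_isInaccessible {K : Cardinal.{u}} (hK : K.IsInaccessible)
    (hm : Meas z) (hz : z < K.ord) :
    #{x | x ⊆ Iio K.ord ∧ ¬ SplitBelow K.ord z x} ≤ Cardinal.lift.{u + 1} K := by
  have hKs := hK.isStrongLimit
  have key : ∀ x : {x | x ⊆ Iio K.ord ∧ ¬ SplitBelow K.ord z x},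
      ∃ (A : lower z) (l : Iio K.ord), ∀ m < K.ord, Agree A.1 z l.1 m x.1 := by
    rintro ⟨x, hx, hns⟩
    by_contra! hno
    choose m hmlt hmA using hno
    have hb : ∀ l : Iio K.ord, ∃ b < K.ord, ∀ A, m A l ≤ b := fun l =>
      exists_bound_ord hK (mk_lower_lt hKs hz) (fun A => m A l) fun A => hmlt A l
    choose b hb hmb using hb
    obtain ⟨lam, hlam, hlt⟩ := exists_fast_sequence hK hz
      (fun l => if h : l < K.ord then b ⟨l, h⟩ else 0) fun l hl => by
        rw [dif_pos hl]; exact hb _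
    obtain ⟨d, hd, hs⟩ := exists_splits hK hm.pos hz hlam fun A hA i j hij hj hag => by
      have hi := hlam i (hij.le.trans hj)
      have h1 := hlt i j hij hj
      rw [dif_pos hi] at h1
      exact hmA ⟨A, hA⟩ ⟨_, hi⟩ (hag.of_le hA ((hmb ⟨_, hi⟩ ⟨A, hA⟩).trans h1.le))
    exact hns ⟨d, hd, lam, hs⟩
  choose A l hAl using key
  let code : {x | x ⊆ Iio K.ord ∧ ¬ SplitBelow K.ord z x} → (lower z × Iio K.ord) × 𝒫 (Iio z) :=
    fun x => ((A x, l x), ⟨x.1 ∩ Iio z, inter_subset_right⟩)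
  refine (Cardinal.mk_le_of_injective (f := code) fun x y hxy => ?_).trans ?_
  · have h1 : A x = A y := congrArg (fun p => p.1.1) hxy
    have h2 : l x = l y := congrArg (fun p => p.1.2) hxy
    have h3 : x.1 ∩ Iio z = y.1 ∩ Iio z := congrArg (fun p => p.2.1) hxy
    apply Subtype.ext
    have hlt : ∀ c < K.ord, c ∈ x.1 ↔ c ∈ y.1 := fun c hc => by
      have he := emO_lower_lt hKs (A x).2 hm.pos hz (l x).2 hc
      have he' := (Cardinal.isSuccLimit_ord hKs.aleph0_le).add_one_lt he
      have hy := hAl y _ he'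
      rw [← h1, ← h2] at hy
      exact (hAl x _ he').mem_iff hy (A x).2 hm h3 (Order.lt_add_one_iff.2 le_rfl)
    ext c
    exact ⟨fun h => (hlt c (x.2.1 h)).1 h, fun h => (hlt c (y.2.1 h)).2 h⟩
  · rw [Cardinal.mk_prod, Cardinal.mk_prod]
    simp only [Cardinal.lift_id]
    have hX : ℵ₀ ≤ Cardinal.lift.{u + 1} K := by simpa using hKs.aleph0_le
    refine Cardinal.mul_le_of_le hX (Cardinal.mul_le_of_le hX (mk_lower_lt hKs hz).le ?_)
      (mk_powerset_iio_lt hKs hz).le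
    rw [Cardinal.mk_Iio_ordinal, Cardinal.card_ord]

/-- For each `η` in a short cofinal set, fix lengths growing so fast that agreement of two of them
determines `x` up to `η`. An unsplit `x` has such an agreement for every `η`; the resulting codes
number fewer than `κ`, because `κ` is a strong limit and the cofinal set is short. -/
theorem mk_not_splitBelow_le_of_cof_lt (hκ : IsLimitOfMeasurables κ) (hcof : κ.cof < κ.card)
    (hm : Meas z) (hz : z < κ) :
    #{x | x ⊆ Iio κ ∧ ¬ SplitBelow κ z x} ≤ Cardinal.lift.{u + 1} κ.card := by
  have hKs := hκ.isStrongLimit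
  have hz' : z < κ.card.ord := by rwa [hκ.ord_card]
  obtain ⟨S, hS, hSc⟩ := Order.exists_cof_eq (Iio κ)
  rw [Ordinal.cof_Iio, ← Ordinal.lift_cof] at hSc
  have hlam : ∀ η : S, ∃ K : Cardinal.{u}, K.IsInaccessible ∧ z < K.ord ∧ K.ord < κ ∧
      ∃ lam : Ordinal.{u} → Ordinal.{u}, (∀ i ≤ z, lam i < K.ord) ∧ ∀ A ∈ lower z, ∀ i j, i < j →
        j ≤ z → emO (A ∪ blk z (lam i)) η.1.1 < lam j := by
    intro η
    obtain ⟨K, hK, h1, h2⟩ := hκ.2 (max z η.1.1) (max_lt hz η.1.2)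
    have hKi := hK.isInaccessible
    have hzK := (le_max_left _ _).trans_lt h1
    have hb : ∀ l : Iio K.ord, ∃ b < K.ord, ∀ A : lower z, emO (A.1 ∪ blk z l.1) η.1.1 ≤ b := fun l =>
      exists_bound_ord hKi (mk_lower_lt hKi.isStrongLimit hzK) _ fun A =>
        emO_lower_lt hKi.isStrongLimit A.2 hm.pos hzK l.2 ((le_max_right _ _).trans_lt h1)
    choose b hb hmb using hb
    obtain ⟨lam, hlam, hlt⟩ := exists_fast_sequence hKi hzK
      (fun l => if h : l < K.ord then b ⟨l, h⟩ else 0) fun l hl => by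
        rw [dif_pos hl]; exact hb _
    refine ⟨K, hKi, hzK, h2, lam, hlam, fun A hA i j hij hj => ?_⟩
    have hi := hlam i (hij.le.trans hj)
    have h1 := hlt i j hij hj
    rw [dif_pos hi] at h1
    exact (hmb ⟨_, hi⟩ ⟨A, hA⟩).trans_lt h1
  choose K hK hzK hKκ lam hlam hlt using hlam
  have key : ∀ (x : {x | x ⊆ Iio κ ∧ ¬ SplitBelow κ z x}) (η : S),
      ∃ p : lower z × Iic z × Iic z, p.2.1.1 < p.2.2.1 ∧
        Agree p.1.1 z (lam η p.2.1.1) (lam η p.2.2.1) x.1 := by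
    rintro ⟨x, hx, hns⟩ η
    by_contra! hno
    obtain ⟨d, hd, hs⟩ := exists_splits (hK η) hm.pos (hzK η) (hlam η) fun A hA i j hij hj hag =>
      hno (⟨A, hA⟩, ⟨i, hij.le.trans hj⟩, ⟨j, hj⟩) hij hag
    exact hns ⟨d, hd.trans (hKκ η), lam η, hs⟩
  choose p hp hag using key
  let code : {x | x ⊆ Iio κ ∧ ¬ SplitBelow κ z x} → 𝒫 (Iio z) × (S → lower z × Iic z × Iic z) :=
    fun x => (⟨x.1 ∩ Iio z, inter_subset_right⟩, p x)
  refine (Cardinal.mk_le_of_injective (f := code) fun x y hxy => ?_).trans ?_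
  · have h1 : p x = p y := congrArg (fun p => p.2) hxy
    have h3 : x.1 ∩ Iio z = y.1 ∩ Iio z := congrArg (fun p => p.1.1) hxy
    apply Subtype.ext
    have hlt : ∀ c < κ, c ∈ x.1 ↔ c ∈ y.1 := fun c hc => by
      obtain ⟨η, hη, hcη⟩ := hS ⟨c + 1, hκ.add_one_lt hc⟩
      have hcη' : c ≤ η.1 := (Order.lt_add_one_iff.2 le_rfl).le.trans hcη
      have hx := hag x ⟨η, hη⟩
      have hy := hag y ⟨η, hη⟩
      rw [← h1] at hy
      refine hx.mem_iff hy (p x ⟨η, hη⟩).1.2 hm h3 ?_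
      exact ((emO_strictMono (small_lower_union (p x ⟨η, hη⟩).1.2)).monotone hcη').trans_lt
        (hlt ⟨η, hη⟩ _ (p x ⟨η, hη⟩).1.2 _ _ (hp x ⟨η, hη⟩) (p x ⟨η, hη⟩).2.2.2)
    ext c
    exact ⟨fun h => (hlt c (x.2.1 h)).1 h, fun h => (hlt c (y.2.1 h)).2 h⟩
  · have hX := isStrongLimit_lift hKs
    have hIic : #(Iic z) < Cardinal.lift.{u + 1} κ.card := mk_iic_lt hKs.aleph0_le hz'
    rw [Cardinal.mk_prod, ← Cardinal.power_def, Cardinal.mk_prod, Cardinal.mk_prod]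
    simp only [Cardinal.lift_id]
    refine (Cardinal.mul_lt_of_lt hX.aleph0_le (mk_powerset_iio_lt hKs hz')
      (power_lt_of_isStrongLimit hX (Cardinal.mul_lt_of_lt hX.aleph0_le (mk_lower_lt hKs hz')
        (Cardinal.mul_lt_of_lt hX.aleph0_le hIic hIic)) ?_)).le
    rw [hSc]
    exact Cardinal.lift_lt.2 hcof

theorem mk_not_splitBelow_le (hκ : IsLimitOfMeasurables κ) (hm : Meas z) (hz : z < κ) :
    #{x | x ⊆ Iio κ ∧ ¬ SplitBelow κ z x} ≤ Cardinal.lift.{u + 1} κ.card := by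
  by_cases hcof : κ.cof < κ.card
  · exact mk_not_splitBelow_le_of_cof_lt hκ hcof hm hz
  · have hK : κ.card.IsInaccessible := by
      refine ⟨?_, by rw [hκ.ord_card]; exact not_lt.1 hcof, hκ.isStrongLimit.isStrongPrelimit⟩
      obtain ⟨μ, hμ, -, h⟩ := hκ.2 0 hκ.pos
      have := Ordinal.card_le_card h.le
      rw [Cardinal.card_ord] at this
      exact hμ.1.trans_le this
    have := mk_not_splitBelow_le_of_isInaccessible hK hm (z := z) (by rwa [hκ.ord_card])
    rwa [hκ.ord_card] at this

theorem exists_forall_splitBelow (hκ : IsLimitOfMeasurables κ) {D : Set (Set Ordinal.{u})}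
    (hD : ∀ x ∈ D, x ⊆ Iio κ) (hDκ : Cardinal.lift.{u + 1} κ.card < #D) :
    ∃ x ∈ D, ∀ z < κ, Meas z → SplitBelow κ z x := by
  by_contra! hno
  have hX : ℵ₀ ≤ Cardinal.lift.{u + 1} κ.card := Cardinal.aleph0_le_lift.2 hκ.isStrongLimit.aleph0_le
  have hsub : D ⊆ ⋃ z : {z : Iio κ // Meas z.1}, {x | x ⊆ Iio κ ∧ ¬ SplitBelow κ z.1.1 x} := by
    intro x hx
    obtain ⟨z, hz, hm, hs⟩ := hno x hx
    exact mem_iUnion.2 ⟨⟨⟨z, hz⟩, hm⟩, hD x hx, hs⟩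
  refine hDκ.not_ge ((Cardinal.mk_le_mk_of_subset hsub).trans ((Cardinal.mk_iUnion_le_sum_mk).trans ?_))
  refine (Cardinal.sum_le_sum _ (fun _ => Cardinal.lift.{u + 1} κ.card) fun z =>
    mk_not_splitBelow_le hκ z.2 z.1.2).trans ?_
  rw [Cardinal.sum_const']
  refine Cardinal.mul_le_of_le hX ?_ le_rfl
  exact (Cardinal.mk_subtype_le _).trans_eq (Cardinal.mk_Iio_ordinal κ)

end SigmaOne

namespace SigmaOne
open Filter Set

/-! ### Towers of measurable cardinals -/

variable {κ : Ordinal.{u}} {x : Set Ordinal.{u}} {ρ : Ordinal.{u}}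

/-- A sequence of blocks above `ρ` that is cofinal in `κ`, together with families of lengths that
have the property `R`. -/
structure Tower (κ : Ordinal.{u}) (R : Ordinal.{u} → Ordinal.{u} → (Ordinal.{u} → Ordinal.{u}) → Prop)
    (ρ : Ordinal.{u}) where
  /-- The blocks. -/
  block : Ordinal.{u} → Ordinal.{u}
  /-- Upper bounds of the blocks. -/
  top : Ordinal.{u} → Ordinal.{u}
  /-- The lengths of the iterations. -/
  len : Ordinal.{u} → Ordinal.{u} → Ordinal.{u}
  meas : ∀ ζ < κ.cof.ord, Meas (block ζ)
  isInaccessible : ∀ ζ < κ.cof.ord, ∃ K : Cardinal.{u}, K.IsInaccessible ∧ K.ord = block ζ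
  lt_block : ∀ ζ < κ.cof.ord, ρ < block ζ
  block_lt_top : ∀ ζ < κ.cof.ord, block ζ < top ζ
  top_lt : ∀ ζ < κ.cof.ord, top ζ < κ
  rel : ∀ ζ < κ.cof.ord, R (block ζ) (top ζ) (len ζ)
  bounded : ∀ ζ < κ.cof.ord, ∃ e < block ζ, ∀ ξ < ζ, top ξ ≤ e
  cofinal : ∀ η < κ, ∃ ζ < κ.cof.ord, η < block ζ

theorem Splits.mono {z d d' : Ordinal.{u}} {lam : Ordinal.{u} → Ordinal.{u}} (h : Splits z d lam x)
    (hd : d ≤ d') : Splits z d' lam x := by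
  refine ⟨fun i hi => (h.1 i hi).trans_le hd, fun A hA i j hij hj heq => h.2 A hA i j hij hj ?_⟩
  have := congrArg (· ∩ Iio d) heq
  simpa only [inter_assoc, inter_eq_self_of_subset_right (Iio_subset_Iio hd)] using this

theorem exists_cofinal_sequence (hκ : IsLimitOfMeasurables κ) :
    ∃ g : Ordinal.{u} → Ordinal.{u}, (∀ ζ, g ζ < κ) ∧ ∀ η < κ, ∃ ζ < κ.cof.ord, η ≤ g ζ := by
  obtain ⟨S, hS, hSc⟩ := Order.exists_cof_eq (Iio κ)
  rw [Ordinal.cof_Iio, ← Ordinal.lift_cof] at hSc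
  have : #(Iio κ.cof.ord) = #S := by rw [hSc, Cardinal.mk_Iio_ordinal, Cardinal.card_ord]
  obtain ⟨e⟩ := Cardinal.eq.1 this
  refine ⟨fun ζ => if h : ζ ∈ Iio κ.cof.ord then (e ⟨ζ, h⟩).1.1 else 0, fun ζ => ?_, fun η hη => ?_⟩
  · dsimp only
    split_ifs with h
    · exact (e ⟨ζ, h⟩).1.2
    · exact hκ.pos
  · obtain ⟨s, hs, hηs⟩ := hS ⟨η, hη⟩
    obtain ⟨ζ, hζ⟩ := e.surjective ⟨s, hs⟩
    refine ⟨ζ.1, ζ.2, ?_⟩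
    have hval : (if h : ζ.1 ∈ Iio κ.cof.ord then (e ⟨ζ.1, h⟩).1.1 else 0) = s.1 := by
      rw [dif_pos ζ.2, Subtype.coe_eta, hζ]
    exact (show η ≤ s.1 from hηs).trans_eq hval.symm

/-- Recursion along the cofinality: each block is taken above all earlier tops, above `ρ` and above
a member of a cofinal sequence. Fewer than `cof κ` tops are bounded below `κ`, so the recursion
continues. -/
theorem exists_tower (hκ : IsLimitOfMeasurables κ)
    {R : Ordinal.{u} → Ordinal.{u} → (Ordinal.{u} → Ordinal.{u}) → Prop}
    (hR : ∀ z < κ, Meas z → ∃ d lam, z < d ∧ d < κ ∧ R z d lam) (hρ : ρ < κ) :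
    Nonempty (Tower κ R ρ) := by
  obtain ⟨g, hg, hgc⟩ := exists_cofinal_sequence hκ
  have hnext : ∀ a : Iio κ, ∃ z, a.1 < z ∧ z < κ ∧ Meas z ∧
      ∃ K : Cardinal.{u}, K.IsInaccessible ∧ K.ord = z := fun a => by
    obtain ⟨μ, hμ, h1, h2⟩ := hκ.2 a.1 a.2
    exact ⟨μ.ord, h1, h2, hμ.meas, μ, hμ.isInaccessible, rfl⟩
  choose next hnext1 hnext2 hnext3 hnext4 using hnext
  have hR' : ∀ z, ∃ d lam, z < κ → Meas z → z < d ∧ d < κ ∧ R z d lam := by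
    intro z
    by_cases h : z < κ ∧ Meas z
    · obtain ⟨d, lam, hs⟩ := hR z h.1 h.2
      exact ⟨d, lam, fun _ _ => hs⟩
    · exact ⟨0, fun _ => 0, fun h1 h2 => absurd ⟨h1, h2⟩ h⟩
  choose d lam hdl using hR'
  let nx : Ordinal.{u} → Ordinal.{u} := fun a => if h : a < κ then next ⟨a, h⟩ else 0
  have hnx : ∀ a (h : a < κ), nx a = next ⟨a, h⟩ := fun a h => dif_pos h
  let δ : Ordinal.{u} → Ordinal.{u} := WellFounded.fix (r := (· < ·)) wellFounded_lt
    fun ζ ih => nx (max (⨆ ξ : Iio ζ, d (ih ξ.1 ξ.2)) (max ρ (g ζ)))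
  have hδ : ∀ ζ, δ ζ = nx (max (⨆ ξ : Iio ζ, d (δ ξ.1)) (max ρ (g ζ))) := fun ζ => by
    simp only [δ]; rw [WellFounded.fix_eq]
  have key : ∀ ζ < κ.cof.ord, δ ζ < κ ∧ Meas (δ ζ) ∧ max (⨆ ξ : Iio ζ, d (δ ξ.1)) (max ρ (g ζ)) < κ := by
    intro ζ
    induction ζ using WellFoundedLT.induction with
    | ind ζ ih =>
    intro hζ
    obtain ⟨b, hb, hle⟩ := exists_bound (ι := Iio ζ) (o := κ) (mk_iio_lt_lift.2 hζ)
      (fun ξ => d (δ ξ.1)) fun ξ => by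
        have := ih ξ.1 ξ.2 ((mem_Iio.1 ξ.2).trans hζ)
        exact (hdl _ this.1 this.2.1).2.1
    have hlt : max (⨆ ξ : Iio ζ, d (δ ξ.1)) (max ρ (g ζ)) < κ :=
      max_lt ((ciSup_le' hle).trans_lt hb) (max_lt hρ (hg ζ))
    rw [hδ ζ, hnx _ hlt]
    exact ⟨hnext2 _, hnext3 _, hlt⟩
  have hlt : ∀ ζ < κ.cof.ord, max (⨆ ξ : Iio ζ, d (δ ξ.1)) (max ρ (g ζ)) < δ ζ := fun ζ hζ => by
    have := hnext1 ⟨_, (key ζ hζ).2.2⟩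
    rwa [← hnx, ← hδ ζ] at this
  exact ⟨{
    block := δ
    top := fun ζ => d (δ ζ)
    len := fun ζ => lam (δ ζ)
    meas := fun ζ hζ => (key ζ hζ).2.1
    isInaccessible := fun ζ hζ => by
      rw [hδ ζ, hnx _ (key ζ hζ).2.2]
      exact hnext4 _
    lt_block := fun ζ hζ => ((le_max_left _ _).trans (le_max_right _ _)).trans_lt (hlt ζ hζ)
    block_lt_top := fun ζ hζ => (hdl _ (key ζ hζ).1 (key ζ hζ).2.1).1
    top_lt := fun ζ hζ => (hdl _ (key ζ hζ).1 (key ζ hζ).2.1).2.1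
    rel := fun ζ hζ => (hdl _ (key ζ hζ).1 (key ζ hζ).2.1).2.2
    bounded := fun ζ hζ => ⟨_, (le_max_left _ _).trans_lt (hlt ζ hζ), fun ξ hξ =>
      le_ciSup (f := fun ξ : Iio ζ => d (δ ξ.1)) Ordinal.bddAbove_of_small ⟨ξ, hξ⟩⟩
    cofinal := fun η hη => by
      obtain ⟨ζ, hζ, h⟩ := hgc η hη
      exact ⟨ζ, hζ, h.trans_lt (((le_max_right _ _).trans (le_max_right _ _)).trans_lt (hlt ζ hζ))⟩ }⟩

/-- Sufficiently late coordinates do not change the images of sets below a given bound. -/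
theorem mem_emS_iff_lower {A : Set Coord.{u}} (hA : Small.{u} A) {η η' c : Ordinal.{u}}
    (h : ∀ i ∈ A, η ≤ i.1 → η' ≤ i.1) (hc : c < η') :
    c ∈ emS A x ↔ c ∈ emS {i | i ∈ A ∧ i.1 < η} x := by
  have hsep : Separates {i : Coord.{u} | i.1 ∈ Iio η} {i | i ∈ A ∧ η ≤ i.1} {i | i ∈ A ∧ i.1 < η} :=
    ⟨IsCut.of_blocks _, fun i hi h => (mem_Iio.1 h).not_ge hi.2, fun i hi => hi.2⟩
  have heq : A = {i | i ∈ A ∧ η ≤ i.1} ∪ {i | i ∈ A ∧ i.1 < η} := by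
    ext i
    simp only [mem_union, mem_ofPred_eq, ← and_or_left, le_or_gt, and_true]
  have h₂ : Small.{u} {i | i ∈ A ∧ i.1 < η} := small_subset (sep_subset _ _)
  conv_lhs => rw [heq]
  exact hsep.mem_emS_iff (small_subset (sep_subset _ _)) h₂ (fun i hi _ => h i hi.1 hi.2) x
    (hc.trans_le (le_emO h₂ _))

namespace Tower

section

variable {R : Ordinal.{u} → Ordinal.{u} → (Ordinal.{u} → Ordinal.{u}) → Prop} (T : Tower κ R ρ)

theorem top_lt_block {ξ ζ : Ordinal.{u}} (hζ : ζ < κ.cof.ord) (h : ξ < ζ) : T.top ξ < T.block ζ := by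
  obtain ⟨e, he, hle⟩ := T.bounded ζ hζ
  exact (hle ξ h).trans_lt he

theorem block_lt_block {ξ ζ : Ordinal.{u}} (hζ : ζ < κ.cof.ord) (h : ξ < ζ) :
    T.block ξ < T.block ζ := (T.block_lt_top ξ (h.trans hζ)).trans (T.top_lt_block hζ h)

theorem block_lt_iff {ξ ζ : Ordinal.{u}} (hξ : ξ < κ.cof.ord) (hζ : ζ < κ.cof.ord) :
    T.block ξ < T.block ζ ↔ ξ < ζ := by
  refine ⟨fun h => ?_, T.block_lt_block hζ⟩
  by_contra! hle
  rcases hle.eq_or_lt with rfl | h'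
  · exact h.false
  · exact (T.block_lt_block hξ h').asymm h

theorem block_injOn {ξ ζ : Ordinal.{u}} (hξ : ξ < κ.cof.ord) (hζ : ζ < κ.cof.ord)
    (h : T.block ξ = T.block ζ) : ξ = ζ := by
  rcases lt_trichotomy ξ ζ with h' | h' | h'
  · exact absurd h (T.block_lt_block hζ h').ne
  · exact h'
  · exact absurd h (T.block_lt_block hξ h').ne'

/-! ### Coordinates of a tower -/

/-- All coordinates of the tower. -/
def coords : Set Coord.{u} := {i | ∃ ζ < κ.cof.ord, i.1 = T.block ζ ∧ i.2 < T.top ζ}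

theorem coords_mem_lower : T.coords ∈ lower κ := by
  rintro i ⟨ζ, hζ, h1, h2⟩
  exact ⟨h1 ▸ (T.block_lt_top ζ hζ).trans (T.top_lt ζ hζ), h2.trans (T.top_lt ζ hζ)⟩

theorem small_coords : Small.{u} T.coords := small_lower T.coords_mem_lower

theorem exists_lower {ζ : Ordinal.{u}} (hζ : ζ < κ.cof.ord) :
    ∃ e < T.block ζ, {i | i ∈ T.coords ∧ i.1 < T.block ζ} ∈ lower e := by
  obtain ⟨e, he, hle⟩ := T.bounded ζ hζ
  refine ⟨e, he, ?_⟩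
  rintro i ⟨⟨ξ, hξ, h1, h2⟩, h3⟩
  rw [h1, T.block_lt_iff hξ hζ] at h3
  have := hle ξ h3
  exact ⟨h1 ▸ (T.block_lt_top ξ hξ).trans_le this, h2.trans_le this⟩

/-- Earlier tops are bounded by some `e` below the block, which is inaccessible; hence the earlier
coordinates, and their finite subsets, are fewer than the block. -/
theorem sparse_coords : Sparse T.coords := by
  rintro i ⟨ζ, hζ, h1, -⟩ -
  obtain ⟨K, hK, hKζ⟩ := T.isInaccessible ζ hζ
  obtain ⟨e, he, hlow⟩ := T.exists_lower hζ
  rw [← hKζ] at he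
  rw [h1]
  have hs := small_lower hlow
  have hlt : #(Finset {j | j ∈ T.coords ∧ j.1 < T.block ζ}) < Cardinal.lift.{u + 1} K :=
    mk_finset_lt (Cardinal.aleph0_le_lift.2 hK.aleph0_lt.le)
      ((Cardinal.mk_le_mk_of_subset hlow).trans_lt (mk_prod_iio_lt hK.aleph0_lt.le he))
  obtain ⟨c, hc, hce⟩ := Cardinal.lt_lift_iff.1 hlt
  have hcard : #(Finset {j | j ∈ T.coords ∧ j.1 < T.block ζ}) = #(Iio c.ord) := by
    rw [← hce, Cardinal.mk_Iio_ordinal, Cardinal.card_ord]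
  obtain ⟨f⟩ := Cardinal.eq.1 hcard
  exact (below_iio ((Cardinal.ord_lt_ord.2 hc).trans_eq hKζ)).of_injective f f.injective

theorem infinite_blocks (hκ : IsLimitOfMeasurables κ) :
    {d | ∃ ζ < κ.cof.ord, d = T.block ζ}.Infinite := by
  have hn : ∀ n : ℕ, (n : Ordinal.{u}) < κ.cof.ord := fun n => by
    rw [← Cardinal.ord_natCast, Cardinal.ord_lt_ord]
    exact (Cardinal.natCast_lt_aleph0).trans_le
      (Ordinal.aleph0_le_cof_iff.2 (Ordinal.one_lt_cof_iff.2 hκ.isSuccLimit))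
  exact Set.infinite_of_injective_forall_mem (f := fun n : ℕ => T.block n)
    (fun m n h => Nat.cast_injective (T.block_injOn (hn m) (hn n) h)) fun n => ⟨n, hn n, rfl⟩

end

theorem exists_of_splitBelow (hκ : IsLimitOfMeasurables κ) (hx : ∀ z < κ, Meas z → SplitBelow κ z x)
    (hρ : ρ < κ) : Nonempty (Tower κ (fun z d lam => Splits z d lam x) ρ) := by
  refine exists_tower hκ (fun z hz hm => ?_) hρ
  obtain ⟨d, hd, lam, hs⟩ := hx z hz hm
  exact ⟨max d (z + 1), lam, lt_max_of_lt_right (Order.lt_add_one_iff.2 le_rfl),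
    max_lt hd (hκ.add_one_lt hz), hs.mono (le_max_left _ _)⟩

variable (T : Tower κ (fun z d lam => Splits z d lam x) ρ)

/-! ### Iterations with lengths selected along a tower -/

variable (M : Set Ordinal.{u}) (t : Ordinal.{u} → Ordinal.{u})

/-- The coordinates of the iteration described by `t`, without the blocks in `M`. -/
def sel : Set Coord.{u} :=
  {i | ∃ ζ < κ.cof.ord, i.1 = T.block ζ ∧ T.block ζ ∉ M ∧ i.2 < T.len ζ (t ζ)}

variable {M t}

theorem sel_subset (ht : ∀ ζ < κ.cof.ord, t ζ ≤ T.block ζ) : T.sel M t ⊆ T.coords := by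
  rintro i ⟨ζ, hζ, h1, -, h2⟩
  exact ⟨ζ, hζ, h1, h2.trans ((T.rel ζ hζ).1 _ (ht ζ hζ))⟩

theorem sel_lower_congr {t' : Ordinal.{u} → Ordinal.{u}} {ζ : Ordinal.{u}} (hζ : ζ < κ.cof.ord)
    (h : ∀ ξ < ζ, T.block ξ ∉ M → t ξ = t' ξ) :
    {i | i ∈ T.sel M t ∧ i.1 < T.block ζ} = {i | i ∈ T.sel M t' ∧ i.1 < T.block ζ} := by
  ext i
  constructor
  all_goals
    rintro ⟨⟨ξ, hξ, h1, h2, h3⟩, h4⟩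
    have h5 := h4
    rw [h1, T.block_lt_iff hξ hζ] at h5
    refine ⟨⟨ξ, hξ, h1, h2, ?_⟩, h4⟩
  · rwa [← h ξ h5 h2]
  · rwa [h ξ h5 h2]

/-- The iterations described by `t` and `t'` agree below a block if `t` and `t'` agree before. -/
theorem emS_sel_inter_eq {t' : Ordinal.{u} → Ordinal.{u}} (ht : ∀ ζ < κ.cof.ord, t ζ ≤ T.block ζ)
    (ht' : ∀ ζ < κ.cof.ord, t' ζ ≤ T.block ζ) {ζ : Ordinal.{u}} (hζ : ζ < κ.cof.ord)
    (h : ∀ ξ < ζ, T.block ξ ∉ M → t ξ = t' ξ) {c : Ordinal.{u}} (hc : c < T.block ζ) :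
    c ∈ emS (T.sel M t) x ↔ c ∈ emS (T.sel M t') x := by
  have := T.small_coords
  rw [mem_emS_iff_lower (small_subset (T.sel_subset ht)) (fun _ _ h => h) hc,
    mem_emS_iff_lower (small_subset (T.sel_subset ht')) (fun _ _ h => h) hc, T.sel_lower_congr hζ h]

/-- Blocks after `ζ` lie above `top ζ` and have no influence below it. -/
theorem mem_emS_sel_iff (ht : ∀ ζ < κ.cof.ord, t ζ ≤ T.block ζ) {ζ : Ordinal.{u}}
    (hζ : ζ < κ.cof.ord) (hM : T.block ζ ∉ M) {c : Ordinal.{u}} (hc : c < T.top ζ) :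
    c ∈ emS (T.sel M t) x ↔
      c ∈ emS ({i | i ∈ T.sel M t ∧ i.1 < T.block ζ} ∪ blk (T.block ζ) (T.len ζ (t ζ))) x := by
  have := T.small_coords
  have heq : {i | i ∈ T.sel M t ∧ i.1 < T.block ζ} ∪ blk (T.block ζ) (T.len ζ (t ζ)) =
      {i | i ∈ T.sel M t ∧ i.1 < T.block ζ + 1} := by
    ext i
    simp only [mem_union, mem_ofPred_eq, blk, Order.lt_add_one_iff]
    constructor
    · rintro (⟨h1, h2⟩ | ⟨h1, h2⟩)
      · exact ⟨h1, h2.le⟩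
      · exact ⟨⟨ζ, hζ, h1, hM, h2⟩, h1.le⟩
    · rintro ⟨h1, h2⟩
      rcases h2.lt_or_eq with h3 | h3
      · exact .inl ⟨h1, h3⟩
      · obtain ⟨ξ, hξ, h4, -, h5⟩ := h1
        obtain rfl := T.block_injOn hξ hζ (h4.symm.trans h3)
        exact .inr ⟨h3, h5⟩
  rw [heq]
  refine mem_emS_iff_lower (small_subset (T.sel_subset ht)) (fun i hi hle => ?_) hc
  obtain ⟨ξ, hξ, h1, -, -⟩ := hi
  rw [h1, Order.add_one_le_iff, T.block_lt_iff hζ hξ] at hle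
  rw [h1]
  exact (T.top_lt_block hξ hle).le

/-- Iterations that agree below the top of a block are described by functions that agree there. -/
theorem eq_of_emS_sel_inter_eq {t' : Ordinal.{u} → Ordinal.{u}} (ht : ∀ ζ < κ.cof.ord, t ζ ≤ T.block ζ)
    (ht' : ∀ ζ < κ.cof.ord, t' ζ ≤ T.block ζ) {ζ : Ordinal.{u}} (hζ : ζ < κ.cof.ord)
    (hM : T.block ζ ∉ M) (h : emS (T.sel M t) x ∩ Iio (T.top ζ) = emS (T.sel M t') x ∩ Iio (T.top ζ)) :
    t ζ = t' ζ := by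
  induction ζ using WellFoundedLT.induction with
  | ind ζ ih =>
  have hlow : ∀ ξ < ζ, T.block ξ ∉ M → t ξ = t' ξ := fun ξ hξ hξM => ih ξ hξ (hξ.trans hζ) hξM (by
    have := congrArg (· ∩ Iio (T.top ξ)) h
    simpa only [inter_assoc, inter_eq_self_of_subset_right
      (Iio_subset_Iio ((T.top_lt_block hζ hξ).trans (T.block_lt_top ζ hζ)).le)] using this)
  have hA : {i | i ∈ T.sel M t ∧ i.1 < T.block ζ} ∈ lower (T.block ζ) := by
    obtain ⟨e, he, hlow⟩ := T.exists_lower hζ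
    rintro i ⟨h1, h2⟩
    have := hlow (⟨T.sel_subset ht h1, h2⟩ : i ∈ {i | i ∈ T.coords ∧ i.1 < T.block ζ})
    exact ⟨(mem_Iio.1 this.1).trans he, (mem_Iio.1 this.2).trans he⟩
  -- The lower parts coincide by induction, so the two iterations differ at most in the length at
  -- block `ζ`, where splitting applies.
  have heq : emS ({i | i ∈ T.sel M t ∧ i.1 < T.block ζ} ∪ blk (T.block ζ) (T.len ζ (t ζ))) x ∩ Iio (T.top ζ) =
      emS ({i | i ∈ T.sel M t ∧ i.1 < T.block ζ} ∪ blk (T.block ζ) (T.len ζ (t' ζ))) x ∩ Iio (T.top ζ) := by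
    ext c
    simp only [mem_inter_iff, mem_Iio]
    refine and_congr_left fun hc => ?_
    rw [← T.mem_emS_sel_iff ht hζ hM hc, T.sel_lower_congr hζ hlow, ← T.mem_emS_sel_iff ht' hζ hM hc]
    have := congrArg (c ∈ ·) h
    simpa only [mem_inter_iff, mem_Iio.2 hc, and_true, eq_iff_iff] using this
  rcases lt_trichotomy (t ζ) (t' ζ) with h' | h' | h'
  · exact absurd heq ((T.rel ζ hζ).2 _ hA _ _ h' (ht' ζ hζ))
  · exact h'
  · exact absurd heq.symm ((T.rel ζ hζ).2 _ hA _ _ h' (ht ζ hζ))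

end Tower

end SigmaOne

namespace SigmaOne
open Filter Set

/-! ### Perfect embeddings -/

variable {κ θ : Ordinal.{u}}

theorem isOpen_funSpace_basic (s : FunSpace θ κ) (ξ : Iio θ) :
    IsOpen {x : FunSpace θ κ | ∀ β < ξ, x β = s β} := .basic _ ⟨s, ξ, rfl⟩

theorem isOpen_powerSpace_basic (X : PowerSpace κ) (η : Iio κ) :
    IsOpen {Y : PowerSpace κ | Y.1 ∩ η.1.toZFSet = X.1 ∩ η.1.toZFSet} := .basic _ ⟨X, η, rfl⟩

/-- `h1` is continuity; `h2` recovers initial segments of `s` from bounded parts of `F s`, which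
gives openness onto the range and, by `hθ`, injectivity. -/
theorem isPerfectEmbedding_of_forall (hθ : ∀ β : Iio θ, ∃ ξ, β < ξ) {F : FunSpace θ κ → PowerSpace κ}
    (h1 : ∀ s, ∀ η : Iio κ, ∃ ξ : Iio θ, ∀ s', (∀ β < ξ, s' β = s β) →
      (F s').1 ∩ η.1.toZFSet = (F s).1 ∩ η.1.toZFSet)
    (h2 : ∀ s, ∀ ξ : Iio θ, ∃ η : Iio κ, ∀ s',
      (F s').1 ∩ η.1.toZFSet = (F s).1 ∩ η.1.toZFSet → ∀ β < ξ, s' β = s β) :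
    IsPerfectEmbedding F := by
  refine ⟨⟨le_antisymm ?_ ?_⟩, fun s s' h => ?_⟩
  · rw [← continuous_iff_le_induced]
    refine continuous_generateFrom_iff.2 ?_
    rintro _ ⟨X, η, rfl⟩
    refine isOpen_iff_forall_mem_open.2 fun s hs => ?_
    obtain ⟨ξ, hξ⟩ := h1 s η
    exact ⟨_, fun s' hs' => (hξ s' hs').trans hs, isOpen_funSpace_basic s ξ, fun _ _ => rfl⟩
  · refine le_generateFrom ?_
    rintro _ ⟨s₀, ξ, rfl⟩
    refine isOpen_induced_iff.2 ⟨⋃ s ∈ {s | ∀ β < ξ, s β = s₀ β}, {Y | Y.1 ∩ (h2 s ξ).choose.1.toZFSet =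
      (F s).1 ∩ (h2 s ξ).choose.1.toZFSet}, isOpen_biUnion fun s _ => isOpen_powerSpace_basic _ _, ?_⟩
    ext s'
    simp only [mem_preimage, mem_iUnion, mem_ofPred_eq, exists_prop]
    refine ⟨fun ⟨s, hs, h⟩ β hβ => ((h2 s ξ).choose_spec s' h β hβ).trans (hs β hβ), fun h => ⟨s', h, rfl⟩⟩
  · funext β
    obtain ⟨ξ, hξ⟩ := hθ β
    obtain ⟨η, hη⟩ := h2 s' ξ
    exact hη s (by rw [h]) β hξ

theorem ordSet_subset {X : ZFSet.{u}} (hX : X ⊆ κ.toZFSet) : ordSet X ⊆ Iio κ := fun _ hc =>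
  Ordinal.toZFSet_mem_toZFSet_iff.1 (hX hc)

theorem isOrdinal_of_mem {X : ZFSet.{u}} (hX : X ⊆ κ.toZFSet) {y : ZFSet.{u}} (hy : y ∈ X) :
    y.IsOrdinal := (ZFSet.isOrdinal_toZFSet κ).mem (hX hy)

theorem inter_toZFSet_eq_iff {X Y : ZFSet.{u}} {η : Ordinal.{u}} :
    X ∩ η.toZFSet = Y ∩ η.toZFSet ↔ ∀ c < η, c ∈ ordSet X ↔ c ∈ ordSet Y := by
  constructor
  · intro h c hc
    have := congrArg (c.toZFSet ∈ ·) h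
    simpa [ordSet, ZFSet.mem_inter, Ordinal.toZFSet_mem_toZFSet_iff, hc] using this
  · intro h
    ext y
    simp only [ZFSet.mem_inter]
    refine and_congr_left fun hy => ?_
    have hy' := ((ZFSet.isOrdinal_toZFSet η).mem hy).toZFSet_rank_eq
    rw [← hy'] at hy ⊢
    exact h _ (Ordinal.toZFSet_mem_toZFSet_iff.1 hy)

theorem ordSet_injOn {X Y : ZFSet.{u}} (hX : X ⊆ κ.toZFSet) (hY : Y ⊆ κ.toZFSet)
    (h : ordSet X = ordSet Y) : X = Y := by
  have := (inter_toZFSet_eq_iff (X := X) (Y := Y) (η := κ)).2 fun c _ => by rw [h]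
  have h1 : ∀ {X : ZFSet.{u}}, X ⊆ κ.toZFSet → X ∩ κ.toZFSet = X := fun hX => by
    ext y
    simpa using fun hy => hX hy
  rwa [h1 hX, h1 hY] at this

/-- The first component of a bijection of `c` with `c × c`, replaced by `0` where it exceeds its
argument. A bounded fibre would inject `c` into a smaller ordinal. -/
theorem exists_regressive_with_cofinal_fibres {c : Cardinal.{u}} (hc : ℵ₀ ≤ c) :
    ∃ q : Ordinal.{u} → Ordinal.{u}, (∀ ζ, q ζ ≤ ζ) ∧
      ∀ ξ < c.ord, ∀ ζ₀ < c.ord, ∃ ζ < c.ord, ζ₀ ≤ ζ ∧ q ζ = ξ := by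
  have hl : ℵ₀ ≤ #(Iio c.ord) := by
    rw [Cardinal.mk_Iio_ordinal, Cardinal.card_ord]; exact Cardinal.aleph0_le_lift.2 hc
  have : #(Iio c.ord) = #(Iio c.ord × Iio c.ord) := by
    rw [Cardinal.mk_prod, Cardinal.lift_id, Cardinal.mul_eq_self hl]
  obtain ⟨e⟩ := Cardinal.eq.1 this
  let p : Ordinal.{u} → Ordinal.{u} := fun ζ => if h : ζ ∈ Iio c.ord then (e ⟨ζ, h⟩).1.1 else 0
  refine ⟨fun ζ => if p ζ ≤ ζ then p ζ else 0, fun ζ => ?_, fun ξ hξ ζ₀ hζ₀ => ?_⟩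
  · dsimp only
    split_ifs with h
    · exact h
    · exact zero_le
  · by_contra! hno
    have hm : max ζ₀ ξ < c.ord := max_lt hζ₀ hξ
    have hinj : #(Iio c.ord) ≤ #(Iio (max ζ₀ ξ)) := by
      refine Cardinal.mk_le_of_injective (f := fun a => ⟨(e.symm (⟨ξ, hξ⟩, a)).1, ?_⟩) ?_
      · by_contra hge
        rw [mem_Iio, not_lt] at hge
        set ζ := e.symm (⟨ξ, hξ⟩, a)
        have hp : p ζ.1 = ξ := by
          simp only [p]
          rw [dif_pos ζ.2, Subtype.coe_eta, Equiv.apply_symm_apply]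
        refine hno ζ.1 ζ.2 ((le_max_left _ _).trans hge) ?_
        rw [hp, if_pos ((le_max_right _ _).trans hge)]
      · intro a b hab
        have := e.symm.injective (Subtype.ext (congrArg (fun y : Iio (max ζ₀ ξ) => y.1) hab))
        exact congrArg Prod.snd this
    refine hinj.not_gt ?_
    rw [Cardinal.mk_Iio_ordinal c.ord, Cardinal.card_ord]
    exact mk_iio_lt_lift.2 hm

/-- Every sufficiently large definable set of subsets of `κ` has an element that is split at all
measurable cardinals below `κ`. -/
theorem exists_mem_forall_splitBelow (hκ : IsLimitOfMeasurables κ) {D : ZFSet.{u}}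
    (hD : D ⊆ κ.toZFSet.powerset) (hDκ : κ.card < D.card) :
    ∃ X ∈ D, ∀ z < κ, Meas z → SplitBelow κ z (ordSet X) := by
  have hsub : ∀ X ∈ D, X ⊆ κ.toZFSet := fun X hX => ZFSet.mem_powerset.1 (hD hX)
  have hcard : Cardinal.lift.{u + 1} κ.card < #(ordSet '' {X | X ∈ D}) := by
    rw [Cardinal.mk_image_eq_of_injOn ordSet {X | X ∈ D} fun X hX Y hY h =>
      ordSet_injOn (hsub X hX) (hsub Y hY) h]
    refine lt_of_lt_of_eq ?_ (ZFSet.cardinalMk_coe_sort (x := D)).symm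
    exact Cardinal.lift_lt.2 hDκ
  obtain ⟨_, ⟨X, hX, rfl⟩, h⟩ := exists_forall_splitBelow hκ (by
    rintro _ ⟨X, hX, rfl⟩
    exact ordSet_subset (hsub X hX)) hcard
  exact ⟨X, hX, h⟩

theorem emb_subset_toZFSet {A : Set Coord.{u}} (hA : Small.{u} A) {X : ZFSet.{u}}
    (hX : X ⊆ κ.toZFSet) (h : emO A κ = κ) : emb A X ⊆ κ.toZFSet := by
  have := emb_subset hA hX
  rwa [emb_toZFSet hA, h] at this

theorem mem_ordSet_emb {A : Set Coord.{u}} (hA : Small.{u} A) {X : ZFSet.{u}}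
    (hX : X ⊆ κ.toZFSet) {c : Ordinal.{u}} : c ∈ ordSet (emb A X) ↔ c ∈ emS A (ordSet X) := by
  rw [ordSet_emb hA fun y hy => isOrdinal_of_mem hX hy]

theorem exists_perfectEmbedding (hκ : IsLimitOfMeasurables κ) {D : ZFSet.{u}}
    (hD : D ⊆ κ.toZFSet.powerset) (hDκ : κ.card < D.card)
    (hdef : IsSigma1Definable (hereditarySets κ ∪ ordinals) {X | X ∈ D}) :
    ∃ ι : FunSpace κ.cof.ord κ → PowerSpace κ, IsPerfectEmbedding ι ∧ ∀ x, (ι x).1 ∈ D := by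
  classical
  obtain ⟨X, hX, hsplit⟩ := exists_mem_forall_splitBelow hκ hD hDκ
  have hXκ : X ⊆ κ.toZFSet := ZFSet.mem_powerset.1 (hD hX)
  obtain ⟨ρ, hρ, F, hF⟩ := hdef.exists_emb_mem hκ
  obtain ⟨T⟩ := Tower.exists_of_splitBelow hκ hsplit hρ
  have hcof : ℵ₀ ≤ κ.cof := Ordinal.aleph0_le_cof_iff.2 (Ordinal.one_lt_cof_iff.2 hκ.isSuccLimit)
  have hθ : Order.IsSuccLimit κ.cof.ord := Cardinal.isSuccLimit_ord hcof
  obtain ⟨q, hq, hqc⟩ := exists_regressive_with_cofinal_fibres hcof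
  -- Omitting these finitely many blocks fixes the parameters and `κ`.
  let M : Set Ordinal.{u} := ⋃ c ∈ insert κ F, moving T.coords c
  have hMf : M.Finite := (insert κ F).finite_toSet.biUnion fun c _ =>
    moving_finite T.small_coords T.sparse_coords c
  obtain ⟨ζM, hζM, hM⟩ : ∃ ζM < κ.cof.ord, ∀ ζ < κ.cof.ord, ζM ≤ ζ → T.block ζ ∉ M := by
    obtain ⟨b, hb, hle⟩ := exists_bound (ι := ↑(M ∩ Iio κ)) (o := κ)
      (((hMf.inter_of_left (Iio κ)).lt_aleph0).trans_le (Cardinal.aleph0_le_lift.2 hcof))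
      (fun m => m.1) fun m => m.2.2
    obtain ⟨ζM, hζM, hbM⟩ := T.cofinal b hb
    refine ⟨ζM, hζM, fun ζ hζ hle' hmem => ?_⟩
    have h1 := hle ⟨_, hmem, (T.block_lt_top ζ hζ).trans (T.top_lt ζ hζ)⟩
    rcases hle'.eq_or_lt with rfl | h
    · exact h1.not_gt hbM
    · exact h1.not_gt (hbM.trans (T.block_lt_block hζ h))
  -- Block `ζ` records the value of `s` at `q ζ ≤ ζ`, truncated because only indices up to the block
  -- are available. As every argument recurs cofinally often, each value is eventually recorded in
  -- full.
  let t : FunSpace κ.cof.ord κ → Ordinal.{u} → Ordinal.{u} := fun s ζ =>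
    if h : q ζ ∈ Iio κ.cof.ord then min (s ⟨q ζ, h⟩).1 (T.block ζ) else 0
  have ht : ∀ s, ∀ ζ < κ.cof.ord, t s ζ ≤ T.block ζ := fun s ζ _ => by
    simp only [t]
    split_ifs
    exacts [min_le_right _ _, zero_le]
  have hA : ∀ s, Small.{u} (T.sel M (t s)) := fun s =>
    have := T.small_coords
    small_subset (T.sel_subset (ht s))
  have hfix : ∀ s, ∀ c ∈ insert κ F, emO (T.sel M (t s)) c = c := fun s c hc =>
    emO_eq_of_disjoint_moving T.small_coords T.sparse_coords (T.sel_subset (ht s)) fun i hi hm => by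
      obtain ⟨ζ, -, h1, h2, -⟩ := hi
      exact h2 (h1 ▸ mem_biUnion hc hm)
  have hsub : ∀ s, emb (T.sel M (t s)) X ⊆ κ.toZFSet := fun s =>
    emb_subset_toZFSet (hA s) hXκ (hfix s κ (Finset.mem_insert_self _ _))
  refine ⟨fun s => ⟨emb (T.sel M (t s)) X, hsub s⟩, isPerfectEmbedding_of_forall
    (fun β => ⟨⟨β.1 + 1, hθ.add_one_lt β.2⟩, show β.1 < β.1 + 1 from Order.lt_add_one_iff.2 le_rfl⟩) ?_ ?_, fun s => ?_⟩
  · intro s η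
    obtain ⟨ζ, hζ, hηζ⟩ := T.cofinal η.1 η.2
    refine ⟨⟨ζ, hζ⟩, fun s' hs' => inter_toZFSet_eq_iff.2 fun c hc => ?_⟩
    rw [mem_ordSet_emb (hA s') hXκ, mem_ordSet_emb (hA s) hXκ]
    refine T.emS_sel_inter_eq (ht s') (ht s) hζ (fun ξ hξ _ => ?_) (hc.trans hηζ)
    have hqξ : q ξ ∈ Iio κ.cof.ord := ((hq ξ).trans_lt hξ).trans hζ
    simp only [t, dif_pos hqξ]
    rw [hs' ⟨q ξ, hqξ⟩ ((hq ξ).trans_lt hξ)]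
  · intro s ξ
    have hex : ∀ β : Iio κ.cof.ord, ∃ ζ < κ.cof.ord, ζM ≤ ζ ∧ (s β).1 < T.block ζ ∧ q ζ = β.1 := by
      intro β
      obtain ⟨ζ₁, h1, h2⟩ := T.cofinal (s β).1 (s β).2
      obtain ⟨ζ, h3, h4, h5⟩ := hqc β.1 β.2 (max ζ₁ ζM) (max_lt h1 hζM)
      refine ⟨ζ, h3, (le_max_right _ _).trans h4, h2.trans_le ?_, h5⟩
      rcases ((le_max_left _ _).trans h4).eq_or_lt with h | h
      · rw [h]
      · exact (T.block_lt_block h3 h).le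
    choose ζ hζ hζM' hsζ hqζ using hex
    -- Fewer than `cof κ` blocks have to be inspected, so their tops are bounded below `κ`.
    obtain ⟨b, hb, hle⟩ := exists_bound (ι := Iio ξ.1) (o := κ) (mk_iio_lt_lift.2 ξ.2)
      (fun β => T.top (ζ ⟨β.1, (mem_Iio.1 β.2).trans ξ.2⟩)) fun β => T.top_lt _ (hζ _)
    refine ⟨⟨b, hb⟩, fun s' hs' β hβ => ?_⟩
    have hs'' := inter_toZFSet_eq_iff.1 hs'
    have heq : t s' (ζ β) = t s (ζ β) := by
      refine T.eq_of_emS_sel_inter_eq (ht s') (ht s) (hζ β) (hM _ (hζ β) (hζM' β)) ?_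
      ext c
      simp only [mem_inter_iff, mem_Iio]
      refine and_congr_left fun hc => ?_
      rw [← mem_ordSet_emb (hA s') hXκ, ← mem_ordSet_emb (hA s) hXκ]
      exact hs'' c (hc.trans_le (hle ⟨β.1, hβ⟩))
    have hqβ : q (ζ β) ∈ Iio κ.cof.ord := by rw [hqζ]; exact β.2
    have hval : ∀ s : FunSpace κ.cof.ord κ, s ⟨q (ζ β), hqβ⟩ = s β := fun s =>
      congrArg s (Subtype.ext (hqζ β))
    simp only [t, dif_pos hqβ, hval, min_eq_left (hsζ β).le] at heq
    apply Subtype.ext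
    -- If `s' β` were truncated, the recorded value would be the block itself, which is larger than
    -- `s β`.
    rcases min_choice (s' β).1 (T.block (ζ β)) with h | h
    · rwa [h] at heq
    · rw [h] at heq
      exact absurd heq (hsζ β).ne'
  · refine hF _ (hA s) (fun i hi => ?_) (fun c hc => hfix s c (Finset.mem_insert_of_mem hc)) X hX
    obtain ⟨ζ, hζ, h1, -⟩ := hi
    rw [h1]
    exact T.lt_block ζ hζ

end SigmaOne

namespace SigmaOne
open Filter Set

/-! ### Wellorders -/

variable {κ : Ordinal.{u}}

/-- Only `W` is assumed definable; that the images of `X` stay in `D` is read off from comparisons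
in `W`. -/
theorem not_exists_wellorder (hκ : IsLimitOfMeasurables κ) {D W : ZFSet.{u}}
    (hD : D ⊆ κ.toZFSet.powerset) (hDκ : κ.card < D.card) (hW : IsWellorderOf W D)
    (hdef : IsSigma1Definable (hereditarySets κ ∪ ordinals) {z | z ∈ W}) : False := by
  classical
  obtain ⟨X, hX, hsplit⟩ := exists_mem_forall_splitBelow hκ hD hDκ
  have hXκ : X ⊆ κ.toZFSet := ZFSet.mem_powerset.1 (hD hX)
  obtain ⟨ρ, hρ, F, hF⟩ := hdef.exists_emb_mem hκ
  obtain ⟨T⟩ := Tower.exists_of_splitBelow hκ hsplit hρ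
  obtain ⟨hWD, hwo⟩ := hW
  have hWmem : ∀ {Y Z}, ZFSet.pair Y Z ∈ W → Y ∈ D ∧ Z ∈ D := fun h =>
    ZFSet.pair_mem_prod.1 (hWD h)
  have htri : ∀ Y ∈ D, ∀ Z ∈ D, Y ≠ Z → ZFSet.pair Y Z ∈ W ∨ ZFSet.pair Z Y ∈ W := by
    intro Y hY Z hZ hne
    by_contra! h
    exact hne (congrArg Subtype.val (hwo.toTrichotomous.trichotomous ⟨Y, hY⟩ ⟨Z, hZ⟩ h.1 h.2))
  have hdesc : ∀ Y : ℕ → ZFSet.{u}, ¬ ∀ n, ZFSet.pair (Y (n + 1)) (Y n) ∈ W := fun Y hY =>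
    (wellFounded_iff_isEmpty_descending_chain.1 hwo.toIsWellFounded.wf).false
      ⟨fun n => ⟨Y n, (hWmem (hY n)).2⟩, hY⟩
  let M : Set Ordinal.{u} := ⋃ c ∈ insert κ F, moving T.coords c
  have hMf : M.Finite := (insert κ F).finite_toSet.biUnion fun c _ =>
    moving_finite T.small_coords T.sparse_coords c
  have ht : ∀ ζ, ∃ i, ζ < κ.cof.ord →
      i ≤ T.block ζ ∧ emS (blk (T.block ζ) (T.len ζ i)) (ordSet X) ≠ ordSet X := by
    intro ζ
    by_cases hζ : ζ < κ.cof.ord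
    -- The lengths with indices `0` and `1` give different images of `X`, so at least one of them
    -- moves `X`.
    · have h01 := (T.rel ζ hζ).2 ∅ (empty_subset _) 0 1 zero_lt_one
        (Order.one_le_iff_pos.2 (T.meas ζ hζ).pos)
      rw [empty_union, empty_union] at h01
      by_cases h0 : emS (blk (T.block ζ) (T.len ζ 0)) (ordSet X) = ordSet X
      · refine ⟨1, fun _ => ⟨Order.one_le_iff_pos.2 (T.meas ζ hζ).pos, fun h1 => h01 ?_⟩⟩
        rw [h0, h1]
      · exact ⟨0, fun _ => ⟨zero_le, h0⟩⟩
    · exact ⟨0, fun h => absurd h hζ⟩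
  choose t ht using ht
  set A := T.sel M t
  have hAc : A ⊆ T.coords := T.sel_subset fun ζ hζ => (ht ζ hζ).1
  have hA : Small.{u} A := have := T.small_coords; small_subset hAc
  have hfix : ∀ S : Set Ordinal.{u}, ∀ c ∈ insert κ F, emO (res A S) c = c := fun S c hc =>
    emO_eq_of_disjoint_moving T.small_coords T.sparse_coords (res_subset.trans hAc) fun i hi hm => by
      obtain ⟨ζ, -, h1, h2, -⟩ := hi.1
      exact h2 (h1 ▸ mem_biUnion hc hm)
  have hsub : ∀ (S : Set Ordinal.{u}) {Y : ZFSet.{u}}, Y ⊆ κ.toZFSet → emb (res A S) Y ⊆ κ.toZFSet :=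
    fun S Y hY => emb_subset_toZFSet (small_res hA) hY (hfix S κ (Finset.mem_insert_self _ _))
  have hmap : ∀ (S : Set Ordinal.{u}) (Y Z : ZFSet.{u}), ZFSet.pair Y Z ∈ W →
      ZFSet.pair (emb (res A S) Y) (emb (res A S) Z) ∈ W := fun S Y Z h => by
    rw [← emb_pair (small_res hA)]
    refine hF _ (small_res hA) (fun i hi => ?_) (fun c hc => hfix S c (Finset.mem_insert_of_mem hc)) _ h
    obtain ⟨ζ, hζ, h1, -⟩ := hi.1
    rw [h1]
    exact T.lt_block ζ hζ
  obtain ⟨d, hd, hdm⟩ := exists_strictMono_of_infinite ((T.infinite_blocks hκ).sdiff hMf)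
  have hblk : ∀ n, ∃ ζ < κ.cof.ord, res A {d n} = blk (T.block ζ) (T.len ζ (t ζ)) := by
    intro n
    obtain ⟨⟨ζ, hζ, hdζ⟩, hM⟩ := hdm n
    refine ⟨ζ, hζ, ?_⟩
    ext i
    constructor
    · rintro ⟨⟨ξ, hξ, h1, -, h2⟩, h3⟩
      obtain rfl := T.block_injOn hξ hζ (h1.symm.trans (h3.trans hdζ))
      exact ⟨h1, h2⟩
    · rintro ⟨h1, h2⟩
      exact ⟨⟨ζ, hζ, h1, hdζ ▸ hM, h2⟩, h1.trans hdζ.symm⟩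
  have hne : ∀ n, emb (res A {d n}) X ≠ X := by
    intro n h
    obtain ⟨ζ, hζ, heq⟩ := hblk n
    refine (ht ζ hζ).2 ?_
    have h' := ordSet_emb (small_res (S := {d n}) hA) fun y hy => isOrdinal_of_mem hXκ hy
    rw [h] at h'
    rw [← heq, ← h']
  obtain ⟨Y, hY, hYX⟩ : ∃ Y ∈ D, Y ≠ X := by
    by_contra! h
    have : D ⊆ {X} := fun Y hY => ZFSet.mem_singleton.2 (h Y hY)
    have h1 := ZFSet.card_mono this
    rw [ZFSet.card_singleton] at h1
    exact (hDκ.trans_le h1).not_ge (Cardinal.one_le_aleph0.trans hκ.isStrongLimit.aleph0_le)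
  have hembD : ∀ S, emb (res A S) X ∈ D := fun S => by
    rcases htri Y hY X hX hYX with h | h
    · exact (hWmem (hmap S _ _ h)).2
    · exact (hWmem (hmap S _ _ h)).1
  have hinc : ∀ n, ZFSet.pair X (emb (res A {d n}) X) ∈ W := by
    intro n
    refine (htri _ hX _ (hembD _) (hne n).symm).resolve_right fun h => ?_
    -- A downward move would be preserved by the embedding and could be repeated forever.
    refine hdesc (fun k => (emb (res A {d n}))^[k] X) fun k => ?_
    induction k with
    | zero => exact h
    | succ k ih =>
      simp only [Function.iterate_succ_apply'] at ih ⊢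
      exact hmap _ _ _ ih
  -- Applying the tail from `n + 1` to the upward move of `X` by block `d n` compares the images of
  -- `X` under two consecutive tails.
  refine hdesc (fun n => emb (res A {x | ∃ m ≥ n, x = d m}) X) fun n => ?_
  have hlt : ∀ s ∈ ({d n} : Set Ordinal), ∀ t ∈ {x | ∃ m ≥ n + 1, x = d m}, s < t := by
    rintro _ rfl _ ⟨m, hm, rfl⟩
    exact hd (by omega)
  have hsep : Separates _ (res A {d n}) (res A {x | ∃ m ≥ n + 1, x = d m}) := separates_res (by
    rw [Set.disjoint_left]
    exact fun s h1 h2 => (hlt s h1 s h2).false)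
  have hcomp : emb (res A {x | ∃ m ≥ n + 1, x = d m}) (emb (res A {d n}) X) =
      emb (res A {x | ∃ m ≥ n, x = d m}) X := by
    refine ordSet_injOn (κ := κ) (hsub _ (hsub _ hXκ)) (hsub _ hXκ) ?_
    have hs := hsep.emS_emS (small_res hA) (small_res hA)
      ((T.sparse_coords.mono hAc).below_res hlt) (ordSet X)
    rw [ordSet_emb (small_res hA) fun y hy => isOrdinal_of_mem (hsub _ hXκ) hy,
      ordSet_emb (small_res hA) fun y hy => isOrdinal_of_mem hXκ hy,
      ordSet_emb (small_res hA) fun y hy => isOrdinal_of_mem hXκ hy, hs, ← res_union, ← setOf_exists_ge_eq]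
  have := hmap {x | ∃ m ≥ n + 1, x = d m} _ _ (hinc n)
  rwa [hcomp] at this

end SigmaOne

namespace SigmaOne
open Filter Set

/-! ### Injections defined on closed unbounded sets -/

variable {κ : Ordinal.{u}}

/-- Some block has the property that all its iterations of length less than `κ` fix finitely many
given ordinals. -/
theorem exists_block_forall_emO_eq (hκ : IsLimitOfMeasurables κ) {ρ : Ordinal.{u}} (hρ : ρ < κ)
    (F : Finset Ordinal.{u}) :
    ∃ z, ρ < z ∧ z < κ ∧ Meas z ∧ ∀ l < κ, ∀ c ∈ F, emO (blk z l) c = c := by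
  by_contra! hno
  obtain ⟨T⟩ := exists_tower hκ (ρ := ρ)
    (R := fun z d lam => ρ < z → lam 0 < d ∧ ∃ c ∈ F, emO (blk z (lam 0)) c ≠ c) (fun z hz hm => by
      by_cases hρz : ρ < z
      · obtain ⟨l, hl, hc⟩ := hno z hρz hz hm
        exact ⟨max z l + 1, fun _ => l, Order.lt_add_one_iff.2 (le_max_left _ _),
          hκ.add_one_lt (max_lt hz hl), fun _ => ⟨Order.lt_add_one_iff.2 (le_max_right _ _), hc⟩⟩
      · exact ⟨z + 1, fun _ => 0, Order.lt_add_one_iff.2 le_rfl, hκ.add_one_lt hz,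
          fun h => absurd h hρz⟩) hρ
  refine T.infinite_blocks hκ ((F.finite_toSet.biUnion fun c _ =>
    moving_finite T.small_coords T.sparse_coords c).subset ?_)
  rintro _ ⟨ζ, hζ, rfl⟩
  obtain ⟨hlt, c, hc, hne⟩ := T.rel ζ hζ (T.lt_block ζ hζ)
  refine mem_biUnion hc (lt_of_lt_of_le (lt_of_le_of_ne (le_emO inferInstance c) hne.symm) ?_)
  exact emO_mono_set (show blk (T.block ζ) (T.len ζ 0) ⊆ res T.coords {T.block ζ} from
    fun i hi => ⟨⟨ζ, hζ, hi.1, hi.2.trans hlt⟩, hi.1⟩) (small_res T.small_coords) c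

/-- Composing representing functions with an injection of `γ` into `κ` injects the image of `γ` into
that of `κ`, which is `κ`. -/
theorem emO_lt_succCard {A : Set Coord.{u}} (hA : Small.{u} A)
    (h : emO A κ = κ) {γ : Ordinal.{u}} (hγ : γ < succCard κ) : emO A γ < succCard κ := by
  have hle : #(Iio γ) ≤ #(Iio κ) := by
    rw [Cardinal.mk_Iio_ordinal, Cardinal.mk_Iio_ordinal]
    exact Cardinal.lift_le.2 (Order.lt_succ_iff.1 (Cardinal.lt_ord.1 hγ))
  obtain ⟨e⟩ := hle
  let f : Ordinal.{u} → Ordinal.{u} := fun c => if h : c ∈ Iio γ then (e ⟨c, h⟩).1 else 0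
  have hf : ∀ c < γ, f c < κ := fun c hc => by
    simp only [f, dif_pos (mem_Iio.2 hc)]
    exact (e _).2
  have hfi : ∀ c < γ, ∀ c' < γ, f c = f c' → c = c' := fun c hc c' hc' hcc => by
    simp only [f, dif_pos (mem_Iio.2 hc), dif_pos (mem_Iio.2 hc')] at hcc
    exact congrArg Subtype.val (e.injective (Subtype.ext hcc))
  rw [succCard, Cardinal.lt_ord, Order.lt_succ_iff, ← Cardinal.lift_le.{u + 1},
    ← Cardinal.mk_Iio_ordinal, ← Cardinal.mk_Iio_ordinal]
  have key : ∀ c : Iio (emO A γ), ∃ g, Fn A g ∧ (∀ᶠ w in iterFilter, g w < γ) ∧ rk A g = c.1 :=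
    fun c => exists_rk_eq (fn_const hA γ) c.2
  choose g hg hgγ hgc using key
  refine Cardinal.mk_le_of_injective (f := fun c => ⟨rk A fun w => f (g c w), ?_⟩) fun c c' hcc => ?_
  · refine mem_Iio.2 (lt_of_lt_of_eq ((rk_lt_emO_iff ((hg c).comp f)).2 ?_) h)
    filter_upwards [hgγ c] with w hw using hf _ hw
  · have h1 := (rk_eq_iff ((hg c).comp f) ((hg c').comp f)).1 (congrArg (fun y : Iio κ => y.1) hcc)
    apply Subtype.ext
    rw [← hgc c, ← hgc c']
    refine rk_congr (hg c) (hg c') ?_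
    filter_upwards [h1, hgγ c, hgγ c'] with w h2 h3 h4 using hfi _ h3 _ h4 h2

/-- A supremum of a sequence of ordinals that are moved below the next one is fixed. -/
theorem emO_eq_of_iSup {A : Set Coord.{u}} (hA : Small.{u} A) {c : ℕ → Ordinal.{u}} {γ : Ordinal.{u}}
    (hγ : IsLUB (range c) γ) (hc : ∀ n, c n < γ) (h : ∀ n, emO A (c n) ≤ c (n + 1)) :
    emO A γ = γ := by
  refine le_antisymm (le_of_forall_lt fun e he => ?_) (le_emO hA γ)
  obtain ⟨g, hg, hgγ, rfl⟩ := exists_rk_eq (fn_const hA γ) he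
  have hex : ∀ a, ∃ n, a < γ → a < c n := fun a => by
    by_cases ha : a < γ
    · obtain ⟨_, ⟨n, rfl⟩, hn⟩ := (lt_isLUB_iff hγ).1 ha
      exact ⟨n, fun _ => hn⟩
    · exact ⟨0, fun h => absurd h ha⟩
  choose k hk using hex
  -- The natural number locating `g` in the sequence is almost everywhere constant, so `g` stays
  -- below a single `c n`.
  obtain ⟨n, hn⟩ := (hg.comp k).eventually_const fun i _ hm => below_nat hm.isNormal.omega0_lt
  refine lt_of_lt_of_le ((rk_lt_emO_iff hg).2 ?_) ((h n).trans (hc (n + 1)).le)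
  filter_upwards [hgγ, hn] with w h1 h2
  exact h2 ▸ hk _ h1

theorem cof_succCard (hκ : IsLimitOfMeasurables κ) : (succCard κ).cof = Order.succ κ.card :=
  (Cardinal.isRegular_succ hκ.isStrongLimit.aleph0_le).cof_ord

/-- A closed unbounded subset of `κ⁺` contains large ordinals that are fixed by all iterations of
length less than `κ` of a given measure. -/
theorem exists_mem_club_forall_emO_eq (hκ : IsLimitOfMeasurables κ) {C : ZFSet.{u}}
    (hC : IsClubIn C (succCard κ)) {z : Ordinal.{u}} (hz : ∀ l < κ, emO (blk z l) κ = κ)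
    {η : Ordinal.{u}} (hη : η < succCard κ) :
    ∃ γ, η < γ ∧ γ < succCard κ ∧ γ.toZFSet ∈ C ∧ ∀ l < κ, emO (blk z l) γ = γ := by
  have hlim : ∀ {c}, c < succCard κ → c + 1 < succCard κ := fun h =>
    (Cardinal.isSuccLimit_ord (hκ.isStrongLimit.aleph0_le.trans (Order.le_succ _))).add_one_lt h
  -- All `κ` lengths are bounded at once because `κ⁺` is regular.
  have hb : ∀ γ : Iio (succCard κ), ∃ b < succCard κ, ∀ l : Iio κ, emO (blk z l.1) γ.1 ≤ b := fun γ => by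
    refine exists_bound ?_ _ fun l => emO_lt_succCard inferInstance (hz l.1 l.2) γ.2
    rw [cof_succCard hκ, Cardinal.mk_Iio_ordinal]
    exact Cardinal.lift_lt.2 (Order.lt_succ _)
  choose b hb hbl using hb
  have hnext : ∀ γ : Iio (succCard κ), ∃ γ' : Iio (succCard κ), γ'.1.toZFSet ∈ C ∧ γ < γ' ∧ b γ ≤ γ'.1 := by
    intro γ
    obtain ⟨γ', h1, h2⟩ := hC.2.isCofinal ⟨max γ.1 (b γ) + 1, hlim (max_lt γ.2 (hb γ))⟩
    have h3 : max γ.1 (b γ) < γ'.1 := (Order.lt_add_one_iff.2 le_rfl).trans_le h2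
    exact ⟨γ', h1, show γ.1 < γ'.1 from (le_max_left _ _).trans_lt h3, ((le_max_right _ _).trans_lt h3).le⟩
  choose next hn1 hn2 hn3 using hnext
  let c : ℕ → Iio (succCard κ) := fun n => Nat.rec (next ⟨η, hη⟩) (fun _ γ => next γ) n
  have hc : ∀ n, c (n + 1) = next (c n) := fun n => rfl
  have hcC : ∀ n, (c n).1.toZFSet ∈ C := fun n => by
    cases n with
    | zero => exact hn1 _
    | succ n => exact hn1 _
  have hclt : ∀ n, (c n).1 < (c (n + 1)).1 := fun n => hn2 (c n)
  obtain ⟨B, hB, hcB⟩ := exists_bound (ι := ULift.{u + 1} ℕ) (o := succCard κ) (by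
      rw [cof_succCard hκ, Cardinal.mk_uLift, Cardinal.mk_nat, Cardinal.lift_aleph0]
      exact Cardinal.aleph0_lt_lift.2 (hκ.isStrongLimit.aleph0_le.trans_lt (Order.lt_succ _))) (fun n => (c n.down).1) fun n => (c n.down).2
  have hlub : IsLUB (range fun n => (c n).1) (⨆ n, (c n).1) := isLUB_ciSup ⟨B, by
    rintro _ ⟨n, rfl⟩
    exact hcB ⟨n⟩⟩
  have hγ : (⨆ n, (c n).1) < succCard κ := (hlub.2 (by
    rintro _ ⟨n, rfl⟩
    exact hcB ⟨n⟩)).trans_lt hB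
  have hclt' : ∀ n, (c n).1 < ⨆ n, (c n).1 := fun n => (hclt n).trans_le (hlub.1 ⟨n + 1, rfl⟩)
  refine ⟨⨆ n, (c n).1, lt_trans (show η < (c 0).1 from hn2 ⟨η, hη⟩) (hclt' 0), hγ, ?_, fun l hl =>
    emO_eq_of_iSup inferInstance hlub hclt' fun n => (hbl (c n) ⟨l, hl⟩).trans (hn3 (c n))⟩
  refine hC.2.isLUB_mem (t := range c) (x := ⟨_, hγ⟩) ?_ ⟨_, ⟨0, rfl⟩⟩ ⟨?_, fun a ha => ?_⟩
  · rintro _ ⟨n, rfl⟩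
    exact hcC n
  · rintro _ ⟨n, rfl⟩
    exact hlub.1 ⟨n, rfl⟩
  · refine hlub.2 ?_
    rintro _ ⟨n, rfl⟩
    exact ha ⟨n, rfl⟩

/-- Sets that are fixed by all iterations of a measure are determined by a bounded part. -/
theorem eq_of_forall_emS_eq {z : Ordinal.{u}} (hz : Meas z) {x y : Set Ordinal.{u}} (hx : x ⊆ Iio κ)
    (hy : y ⊆ Iio κ) (hκ : IsLimitOfMeasurables κ) (hxl : ∀ l < κ, emS (blk z l) x = x)
    (hyl : ∀ l < κ, emS (blk z l) y = y) (hxy : x ∩ Iio z = y ∩ Iio z) : x = y := by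
  have key : ∀ c < κ, c ∈ x ↔ c ∈ y := fun c hc => by
    have hl := hκ.add_one_lt hc
    -- Length `c + 1` moves `z` beyond `c`, so the membership of `c` in a fixed set is decided by
    -- its part below `z`.
    have hlt : c < emO (blk z (c + 1)) z :=
      (Order.lt_add_one_iff.2 le_rfl).trans_le (le_emO_of_blk_subset inferInstance hz subset_rfl)
    have h1 : c ∈ emS (blk z (c + 1)) (Iio z) := by
      rw [emS_iio inferInstance]; exact hlt
    have h2 := congrArg (fun s => c ∈ emS (blk z (c + 1)) s) hxy
    simp only [emS_inter, mem_inter_iff, h1, and_true, eq_iff_iff] at h2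
    rwa [hxl _ hl, hyl _ hl] at h2
  ext c
  exact ⟨fun h => (key c (hx h)).1 h, fun h => (key c (hy h)).2 h⟩

theorem not_exists_injection_on_club (hκ : IsLimitOfMeasurables κ) {f C : ZFSet.{u}}
    (hdef : IsSigma1Definable (hereditarySets κ ∪ ordinals) {z | z ∈ f})
    (hC : IsClubIn C (succCard κ))
    (hfC : IsInjectiveFunction C κ.toZFSet.powerset (restrict f C)) : False := by
  classical
  obtain ⟨ρ, hρ, F, hF⟩ := hdef.exists_emb_mem hκ
  obtain ⟨z, hρz, hzκ, hz, hfix⟩ := exists_block_forall_emO_eq hκ hρ (insert κ F)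
  have hfixκ : ∀ l < κ, emO (blk z l) κ = κ := fun l hl => hfix l hl κ (Finset.mem_insert_self _ _)
  have hres : ∀ {a b}, a ∈ C → (ZFSet.pair a b ∈ restrict f C ↔ ZFSet.pair a b ∈ f) := fun {a b} ha => by
    rw [restrict, ZFSet.mem_sep]
    exact ⟨fun h => h.1, fun h => ⟨h, a, ha, b, rfl⟩⟩
  let G : Set Ordinal.{u} := {γ | γ < succCard κ ∧ γ.toZFSet ∈ C ∧ ∀ l < κ, emO (blk z l) γ = γ}
  have hy : ∀ γ : G, ∃ y, ZFSet.pair γ.1.toZFSet y ∈ restrict f C ∧ y ⊆ κ.toZFSet ∧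
      ∀ l < κ, emb (blk z l) y = y := by
    rintro ⟨γ, hγ, hγC, hγl⟩
    obtain ⟨y, hy, huniq⟩ := hfC.1.2 _ hγC
    -- The image of the pair is again in `f` with the same first component, so uniqueness of the
    -- value at `γ` makes `y` fixed.
    refine ⟨y, hy, ZFSet.mem_powerset.1 (ZFSet.pair_mem_prod.1 (hfC.1.1 hy)).2, fun l hl => huniq _ ?_⟩
    have := hF (blk z l) inferInstance (fun i hi => hi.1.symm ▸ hρz)
      (fun c hc => hfix l hl c (Finset.mem_insert_of_mem hc)) _ ((hres hγC).1 hy)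
    rw [emb_pair inferInstance, emb_toZFSet inferInstance, hγl l hl] at this
    exact (hres hγC).2 this
  choose y hyf hyκ hyl using hy
  have hinj : #G ≤ #(𝒫 (Iio z)) := by
    refine Cardinal.mk_le_of_injective
      (f := fun γ => ⟨ordSet (y γ) ∩ Iio z, inter_subset_right⟩) fun γ γ' h => ?_
    have h1 : ∀ γ, ∀ l < κ, emS (blk z l) (ordSet (y γ)) = ordSet (y γ) := fun γ l hl => by
      rw [← ordSet_emb inferInstance fun a ha => isOrdinal_of_mem (hyκ γ) ha, hyl γ l hl]
    have h2 := eq_of_forall_emS_eq hz (ordSet_subset (hyκ γ)) (ordSet_subset (hyκ γ')) hκ (h1 γ) (h1 γ')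
      (congrArg (fun s : 𝒫 (Iio z) => s.1) h)
    have h3 := hyf γ
    rw [ordSet_injOn (hyκ γ) (hyκ γ') h2] at h3
    exact Subtype.ext (Ordinal.toZFSet_injective (hfC.2 _ _ _ h3 (hyf γ')))
  -- With at most `2 ^ |z| < κ` elements, `G` is bounded in `κ⁺`, whereas the fixed points in the
  -- club are unbounded.
  obtain ⟨b, hb, hGb⟩ := exists_bound (ι := G) (o := succCard κ) (by
      refine hinj.trans_lt ((mk_powerset_iio_lt hκ.isStrongLimit (by rwa [hκ.ord_card])).trans ?_)
      rw [cof_succCard hκ]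
      exact Cardinal.lift_lt.2 (Order.lt_succ _)) (fun γ => γ.1) fun γ => γ.2.1
  obtain ⟨γ, hbγ, hγ⟩ := exists_mem_club_forall_emO_eq hκ hC hfixκ hb
  exact (hGb ⟨γ, hγ⟩).not_gt hbγ

end SigmaOne

theorem mainTheorem1 (κ : Ordinal.{u}) (hκ : SigmaOne.IsLimitOfMeasurables κ) :
    (∀ D : ZFSet.{u}, D ⊆ κ.toZFSet.powerset → κ.card < D.card →
      SigmaOne.IsSigma1Definable (SigmaOne.hereditarySets κ ∪ SigmaOne.ordinals) {X | X ∈ D} →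
      ∃ ι : SigmaOne.FunSpace κ.cof.ord κ → SigmaOne.PowerSpace κ,
        SigmaOne.IsPerfectEmbedding ι ∧ ∀ x, (ι x).1 ∈ D) ∧
    (¬ ∃ D W : ZFSet.{u}, D ⊆ κ.toZFSet.powerset ∧ κ.card < D.card ∧
      SigmaOne.IsWellorderOf W D ∧
      SigmaOne.IsSigma1Definable (SigmaOne.hereditarySets κ ∪ SigmaOne.ordinals) {z | z ∈ W}) ∧
    (¬ ∃ f C : ZFSet.{u},
      f ⊆ ZFSet.prod (SigmaOne.succCard κ).toZFSet κ.toZFSet.powerset ∧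
      SigmaOne.IsSigma1Definable (SigmaOne.hereditarySets κ ∪ SigmaOne.ordinals) {z | z ∈ f} ∧
      SigmaOne.IsClubIn C (SigmaOne.succCard κ) ∧
      SigmaOne.IsInjectiveFunction C κ.toZFSet.powerset (SigmaOne.restrict f C)) :=
  ⟨fun _ hD hDκ hdef => SigmaOne.exists_perfectEmbedding hκ hD hDκ hdef,
    fun ⟨_, _, hD, hDκ, hW, hdef⟩ => SigmaOne.not_exists_wellorder hκ hD hDκ hW hdef,
    fun ⟨_, _, _, hdef, hC, hfC⟩ => SigmaOne.not_exists_injection_on_club hκ hdef hC hfC⟩
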